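/- **Setting.** Let $k$ be an algebraically closed field of characteristic zero and fix $i\in k$ with $i^2=-1$. Let $\widehat S=k[t^q\mid q\in\mathbb Q]$ with the derivation $\delta=\frac{d}{dt}$ (so $\delta(t^q)=q\,t^{q-1}$), and put $\delta^{(j)}=\delta^j/j!$. Let $\sigma^1=\begin{pmatrix}0&1\\1&0\end{pmatrix}$, $\sigma^2=\begin{pmatrix}0&-i\\i&0\end{pmatrix}$, $\sigma^3=\begin{pmatrix}1&0\\0&-1\end{pmatrix}$ and $J^s=\frac12\sigma^s$. The $N=4$ conformal superalgebra $\mathcal A$ over $k$ is the free $k[\partial]$-module with even generators $L,J^1,J^2,J^3$ and odd generators $G^1,G^2,\overline G^1,\overline G^2$. Its $\lambda$-bracket $[a_\lambda b]=\sum_{n\ge0}\frac{\lambda^n}{n!}a_{(n)}b$ is determined by sesquilinearity, $[\partial a_\lambda b]=-\lambda[a_\lambda b]$ and $[a_\lambda\partial b]=(\partial+\lambda)[a_\lambda b]$, by skew-symmetry, $[a_\lambda b]=-(-1)^{p(a)p(b)}[b_{-\lambda-\partial}a]$, and by $$[L_\lambda L]=(\partial+2\lambda)L,\quad [L_\lambda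 J^s]=(\partial+\lambda)J^s,\quad [L_\lambda G^a]=(\partial+\tfrac32\lambda)G^a,\quad [L_\lambda\overline G^a]=(\partial+\tfrac32\lambda)\overline G^a,$$ $$[J^m{}_\lambda J^n]=J^mJ^n-J^nJ^m,\quad [J^s{}_\lambda G^a]=-\tfrac12\sum_b\sigma^s_{ab}G^b,\quad [J^s{}_\lambda\overline G^a]=\tfrac12\sum_b\sigma^s_{ba}\overline G^b,$$ $$[G^a{}_\lambda G^b]=[\overline G^a{}_\lambda\overline G^b]=0,\quad [G^a{}_\lambda\overline G^b]=2\delta_{ab}L-2(\partial+2\lambda)\sum_s\sigma^s_{ab}J^s .$$ On $\mathcal A\otimes_k\widehat S$ the derivation is $\partial\otimes1+1\otimes\delta$, the grading is the one of $\mathcal A$, and the $n$-products are $(a\otimes r)_{(n)}(b\otimes s)=\sum_{j\ge0}(a_{(n+j)}b)\otimes\delta^{(j)}(r)s$. Let $\mathrm{Aut}_{\widehat{\mathcal S}}(\mathcal A\otimes_k\widehat S)$ be the group of bijective $\widehat S$-linear parity-preserving maps $\mathcal A\otimes_k\widehat S\to\mathcal A\otimes_k\widehat S$ that respect all $n$-products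 and commute with the derivation. Identify $\mathfrak{sl}_2(\widehat S)$ with $\bigoplus_s J^s\otimes\widehat S$, and for $v=(v_1,v_2)^T\in\widehat S^2$ write $G(v)=G^1\otimes v_1+G^2\otimes v_2$ and $\overline G(v)=\overline G^1\otimes v_1+\overline G^2\otimes v_2$. Let $\varepsilon=\begin{pmatrix}0&1\\-1&0\end{pmatrix}$, and let $Y'$ denote the entrywise derivative of a matrix $Y$. **Proposition.** There is a unique group isomorphism $$\Phi:\ \frac{\mathbf{SL}_2(\widehat S)\times\mathbf{SL}_2(k)}{\langle(-I,-I)\rangle}\ \longrightarrow\ \mathrm{Aut}_{\widehat{\mathcal S}}(\mathcal A\otimes_k\widehat S)$$ such that for all $Y\in\mathbf{SL}_2(\widehat S)$ and $X=\begin{pmatrix}c&-e\\d&f\end{pmatrix}\in\mathbf{SL}_2(k)$ the automorphism $\sigma=\Phi(Y,X)$ satisfies $$\sigma(L\otimes1)=L\otimes1+Y'Y^{-1},\qquad \sigma(J^s\otimes1)=YJ^sY^{-1}\quad(s=1,2,3),$$ $$\sigma(G(v))=c\,G\big((Y^{-1})^Tv\big)+d\,\overline G\big(Y\varepsilon v\big),\qquad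 \sigma(\overline G(v))=e\,G\big((Y^{-1})^T\varepsilon v\big)+f\,\overline G\big(Yv\big)$$ for all $v\in\widehat S^2$. In particular every automorphism is given by these formulas for some pair $(Y,X)$, and every such pair defines an automorphism. -/

import Mathlib

open scoped TensorProduct Polynomial Matrix MatrixGroups

noncomputable section

namespace ConformalSuper

/-! ### Differential rings and conformal superalgebras -/

section Basic

variable {k S : Type*} [Field k] [CommRing S] [Algebra k S]

/-- The divided power `δ^(j) = δ^j / j!` of a `k`-linear derivation `δ` of `S`. -/
def dpow (δ : Derivation k S S) (j : ℕ) : S →ₗ[k] S :=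
  ((j.factorial : k)⁻¹) • ((δ : S →ₗ[k] S) ^ j)

theorem dpow_zero_apply (δ : Derivation k S S) (r : S) : dpow δ 0 r = r := by
  simp [dpow]

theorem succ_smul_dpow_succ [CharZero k] (δ : Derivation k S S) (j : ℕ) (r : S) :
    ((j : k) + 1) • dpow δ (j + 1) r = δ (dpow δ j r) := by
  have h : ((j : k) + 1) ≠ 0 := by exact_mod_cast Nat.succ_ne_zero j
  have h2 : ((j.factorial : ℕ) : k) ≠ 0 := by exact_mod_cast j.factorial_ne_zero
  simp only [dpow, LinearMap.smul_apply, pow_succ', Module.End.mul_apply, Nat.factorial_succ,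
    Nat.cast_mul, Nat.cast_succ, smul_smul, Derivation.coeFn_coe, Derivation.map_smul]
  congr 1
  field_simp

theorem succ_smul_dpow_succ' [CharZero k] (δ : Derivation k S S) (j : ℕ) (r : S) :
    ((j : k) + 1) • dpow δ (j + 1) r = dpow δ j (δ r) := by
  rw [succ_smul_dpow_succ]
  simp only [dpow, LinearMap.smul_apply, Derivation.map_smul]
  congr 1
  have := LinearMap.congr_fun ((Commute.refl (δ : S →ₗ[k] S)).pow_right j).eq r
  simpa using this

theorem dpow_mul [CharZero k] (δ : Derivation k S S) (m : ℕ) (r s : S) :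
    dpow δ m (r * s) = ∑ p ∈ Finset.HasAntidiagonal.antidiagonal m, dpow δ p.1 r * dpow δ p.2 s := by
  induction m with
  | zero => simp [dpow_zero_apply]
  | succ m ih =>
    have h : ((m : k) + 1) ≠ 0 := by exact_mod_cast Nat.succ_ne_zero m
    apply (smul_right_injective S h)
    simp only
    rw [succ_smul_dpow_succ, ih, map_sum, Finset.smul_sum]
    have e : ∀ p ∈ Finset.HasAntidiagonal.antidiagonal (m + 1),
        ((m : k) + 1) • (dpow δ p.1 r * dpow δ p.2 s)
          = (p.1 : k) • (dpow δ p.1 r * dpow δ p.2 s)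
            + (p.2 : k) • (dpow δ p.1 r * dpow δ p.2 s) := by
      intro p hp
      rw [← add_smul]
      congr 1
      have := Finset.HasAntidiagonal.mem_antidiagonal.1 hp
      exact_mod_cast this.symm
    rw [Finset.sum_congr rfl e, Finset.sum_add_distrib, Finset.Nat.sum_antidiagonal_succ,
      Finset.Nat.sum_antidiagonal_succ']
    simp only [Nat.cast_zero, zero_smul, zero_add, Nat.cast_succ]
    rw [← Finset.sum_add_distrib]
    refine Finset.sum_congr rfl fun p _ => ?_
    rw [← smul_mul_assoc, ← mul_smul_comm, succ_smul_dpow_succ, succ_smul_dpow_succ,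
      Derivation.leibniz]
    simp only [smul_eq_mul]
    ring

/-- A conformal superalgebra over the differential `k`-ring `(S, δ)`, with underlying `S`-module
`A`: a `ℤ/2`-grading of `A` by `S`-submodules, an even `k`-linear endomorphism `der`, and
`k`-bilinear `n`-products `a_(n) b` for `n ≥ 0`. The sums over all `j ≥ 0` are finite because of
`nProd_eventually_zero`. -/
structure ConformalSuperalgebra (δ : Derivation k S S)
    (A : Type*) [AddCommGroup A] [Module k A] [Module S A] [IsScalarTower k S A] where
  parity : ZMod 2 → Submodule S A
  parity_isCompl : IsCompl (parity 0) (parity 1)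
  der : A →ₗ[k] A
  der_mem : ∀ p, ∀ a ∈ parity p, der a ∈ parity p
  nProd : ℕ → A →ₗ[k] A →ₗ[k] A
  nProd_mem : ∀ n p q, ∀ a ∈ parity p, ∀ b ∈ parity q, nProd n a b ∈ parity (p + q)
  nProd_eventually_zero : ∀ a b, ∃ N, ∀ n ≥ N, nProd n a b = 0
  nProd_der_left : ∀ n a b, nProd n (der a) b = -((n : k) • nProd (n - 1) a b)
  nProd_der_right : ∀ n a b,
    nProd n a (der b) = der (nProd n a b) + (n : k) • nProd (n - 1) a b
  der_smul : ∀ (r : S) a, der (r • a) = r • der a + δ r • a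
  nProd_smul_right : ∀ n (r : S) a b, nProd n a (r • b) = r • nProd n a b
  nProd_smul_left : ∀ n (r : S) a b,
    nProd n (r • a) b = ∑ᶠ j : ℕ, dpow δ j r • nProd (n + j) a b

namespace ConformalSuperalgebra

variable {δ : Derivation k S S} {A : Type*} [AddCommGroup A] [Module k A] [Module S A]
  [IsScalarTower k S A]

/-- The group of automorphisms of a conformal superalgebra over `(S, δ)`: the bijective `S`-linear
maps that preserve the parity, respect all `n`-products and commute with the derivation. -/
def Aut (𝒜 : ConformalSuperalgebra δ A) : Subgroup (A ≃ₗ[S] A) where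
  carrier := {σ | (∀ p, ∀ a ∈ 𝒜.parity p, σ a ∈ 𝒜.parity p) ∧
    (∀ n a b, σ (𝒜.nProd n a b) = 𝒜.nProd n (σ a) (σ b)) ∧
    (∀ a, σ (𝒜.der a) = 𝒜.der (σ a))}
  one_mem' := ⟨fun _ _ h => h, fun _ _ _ => rfl, fun _ => rfl⟩
  mul_mem' := by
    rintro σ τ ⟨h1, h2, h3⟩ ⟨g1, g2, g3⟩
    refine ⟨fun p a ha => h1 p _ (g1 p a ha), fun n a b => ?_, fun a => ?_⟩
    · simp only [LinearEquiv.mul_apply, g2, h2]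
    · simp only [LinearEquiv.mul_apply, g3, h3]
  inv_mem' := by
    rintro σ ⟨h1, h2, h3⟩
    have key : ∀ p q, IsCompl (𝒜.parity p) (𝒜.parity q) →
        ∀ a ∈ 𝒜.parity p, σ⁻¹ a ∈ 𝒜.parity p := by
      intro p q hpq a ha
      obtain ⟨x, hx, y, hy, hxy⟩ := Submodule.mem_sup.1
        (hpq.sup_eq_top ▸ Submodule.mem_top : σ⁻¹ a ∈ 𝒜.parity p ⊔ 𝒜.parity q)
      have e : σ y = a - σ x := by
        rw [eq_sub_iff_add_eq, add_comm, ← map_add, hxy]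
        exact σ.apply_symm_apply a
      have hz : σ y = 0 := (Submodule.disjoint_def.1 hpq.disjoint) _
        (e ▸ Submodule.sub_mem _ ha (h1 p x hx)) (h1 q y hy)
      have hy0 : y = 0 := by simpa using hz
      rw [← hxy, hy0, add_zero]
      exact hx
    refine ⟨fun p => ?_, fun n a b => ?_, fun a => ?_⟩
    · fin_cases p
      · exact key 0 1 𝒜.parity_isCompl
      · exact key 1 0 𝒜.parity_isCompl.symm
    · apply σ.injective
      rw [h2]
      change σ (σ.symm _) = 𝒜.nProd n (σ (σ.symm a)) (σ (σ.symm b))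
      simp
    · apply σ.injective
      rw [h3]
      change σ (σ.symm _) = 𝒜.der (σ (σ.symm a))
      simp

end ConformalSuperalgebra

end Basic

/-! ### Base change of a conformal superalgebra over `k` to a differential `k`-ring -/

theorem finsum_eq_sum_range {M : Type*} [AddCommMonoid M] {f : ℕ → M} {N : ℕ}
    (h : ∀ n ≥ N, f n = 0) : ∑ᶠ j, f j = ∑ j ∈ Finset.range N, f j := by
  apply finsum_eq_sum_of_support_subset
  intro j hj
  by_contra hc
  exact hj (h j (by simpa using hc))

namespace ConformalSuperalgebra

section BaseChange

variable {k A S : Type*} [Field k] [AddCommGroup A] [Module k A]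
  [CommRing S] [Algebra k S]

/-- The `j`-th summand of the `n`-product after base change:
`(r ⊗ a, s ⊗ b) ↦ δ^(j)(r) s ⊗ a_(n+j) b`. -/
def bcTerm (𝒜 : ConformalSuperalgebra (0 : Derivation k k k) A) (δ : Derivation k S S)
    (n j : ℕ) : S ⊗[k] A →ₗ[k] S ⊗[k] A →ₗ[k] S ⊗[k] A :=
  TensorProduct.map₂ ((LinearMap.mul k S) ∘ₗ dpow δ j) (𝒜.nProd (n + j))

theorem bcTerm_tmul (𝒜 : ConformalSuperalgebra (0 : Derivation k k k) A) (δ : Derivation k S S)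
    (n j : ℕ) (r s : S) (a b : A) :
    bcTerm 𝒜 δ n j (r ⊗ₜ a) (s ⊗ₜ b) = (dpow δ j r * s) ⊗ₜ 𝒜.nProd (n + j) a b := rfl

theorem bcTerm_eventually (𝒜 : ConformalSuperalgebra (0 : Derivation k k k) A)
    (δ : Derivation k S S) (x y : S ⊗[k] A) :
    ∃ N, ∀ n j, N ≤ n + j → bcTerm 𝒜 δ n j x y = 0 := by
  induction x using TensorProduct.induction_on with
  | zero => exact ⟨0, by simp⟩
  | add x x' hx hx' =>
    obtain ⟨N, h⟩ := hx
    obtain ⟨N', h'⟩ := hx'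
    refine ⟨max N N', fun n j hj => ?_⟩
    rw [map_add, LinearMap.add_apply, h n j (le_trans (le_max_left _ _) hj),
      h' n j (le_trans (le_max_right _ _) hj), add_zero]
  | tmul r a =>
    induction y using TensorProduct.induction_on with
    | zero => exact ⟨0, by simp⟩
    | add x x' hx hx' =>
      obtain ⟨N, h⟩ := hx
      obtain ⟨N', h'⟩ := hx'
      refine ⟨max N N', fun n j hj => ?_⟩
      rw [map_add, h n j (le_trans (le_max_left _ _) hj),
        h' n j (le_trans (le_max_right _ _) hj), add_zero]
    | tmul s b =>
      obtain ⟨N, h⟩ := 𝒜.nProd_eventually_zero a b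
      exact ⟨N, fun n j hj => by rw [bcTerm_tmul, h _ hj, TensorProduct.tmul_zero]⟩

theorem bcTerm_support (𝒜 : ConformalSuperalgebra (0 : Derivation k k k) A)
    (δ : Derivation k S S) (n : ℕ) (x y : S ⊗[k] A) :
    (Function.support fun j => bcTerm 𝒜 δ n j x y).Finite := by
  obtain ⟨N, h⟩ := bcTerm_eventually 𝒜 δ x y
  refine (Finset.finite_toSet (Finset.range N)).subset fun j hj => ?_
  by_contra hc
  exact hj (h n j (by have : N ≤ j := by simpa using hc
                      omega))

/-- The `n`-product of the base change:
`(r ⊗ a)_(n) (s ⊗ b) = ∑_{j ≥ 0} δ^(j)(r) s ⊗ a_(n+j) b`, extended bilinearly. -/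
def bcProd (𝒜 : ConformalSuperalgebra (0 : Derivation k k k) A) (δ : Derivation k S S)
    (n : ℕ) : S ⊗[k] A →ₗ[k] S ⊗[k] A →ₗ[k] S ⊗[k] A :=
  LinearMap.mk₂ k (fun x y => ∑ᶠ j : ℕ, bcTerm 𝒜 δ n j x y)
    (fun x x' y => by
      simp only [map_add, LinearMap.add_apply]
      exact finsum_add_distrib (bcTerm_support 𝒜 δ n x y) (bcTerm_support 𝒜 δ n x' y))
    (fun c x y => by
      simp only [map_smul, LinearMap.smul_apply]
      exact (smul_finsum' c (bcTerm_support 𝒜 δ n x y)).symm)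
    (fun x y y' => by
      simp only [map_add]
      exact finsum_add_distrib (bcTerm_support 𝒜 δ n x y) (bcTerm_support 𝒜 δ n x y'))
    (fun c x y => by
      simp only [map_smul]
      exact (smul_finsum' c (bcTerm_support 𝒜 δ n x y)).symm)

theorem bcProd_tmul (𝒜 : ConformalSuperalgebra (0 : Derivation k k k) A) (δ : Derivation k S S)
    (n : ℕ) (r s : S) (a b : A) {N : ℕ} (hN : ∀ m ≥ N, 𝒜.nProd m a b = 0) {M : ℕ}
    (hM : N ≤ n + M) :
    bcProd 𝒜 δ n (r ⊗ₜ a) (s ⊗ₜ b)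
      = ∑ j ∈ Finset.range M, (dpow δ j r * s) ⊗ₜ[k] 𝒜.nProd (n + j) a b := by
  refine finsum_eq_sum_range (f := fun j => bcTerm 𝒜 δ n j (r ⊗ₜ a) (s ⊗ₜ b)) fun j hj => ?_
  simp only [bcTerm_tmul]
  rw [hN _ (by omega), TensorProduct.tmul_zero]

/-- The derivation of the base change: `r ⊗ a ↦ r ⊗ ∂ a + δ r ⊗ a`. -/
def bcDer (𝒜 : ConformalSuperalgebra (0 : Derivation k k k) A) (δ : Derivation k S S) :
    S ⊗[k] A →ₗ[k] S ⊗[k] A :=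
  TensorProduct.map LinearMap.id 𝒜.der + TensorProduct.map (δ : S →ₗ[k] S) LinearMap.id

theorem bcDer_tmul (𝒜 : ConformalSuperalgebra (0 : Derivation k k k) A) (δ : Derivation k S S)
    (r : S) (a : A) : bcDer 𝒜 δ (r ⊗ₜ a) = r ⊗ₜ 𝒜.der a + δ r ⊗ₜ a := rfl

theorem bcProd_eventually (𝒜 : ConformalSuperalgebra (0 : Derivation k k k) A)
    (δ : Derivation k S S) (x y : S ⊗[k] A) : ∃ N, ∀ n ≥ N, bcProd 𝒜 δ n x y = 0 := by
  obtain ⟨N, h⟩ := bcTerm_eventually 𝒜 δ x y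
  refine ⟨N, fun n hn => ?_⟩
  refine (finsum_congr (g := fun _ => 0) fun j => h n j (by omega)).trans finsum_zero

theorem bcProd_der_left [CharZero k] (𝒜 : ConformalSuperalgebra (0 : Derivation k k k) A)
    (δ : Derivation k S S) (n : ℕ) (x y : S ⊗[k] A) :
    bcProd 𝒜 δ n (bcDer 𝒜 δ x) y = -((n : k) • bcProd 𝒜 δ (n - 1) x y) := by
  induction x using TensorProduct.induction_on with
  | zero => simp
  | add x x' hx hx' => simp only [map_add, LinearMap.add_apply, hx, hx', smul_add, neg_add]
  | tmul r a =>
    induction y using TensorProduct.induction_on with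
    | zero => simp
    | add x x' hx hx' => simp only [map_add, hx, hx', smul_add, neg_add]
    | tmul s b =>
      obtain ⟨N, h⟩ := 𝒜.nProd_eventually_zero a b
      have h' : ∀ m ≥ N + 1, 𝒜.nProd m (𝒜.der a) b = 0 := fun m hm => by
        rw [𝒜.nProd_der_left, h _ (by omega), smul_zero, neg_zero]
      rw [bcDer_tmul, map_add, LinearMap.add_apply,
        bcProd_tmul 𝒜 δ n r s (𝒜.der a) b h' (M := N + 1) (by omega),
        bcProd_tmul 𝒜 δ n (δ r) s a b h (M := N) (by omega),
        bcProd_tmul 𝒜 δ (n - 1) r s a b h (M := N + 1) (by omega),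
        Finset.sum_range_succ', Finset.sum_range_succ' _ N, add_right_comm,
        ← Finset.sum_add_distrib, smul_add, neg_add, Finset.smul_sum, ← Finset.sum_neg_distrib]
      congr 1
      · refine Finset.sum_congr rfl fun j _ => ?_
        rw [𝒜.nProd_der_left, ← succ_smul_dpow_succ', smul_mul_assoc, TensorProduct.smul_tmul,
          ← TensorProduct.tmul_add]
        rcases n with _ | n
        · simp
        · have e1 : n + 1 + (j + 1) - 1 = n + 1 + j := by omega
          have e2 : n + 1 - 1 + (j + 1) = n + 1 + j := by omega
          rw [e1, e2, ← TensorProduct.tmul_smul, ← TensorProduct.tmul_neg]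
          congr 1
          push_cast
          module
      · simp only [add_zero, 𝒜.nProd_der_left]
        rw [TensorProduct.tmul_neg, TensorProduct.tmul_smul]

theorem bcProd_der_right (𝒜 : ConformalSuperalgebra (0 : Derivation k k k) A)
    [CharZero k] (δ : Derivation k S S) (n : ℕ) (x y : S ⊗[k] A) :
    bcProd 𝒜 δ n x (bcDer 𝒜 δ y)
      = bcDer 𝒜 δ (bcProd 𝒜 δ n x y) + (n : k) • bcProd 𝒜 δ (n - 1) x y := by
  induction x using TensorProduct.induction_on with
  | zero => simp
  | add x x' hx hx' =>
    simp only [map_add, LinearMap.add_apply, hx, hx', smul_add]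
    abel
  | tmul r a =>
    induction y using TensorProduct.induction_on with
    | zero => simp
    | add x x' hx hx' =>
      simp only [map_add, hx, hx', smul_add]
      abel
    | tmul s b =>
      obtain ⟨N, h⟩ := 𝒜.nProd_eventually_zero a b
      have h' : ∀ m ≥ N + 1, 𝒜.nProd m a (𝒜.der b) = 0 := fun m hm => by
        rw [𝒜.nProd_der_right, h _ (by omega), h _ (by omega), smul_zero, map_zero, add_zero]
      rw [bcDer_tmul, map_add,
        bcProd_tmul 𝒜 δ n r s a (𝒜.der b) h' (M := N + 1) (by omega),
        bcProd_tmul 𝒜 δ n r (δ s) a b h (M := N + 1) (by omega),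
        bcProd_tmul 𝒜 δ n r s a b h (M := N + 1) (by omega),
        bcProd_tmul 𝒜 δ (n - 1) r s a b h (M := N + 2) (by omega),
        map_sum]
      have e : ∀ j ∈ Finset.range (N + 1),
          (dpow δ j r * s) ⊗ₜ[k] 𝒜.nProd (n + j) a (𝒜.der b)
            + (dpow δ j r * δ s) ⊗ₜ[k] 𝒜.nProd (n + j) a b
          = bcDer 𝒜 δ ((dpow δ j r * s) ⊗ₜ[k] 𝒜.nProd (n + j) a b)
            + (((n : k) + j) • ((dpow δ j r * s) ⊗ₜ[k] 𝒜.nProd (n + j - 1) a b)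
            - ((j : k) + 1) • ((dpow δ (j + 1) r * s) ⊗ₜ[k] 𝒜.nProd (n + j) a b)) := by
        intro j _
        rw [bcDer_tmul, 𝒜.nProd_der_right, Derivation.leibniz, ← succ_smul_dpow_succ]
        simp only [TensorProduct.tmul_add, TensorProduct.add_tmul, TensorProduct.tmul_smul,
          smul_eq_mul, Nat.cast_add, mul_smul_comm, ← TensorProduct.smul_tmul']
        rw [mul_comm s]
        abel
      rw [← Finset.sum_add_distrib, Finset.sum_congr rfl e, Finset.sum_add_distrib]
      congr 1
      have f : ∀ j : ℕ, ((n : k) + j) • ((dpow δ j r * s) ⊗ₜ[k] 𝒜.nProd (n + j - 1) a b)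
            - ((j : k) + 1) • ((dpow δ (j + 1) r * s) ⊗ₜ[k] 𝒜.nProd (n + j) a b)
          = (n : k) • ((dpow δ j r * s) ⊗ₜ[k] 𝒜.nProd (n - 1 + j) a b)
            - (((j + 1 : ℕ) : k) • ((dpow δ (j + 1) r * s) ⊗ₜ[k] 𝒜.nProd (n + (j + 1) - 1) a b)
              - (j : k) • ((dpow δ j r * s) ⊗ₜ[k] 𝒜.nProd (n + j - 1) a b)) := by
        intro j
        have e0 : n + (j + 1) - 1 = n + j := by omega
        rw [e0]
        rcases n with _ | n
        · push_cast
          module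
        · have e1 : n + 1 - 1 + j = n + 1 + j - 1 := by omega
          rw [e1]
          push_cast
          module
      rw [Finset.sum_congr rfl fun j _ => f j, Finset.sum_sub_distrib,
        Finset.sum_range_sub (fun j => (j : k) • ((dpow δ j r * s) ⊗ₜ[k]
          𝒜.nProd (n + j - 1) a b)), Finset.smul_sum, Finset.sum_range_succ _ (N + 1)]
      have z1 : 𝒜.nProd (n + (N + 1) - 1) a b = 0 := h _ (by omega)
      rcases n with _ | n
      · simp at z1
        simp [z1]
      · have z2 : 𝒜.nProd (n + 1 - 1 + (N + 1)) a b = 0 := h _ (by omega)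
        rw [z1, z2]
        simp

theorem bcDer_smul (𝒜 : ConformalSuperalgebra (0 : Derivation k k k) A)
    (δ : Derivation k S S) (r : S) (x : S ⊗[k] A) :
    bcDer 𝒜 δ (r • x) = r • bcDer 𝒜 δ x + δ r • x := by
  induction x using TensorProduct.induction_on with
  | zero => simp
  | add x x' hx hx' =>
    simp only [map_add, hx, hx', smul_add]
    abel
  | tmul s a =>
    simp only [TensorProduct.smul_tmul', bcDer_tmul, smul_eq_mul, Derivation.leibniz, smul_add,
      TensorProduct.add_tmul]
    rw [mul_comm s]
    abel

theorem bcProd_smul_right (𝒜 : ConformalSuperalgebra (0 : Derivation k k k) A)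
    (δ : Derivation k S S) (n : ℕ) (r : S) (x y : S ⊗[k] A) :
    bcProd 𝒜 δ n x (r • y) = r • bcProd 𝒜 δ n x y := by
  induction x using TensorProduct.induction_on with
  | zero => simp
  | add x x' hx hx' => simp only [map_add, LinearMap.add_apply, hx, hx', smul_add]
  | tmul s a =>
    induction y using TensorProduct.induction_on with
    | zero => simp
    | add x x' hx hx' => simp only [map_add, hx, hx', smul_add]
    | tmul s' b =>
      obtain ⟨N, h⟩ := 𝒜.nProd_eventually_zero a b
      rw [TensorProduct.smul_tmul', bcProd_tmul 𝒜 δ n s _ a b h (M := N) (by omega),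
        bcProd_tmul 𝒜 δ n s _ a b h (M := N) (by omega), Finset.smul_sum]
      refine Finset.sum_congr rfl fun j _ => ?_
      rw [TensorProduct.smul_tmul', smul_eq_mul, smul_eq_mul, mul_left_comm]

theorem bcProd_smul_left_aux [CharZero k] (𝒜 : ConformalSuperalgebra (0 : Derivation k k k) A)
    (δ : Derivation k S S) (n : ℕ) (r : S) (x y : S ⊗[k] A) :
    ∃ N₀, ∀ N ≥ N₀, bcProd 𝒜 δ n (r • x) y
      = ∑ j ∈ Finset.range N, dpow δ j r • bcProd 𝒜 δ (n + j) x y := by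
  induction x using TensorProduct.induction_on with
  | zero => exact ⟨0, by simp⟩
  | add x x' hx hx' =>
    obtain ⟨N, h⟩ := hx
    obtain ⟨N', h'⟩ := hx'
    refine ⟨max N N', fun M hM => ?_⟩
    simp only [smul_add, map_add, LinearMap.add_apply, Finset.sum_add_distrib]
    rw [h M (le_trans (le_max_left _ _) hM), h' M (le_trans (le_max_right _ _) hM)]
  | tmul s a =>
    induction y using TensorProduct.induction_on with
    | zero => exact ⟨0, by simp⟩
    | add x x' hx hx' =>
      obtain ⟨N, h⟩ := hx
      obtain ⟨N', h'⟩ := hx'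
      refine ⟨max N N', fun M hM => ?_⟩
      simp only [smul_add, map_add, Finset.sum_add_distrib]
      rw [h M (le_trans (le_max_left _ _) hM), h' M (le_trans (le_max_right _ _) hM)]
    | tmul s' b =>
      obtain ⟨N, h⟩ := 𝒜.nProd_eventually_zero a b
      refine ⟨N, fun M hM => ?_⟩
      rw [TensorProduct.smul_tmul', bcProd_tmul 𝒜 δ n _ s' a b h (M := M) (by omega)]
      have e : ∀ j ∈ Finset.range M, dpow δ j r • bcProd 𝒜 δ (n + j) (s ⊗ₜ a) (s' ⊗ₜ b)
          = ∑ i ∈ Finset.range (M - j),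
            (dpow δ j r * dpow δ i s * s') ⊗ₜ[k] 𝒜.nProd (n + (j + i)) a b := by
        intro j hj
        rw [bcProd_tmul 𝒜 δ (n + j) s s' a b h (M := M - j) (by omega), Finset.smul_sum]
        refine Finset.sum_congr rfl fun i _ => ?_
        rw [TensorProduct.smul_tmul', smul_eq_mul, mul_assoc, add_assoc]
      rw [Finset.sum_congr rfl e, Finset.sum_sigma']
      simp only [smul_eq_mul, dpow_mul, Finset.sum_mul, TensorProduct.sum_tmul]
      rw [Finset.sum_sigma']
      refine Finset.sum_bij' (fun p _ => ⟨p.2.1, p.2.2⟩) (fun p _ => ⟨p.1 + p.2, (p.1, p.2)⟩)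
        ?_ ?_ ?_ ?_ ?_
      · rintro ⟨m, i, j⟩ hp
        simp only [Finset.mem_sigma, Finset.mem_range, Finset.HasAntidiagonal.mem_antidiagonal] at hp ⊢
        omega
      · rintro ⟨i, j⟩ hp
        simp only [Finset.mem_sigma, Finset.mem_range, Finset.HasAntidiagonal.mem_antidiagonal] at hp ⊢
        exact ⟨by omega, trivial⟩
      · rintro ⟨m, i, j⟩ hp
        simp only [Finset.mem_sigma, Finset.mem_range, Finset.HasAntidiagonal.mem_antidiagonal] at hp
        obtain ⟨_, rfl⟩ := hp
        rfl
      · rintro ⟨i, j⟩ hp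
        rfl
      · rintro ⟨m, i, j⟩ hp
        simp only [Finset.mem_sigma, Finset.mem_range, Finset.HasAntidiagonal.mem_antidiagonal] at hp
        obtain ⟨_, rfl⟩ := hp
        rfl

theorem bcProd_smul_left [CharZero k] (𝒜 : ConformalSuperalgebra (0 : Derivation k k k) A)
    (δ : Derivation k S S) (n : ℕ) (r : S) (x y : S ⊗[k] A) :
    bcProd 𝒜 δ n (r • x) y = ∑ᶠ j : ℕ, dpow δ j r • bcProd 𝒜 δ (n + j) x y := by
  obtain ⟨N₀, h⟩ := bcProd_smul_left_aux 𝒜 δ n r x y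
  obtain ⟨N₁, h'⟩ := bcProd_eventually 𝒜 δ x y
  rw [finsum_eq_sum_range (N := max N₀ N₁) fun j hj => ?_, h _ (le_max_left _ _)]
  rw [h' _ (by have := le_trans (le_max_right N₀ N₁) hj
               omega), smul_zero]

theorem baseChange_disjoint {P Q : Submodule k A} (h : IsCompl P Q) :
    Disjoint (P.baseChange S) (Q.baseChange S) := by
  rw [Submodule.disjoint_def]
  intro x hx hy
  have key : ∀ {P Q : Submodule k A} (h : IsCompl P Q), ∀ x ∈ P.baseChange S,
      (Q.projection P h.symm).baseChange S x = 0 := by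
    intro P Q h x hx
    rw [Submodule.baseChange_eq_span] at hx
    induction hx using Submodule.span_induction with
    | zero => simp
    | add x y _ _ hx hy => rw [map_add, hx, hy, add_zero]
    | smul r x _ hx => rw [map_smul, hx, smul_zero]
    | mem x hx =>
      obtain ⟨a, ha, rfl⟩ := hx
      simp only [TensorProduct.mk_apply, LinearMap.baseChange_tmul]
      rw [(Submodule.projection_apply_eq_zero_iff h.symm).2 ha, TensorProduct.tmul_zero]
  have e : (P.projection Q h).baseChange S + (Q.projection P h.symm).baseChange S = LinearMap.id := by
    rw [← LinearMap.baseChange_add, Submodule.projection_add_projection_eq_id]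
    exact LinearMap.baseChange_id
  have := LinearMap.congr_fun e x
  rw [LinearMap.add_apply, key h x hx, key h.symm x hy] at this
  simpa using this.symm

/-- The base change `𝒜 ⊗_k (S, δ)` of a conformal superalgebra `𝒜` over `k` (with its zero
derivation) to the differential `k`-ring `(S, δ)`; it is a conformal superalgebra over `(S, δ)`.
The underlying `S`-module is written `S ⊗[k] A`. -/
def baseChange [CharZero k] (𝒜 : ConformalSuperalgebra (0 : Derivation k k k) A)
    (δ : Derivation k S S) : ConformalSuperalgebra δ (S ⊗[k] A) where
  parity p := (𝒜.parity p).baseChange S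
  parity_isCompl := by
    refine ⟨baseChange_disjoint 𝒜.parity_isCompl, ?_⟩
    rw [codisjoint_iff, eq_top_iff]
    rintro x -
    induction x using TensorProduct.induction_on with
    | zero => exact Submodule.zero_mem _
    | add x y hx hy => exact Submodule.add_mem _ hx hy
    | tmul r a =>
      obtain ⟨u, hu, v, hv, rfl⟩ := Submodule.mem_sup.1
        (𝒜.parity_isCompl.sup_eq_top ▸ Submodule.mem_top : a ∈ 𝒜.parity 0 ⊔ 𝒜.parity 1)
      rw [TensorProduct.tmul_add]
      exact Submodule.add_mem _
        (Submodule.mem_sup_left (Submodule.tmul_mem_baseChange_of_mem r hu))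
        (Submodule.mem_sup_right (Submodule.tmul_mem_baseChange_of_mem r hv))
  der := bcDer 𝒜 δ
  der_mem p x hx := by
    rw [Submodule.baseChange_eq_span] at hx
    induction hx using Submodule.span_induction with
    | zero => simp
    | add x y _ _ hx hy =>
      rw [map_add]
      exact Submodule.add_mem _ hx hy
    | smul r x h1 hx =>
      rw [← Submodule.baseChange_eq_span] at h1
      rw [bcDer_smul]
      exact Submodule.add_mem _ (Submodule.smul_mem _ _ hx) (Submodule.smul_mem _ _ h1)
    | mem x h =>
      obtain ⟨a, ha, rfl⟩ := h
      rw [TensorProduct.mk_apply, bcDer_tmul]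
      exact Submodule.add_mem _ (Submodule.tmul_mem_baseChange_of_mem _ (𝒜.der_mem p a ha))
        (Submodule.tmul_mem_baseChange_of_mem _ ha)
  nProd := bcProd 𝒜 δ
  nProd_mem n p q x hx y hy := by
    rw [Submodule.baseChange_eq_span] at hx hy
    induction hy using Submodule.span_induction with
    | zero => simp
    | add y y' _ _ h h' =>
      rw [map_add]
      exact Submodule.add_mem _ h h'
    | smul r y _ h =>
      rw [bcProd_smul_right]
      exact Submodule.smul_mem _ _ h
    | mem y h =>
      obtain ⟨b, hb, rfl⟩ := h
      revert n
      induction hx using Submodule.span_induction with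
      | zero => simp
      | add y y' _ _ h h' =>
        intro n
        rw [map_add, LinearMap.add_apply]
        exact Submodule.add_mem _ (h n) (h' n)
      | smul r y _ h =>
        intro n
        obtain ⟨N, hN⟩ := bcProd_smul_left_aux 𝒜 δ n r y (TensorProduct.mk k S A 1 b)
        rw [hN N le_rfl]
        exact Submodule.sum_mem _ fun j _ => Submodule.smul_mem _ _ (h _)
      | mem x h =>
        intro n
        obtain ⟨a, ha, rfl⟩ := h
        obtain ⟨N, h⟩ := 𝒜.nProd_eventually_zero a b
        rw [TensorProduct.mk_apply, TensorProduct.mk_apply,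
          bcProd_tmul 𝒜 δ n _ _ a b h (M := N) (by omega)]
        exact Submodule.sum_mem _ fun j _ =>
          Submodule.tmul_mem_baseChange_of_mem _ (𝒜.nProd_mem _ p q a ha b hb)
  nProd_eventually_zero := bcProd_eventually 𝒜 δ
  nProd_der_left := bcProd_der_left 𝒜 δ
  nProd_der_right := bcProd_der_right 𝒜 δ
  der_smul := bcDer_smul 𝒜 δ
  nProd_smul_right := bcProd_smul_right 𝒜 δ
  nProd_smul_left := bcProd_smul_left 𝒜 δ

end BaseChange

end ConformalSuperalgebra

/-! ### The ring of polynomials in all rational powers of `t`, with `d/dt` -/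

/-- `Ŝ = k[t^q | q ∈ ℚ]`, where `t^q` is `AddMonoidAlgebra.single q 1`. -/
abbrev Shat (k : Type*) [Field k] : Type _ := AddMonoidAlgebra k ℚ

/-- The `k`-linear map `t^q ↦ q t^(q-1)`. -/
def ddtLinear (k : Type*) [Field k] : Shat k →ₗ[k] Shat k :=
  (Finsupp.lsum k fun q : ℚ => (q : k) • AddMonoidAlgebra.lsingle (q - 1)) ∘ₗ
    (AddMonoidAlgebra.coeffLinearEquiv k).toLinearMap

theorem ddtLinear_single (k : Type*) [Field k] (q : ℚ) (c : k) :
    ddtLinear k (AddMonoidAlgebra.single q c) = AddMonoidAlgebra.single (q - 1) ((q : k) * c) := by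
  simp [ddtLinear]

/-- The derivation `d/dt` of `Ŝ`. -/
def ddt (k : Type*) [Field k] [CharZero k] : Derivation k (Shat k) (Shat k) :=
  Derivation.mk' (ddtLinear k) fun a b => by
    induction a using AddMonoidAlgebra.induction_linear with
    | zero => simp
    | add f g hf hg =>
      simp only [add_mul, map_add, hf, hg, smul_eq_mul, mul_add]
      ring
    | single p c =>
      induction b using AddMonoidAlgebra.induction_linear with
      | zero => simp
      | add f g hf hg =>
        simp only [add_mul, map_add, hf, hg, smul_eq_mul, mul_add]
        ring
      | single q d =>
        simp only [AddMonoidAlgebra.single_mul_single, ddtLinear_single, smul_eq_mul]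
        rw [show p + (q - 1) = p + q - 1 by ring, show q + (p - 1) = p + q - 1 by ring,
          ← AddMonoidAlgebra.single_add]
        congr 1
        push_cast
        ring

/-! ### The `N = 4` conformal superalgebra -/

/-- The generators of the `N = 4` conformal superalgebra over `k[∂]`. -/
inductive Gen : Type
  | L : Gen
  | J (s : Fin 3) : Gen
  | G (a : Fin 2) : Gen
  | Gbar (a : Fin 2) : Gen
  deriving DecidableEq, Fintype

/-- `L` and `J^s` are even, `G^a` and `Ḡ^a` are odd. -/
def Gen.parity : Gen → ZMod 2
  | .L => 0
  | .J _ => 0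
  | .G _ => 1
  | .Gbar _ => 1

section N4

variable {k : Type*} [Field k]

/-- The Pauli matrices, for a square root `i` of `-1`. -/
def pauli (i : k) : Fin 3 → Matrix (Fin 2) (Fin 2) k :=
  ![!![0, 1; 1, 0], !![0, -i; i, 0], !![1, 0; 0, -1]]

/-- The matrices `J^s = σ^s / 2`, a basis of `sl₂(k)`. -/
def Jmat (i : k) (s : Fin 3) : Matrix (Fin 2) (Fin 2) k := (1 / 2 : k) • pauli i s

/-- The free `k[∂]`-module on the generators; the variable of `k[X]` is `∂`. -/
abbrev N4 (k : Type*) [Field k] : Type _ := Gen → k[X]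

/-- The `λ`-brackets `[u_λ v]` of the generators, with coefficients in `k[∂][λ]`: the outer
variable is `λ`, the inner one is `∂`. The brackets `[J_λ L]`, `[G_λ L]`, `[G_λ J]`, `[Ḡ_λ G]` and
so on are those that skew-symmetry `[v_λ u] = -(-1)^{p(u)p(v)} [u_{-λ-∂} v]` prescribes. A traceless
matrix `M` is `∑_s tr(M σ^s) J^s`, whence the value of `[J^m_λ J^n] = J^m J^n - J^n J^m`. -/
def genBracket (i : k) : Gen → Gen → (Gen → k[X][X]) :=
  let lam : k[X][X] := Polynomial.X
  let del : k[X][X] := Polynomial.C Polynomial.X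
  let c : k → k[X][X] := fun a => Polynomial.C (Polynomial.C a)
  fun u v => match u, v with
  | .L, .L => Pi.single .L (del + 2 * lam)
  | .L, .J s => Pi.single (.J s) (del + lam)
  | .L, .G a => Pi.single (.G a) (del + c (3 / 2) * lam)
  | .L, .Gbar a => Pi.single (.Gbar a) (del + c (3 / 2) * lam)
  | .J s, .L => Pi.single (.J s) lam
  | .J m, .J n => ∑ s, Pi.single (.J s)
      (c (Matrix.trace ((Jmat i m * Jmat i n - Jmat i n * Jmat i m) * pauli i s)))
  | .J s, .G a => ∑ b, Pi.single (.G b) (c (-(1 / 2) * pauli i s a b))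
  | .J s, .Gbar a => ∑ b, Pi.single (.Gbar b) (c ((1 / 2) * pauli i s b a))
  | .G a, .L => Pi.single (.G a) (c (1 / 2) * del + c (3 / 2) * lam)
  | .G a, .J s => ∑ b, Pi.single (.G b) (c ((1 / 2) * pauli i s a b))
  | .G _, .G _ => 0
  | .G a, .Gbar b => Pi.single .L (c (if a = b then 2 else 0))
      - ∑ s, Pi.single (.J s) (2 * (del + 2 * lam) * c (pauli i s a b))
  | .Gbar a, .L => Pi.single (.Gbar a) (c (1 / 2) * del + c (3 / 2) * lam)
  | .Gbar a, .J s => ∑ b, Pi.single (.Gbar b) (c (-(1 / 2) * pauli i s b a))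
  | .Gbar b, .G a => Pi.single .L (c (if a = b then 2 else 0))
      + ∑ s, Pi.single (.J s) (2 * (del + 2 * lam) * c (pauli i s a b))
  | .Gbar _, .Gbar _ => 0

theorem genBracket_parity (i : k) (u v w : Gen) (h : w.parity ≠ u.parity + v.parity) :
    genBracket i u v w = 0 := by
  cases u <;> cases v <;> cases w <;>
    first
      | exact absurd rfl h
      | simp [genBracket, Finset.sum_apply]

/-- The `λ`-bracket of `N4 k`, the sesquilinear extension of `genBracket`:
`[p(∂) u _λ q(∂) v] = p(-λ) q(∂ + λ) [u_λ v]`. -/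
def lambdaBracket (i : k) (x y : N4 k) : Gen → k[X][X] := fun w =>
  ∑ u, ∑ v, Polynomial.aeval (-Polynomial.X : k[X][X]) (x u) *
    Polynomial.aeval (Polynomial.C Polynomial.X + Polynomial.X : k[X][X]) (y v) *
      genBracket i u v w

/-- The `n`-product of `N4 k`, determined by `[x_λ y] = ∑_n (λ^n / n!) x_(n) y`. -/
def n4Prod (i : k) (n : ℕ) : N4 k →ₗ[k] N4 k →ₗ[k] N4 k :=
  LinearMap.mk₂ k (fun x y w => (n.factorial : k) • (lambdaBracket i x y w).coeff n)
    (fun x x' y => by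
      ext1 w
      simp only [lambdaBracket, Pi.add_apply, map_add, add_mul, Finset.sum_add_distrib,
        Polynomial.coeff_add, smul_add])
    (fun c x y => by
      ext1 w
      simp only [lambdaBracket, Pi.smul_apply, map_smul, smul_mul_assoc, ← Finset.smul_sum,
        Polynomial.coeff_smul]
      rw [smul_comm])
    (fun x y y' => by
      ext1 w
      simp only [lambdaBracket, Pi.add_apply, map_add, add_mul, mul_add, Finset.sum_add_distrib,
        Polynomial.coeff_add, smul_add])
    (fun c x y => by
      ext1 w
      simp only [lambdaBracket, Pi.smul_apply, map_smul, smul_mul_assoc, mul_smul_comm,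
        ← Finset.smul_sum, Polynomial.coeff_smul]
      rw [smul_comm])

theorem n4Prod_apply (i : k) (n : ℕ) (x y : N4 k) (w : Gen) :
    n4Prod i n x y w = (n.factorial : k) • (lambdaBracket i x y w).coeff n := rfl

/-- Multiplication by `∂`. -/
def n4Der (k : Type*) [Field k] : N4 k →ₗ[k] N4 k where
  toFun x := fun u => Polynomial.X * x u
  map_add' x y := by
    ext1 u
    simp [mul_add]
  map_smul' c x := by
    ext1 u
    simp

theorem lambdaBracket_der_left (i : k) (x y : N4 k) (w : Gen) :
    lambdaBracket i (n4Der k x) y w = -(Polynomial.X * lambdaBracket i x y w) := by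
  simp only [lambdaBracket, n4Der, LinearMap.coe_mk, AddHom.coe_mk, map_mul, Polynomial.aeval_X,
    Finset.mul_sum, ← Finset.sum_neg_distrib]
  refine Finset.sum_congr rfl fun u _ => Finset.sum_congr rfl fun v _ => ?_
  ring

theorem lambdaBracket_der_right (i : k) (x y : N4 k) (w : Gen) :
    lambdaBracket i x (n4Der k y) w = Polynomial.C Polynomial.X * lambdaBracket i x y w
      + Polynomial.X * lambdaBracket i x y w := by
  simp only [lambdaBracket, n4Der, LinearMap.coe_mk, AddHom.coe_mk, map_mul, Polynomial.aeval_X,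
    Finset.mul_sum, ← Finset.sum_add_distrib]
  refine Finset.sum_congr rfl fun u _ => Finset.sum_congr rfl fun v _ => ?_
  ring

/-- The elements whose coordinates vanish on the generators of parity other than `p`. -/
def n4Parity (k : Type*) [Field k] (p : ZMod 2) : Submodule k (N4 k) where
  carrier := {x | ∀ u : Gen, u.parity ≠ p → x u = 0}
  zero_mem' := fun _ _ => rfl
  add_mem' := fun {x y} hx hy u hu => by
    rw [Pi.add_apply, hx u hu, hy u hu, add_zero]
  smul_mem' := fun c x hx u hu => by
    rw [Pi.smul_apply, hx u hu, smul_zero]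

theorem zmod_two_cases (p : ZMod 2) : p = 0 ∨ p = 1 := by
  fin_cases p
  · exact Or.inl rfl
  · exact Or.inr rfl

/-- The `N = 4` conformal superalgebra over `k`; the parameter `i` is the square root of `-1`
that occurs in the second Pauli matrix. -/
def n4 (i : k) : ConformalSuperalgebra (0 : Derivation k k k) (N4 k) where
  parity := n4Parity k
  parity_isCompl := by
    constructor
    · rw [Submodule.disjoint_def]
      intro x hx hy
      ext1 u
      rcases zmod_two_cases u.parity with h | h
      · exact hy u (by simp [h])
      · exact hx u (by simp [h])
    · rw [codisjoint_iff, eq_top_iff]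
      rintro x -
      refine Submodule.mem_sup.2 ⟨fun u => if u.parity = 0 then x u else 0, ?_,
        fun u => if u.parity = 0 then 0 else x u, ?_, ?_⟩
      · intro u hu
        exact if_neg hu
      · intro u hu
        rcases zmod_two_cases u.parity with h | h
        · exact if_pos h
        · exact absurd h hu
      · ext1 u
        by_cases h : u.parity = 0 <;> simp [h]
  der := n4Der k
  der_mem p x hx u hu := by
    change Polynomial.X * x u = 0
    rw [hx u hu, mul_zero]
  nProd := n4Prod i
  nProd_mem n p q x hx y hy w hw := by
    have h : lambdaBracket i x y w = 0 := by
      refine Finset.sum_eq_zero fun u _ => Finset.sum_eq_zero fun v _ => ?_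
      by_cases hu : u.parity = p
      · by_cases hv : v.parity = q
        · rw [genBracket_parity i u v w (by rw [hu, hv]; exact hw), mul_zero]
        · rw [hy v hv, map_zero, mul_zero, zero_mul]
      · rw [hx u hu, map_zero, zero_mul, zero_mul]
    rw [n4Prod_apply, h, Polynomial.coeff_zero, smul_zero]
  nProd_eventually_zero x y := by
    refine ⟨(Finset.univ.sup fun w => (lambdaBracket i x y w).natDegree) + 1, fun n hn => ?_⟩
    ext1 w
    rw [n4Prod_apply, Polynomial.coeff_eq_zero_of_natDegree_lt, smul_zero, Pi.zero_apply]
    have := Finset.le_sup (f := fun w => (lambdaBracket i x y w).natDegree) (Finset.mem_univ w)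
    omega
  nProd_der_left n x y := by
    ext1 w
    simp only [Pi.neg_apply, Pi.smul_apply, n4Prod_apply, lambdaBracket_der_left,
      Polynomial.coeff_neg, smul_neg]
    rcases n with _ | n
    · simp
    · rw [Polynomial.coeff_X_mul, smul_smul, Nat.add_sub_cancel, Nat.factorial_succ, Nat.cast_mul]
  nProd_der_right n x y := by
    ext1 w
    simp only [Pi.add_apply, Pi.smul_apply, n4Prod_apply, lambdaBracket_der_right,
      Polynomial.coeff_add, smul_add, Polynomial.coeff_C_mul]
    refine congrArg₂ (· + ·) ?_ ?_
    · simp [n4Der, n4Prod_apply]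
    · rcases n with _ | n
      · simp
      · rw [Polynomial.coeff_X_mul, smul_smul, Nat.add_sub_cancel, Nat.factorial_succ,
          Nat.cast_mul]
  der_smul r x := by simp
  nProd_smul_right n r x y := by simp
  nProd_smul_left n r x y := by
    rw [finsum_eq_single _ 0]
    · simp [dpow_zero_apply]
    · intro j hj
      have : dpow (0 : Derivation k k k) j r = 0 := by
        simp [dpow, zero_pow hj]
      rw [this, zero_smul]

end N4

/-! ### Notation for elements of `𝒜 ⊗ Ŝ` -/

section Elements

variable {k : Type*} [Field k]

/-- The generator `u`, as an element of `N4 k`. -/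
def gen (u : Gen) : N4 k := Pi.single u 1

/-- The inclusion of `sl₂(Ŝ)` in `𝒜 ⊗ Ŝ`: it sends `∑_s f_s J^s` to `∑_s J^s ⊗ f_s`, where
`f_s = tr(M σ^s)` for a traceless matrix `M`. -/
def ofSl2 (i : k) (M : Matrix (Fin 2) (Fin 2) (Shat k)) : Shat k ⊗[k] N4 k :=
  ∑ s, Matrix.trace (M * (pauli i s).map (algebraMap k (Shat k))) ⊗ₜ[k] gen (Gen.J s)

/-- `(a, b)ᵗ ⊗ (1, 0)ᵗ := G^1 ⊗ a + G^2 ⊗ b`. -/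
def gVec (v : Fin 2 → Shat k) : Shat k ⊗[k] N4 k := ∑ a, v a ⊗ₜ[k] gen (Gen.G a)

/-- `(a, b)ᵗ ⊗ (0, 1)ᵗ := Ḡ^1 ⊗ a + Ḡ^2 ⊗ b`. -/
def gbarVec (v : Fin 2 → Shat k) : Shat k ⊗[k] N4 k := ∑ a, v a ⊗ₜ[k] gen (Gen.Gbar a)

/-- The subgroup of `SL₂(Ŝ) × SL₂(k)` generated by `(-I, -I)`. -/
def signs (k : Type*) [Field k] : Subgroup (SL(2, Shat k) × SL(2, k)) :=
  Subgroup.zpowers (-1, -1)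

instance signs_normal (k : Type*) [Field k] : (signs k).Normal := by
  refine ⟨fun x hx g => ?_⟩
  obtain ⟨n, rfl⟩ := Subgroup.mem_zpowers_iff.1 hx
  have h : Commute g (-1, -1) := by
    refine Prod.ext ?_ ?_ <;> simp
  have e := (h.zpow_right n).eq
  rw [e, mul_inv_cancel_right]
  exact hx

end Elements

end ConformalSuper

end

open ConformalSuper

noncomputable section

namespace ConformalSuper

/-! ### Iterated derivations in `n`-products -/

namespace ConformalSuperalgebra

variable {k S : Type*} [Field k] [CommRing S] [Algebra k S] {δ : Derivation k S S}
  {A : Type*} [AddCommGroup A] [Module k A] [Module S A] [IsScalarTower k S A]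

/-! Write `D` for the derivation of `𝒜 ⊗ Ŝ` and `V` for the free `Ŝ`-module on the eight generators.
Every element is uniquely a finite sum `∑ D^n w_n` with `w_n ∈ V` (`coeffs`), and brackets of
elements of `V` are affine in `λ` and `D`, so they are described by three bilinear maps on `V`:
`prodLam`, `prodDel`, `prodConst`. In the coordinates `vec i r M v w`, with `M` traceless, these
become matrix formulas.

Existence. An `Ŝ`-linear endomorphism of `V` extends to one commuting with `D`, and by
sesquilinearity the extension respects all products as soon as it does so on generators. For
`SL₂(Ŝ)` this is gauge covariance: `M` is conjugated, the odd vectors transform by `(Y⁻¹)ᵀ` and `Y`,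
and `L` is shifted by the logarithmic derivative of `Y` to absorb the derivatives of `Y`
(`prodConst_gauge`). For `SL₂(k)` the point is that `(Y⁻¹)ᵀ` and `Y` are equivalent through `ε`: the
odd part is a standard representation tensored with a two-dimensional multiplicity space, on which
`SL₂(k)` acts, commuting with `SL₂(Ŝ)` (`gaugeEnd_commute_rotEnd`).

Surjectivity. A general automorphism could raise the degree in `D`, so it must first be shown to
preserve `V`. Comparing top-degree terms in suitable vanishing products removes the `L`-part of the
image of a current (`coeffs_apply_L_eq_zero`), then its positive powers of `D`
(`exists_map_iota_current`). Since the currents are then permuted among themselves, their brackets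
with odd elements and with `L` settle the other generators (`exists_map_iota_odd`,
`exists_map_iota_L`). What remains is linear algebra. The four blocks of the odd part intertwine
representations of `sl₂` and satisfy linear differential equations with traceless coefficient. A
nonzero first block thus has nonzero constant determinant (`ActsBy.det_ne_zero`, `ActsBy.ddt_det`).
A square root of that determinant gives an element of `SL₂(Ŝ)` that turns the block into a scalar,
and then Schur's lemma leaves an element of `SL₂(k)` (`exists_rot_eq`). If the first block vanishes,
a rotation makes it nonzero.

Kernel. If `(Y, X)` acts trivially, `Y` commutes with `sl₂`, hence is `±1`, and the odd part forces
`X = Y` as signs. Uniqueness of the isomorphism holds because an automorphism is determined by its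
values on generators. -/

theorem nProd_der_pow_left (𝒜 : ConformalSuperalgebra δ A) (n p : ℕ) (a b : A) :
    𝒜.nProd n ((𝒜.der ^ p) a) b
      = ((-1) ^ p * (n.descFactorial p : k)) • 𝒜.nProd (n - p) a b := by
  induction p generalizing n with
  | zero => simp
  | succ p ih =>
    rw [pow_succ', Module.End.mul_apply, 𝒜.nProd_der_left, ih]
    rcases n with _ | n
    · simp
    · rw [Nat.succ_descFactorial_succ, Nat.add_sub_cancel, Nat.add_sub_add_right, smul_smul,
        ← neg_smul]
      congr 1
      push_cast
      ring

/-- Each factor of the derivation on the right costs a total derivative, which `f` kills, and lowers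
the order by one. When `q > n` the truncated order `n - q` is harmless, because the descending
factorial vanishes. -/
theorem map_nProd_der_pow_right (𝒜 : ConformalSuperalgebra δ A) {B : Type*} [AddCommGroup B]
    [Module k B] (f : A →ₗ[k] B) (hf : ∀ x, f (𝒜.der x) = 0) (n q : ℕ) (a b : A) :
    f (𝒜.nProd n a ((𝒜.der ^ q) b)) = (n.descFactorial q : k) • f (𝒜.nProd (n - q) a b) := by
  induction q generalizing n with
  | zero => simp
  | succ q ih =>
    rw [pow_succ', Module.End.mul_apply, 𝒜.nProd_der_right, map_add, hf, zero_add, map_smul, ih]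
    rcases n with _ | n
    · simp
    · rw [Nat.succ_descFactorial_succ, Nat.add_sub_cancel, Nat.add_sub_add_right, smul_smul]
      congr 1
      push_cast
      ring

/-- Modulo the image of the derivation, `(D^p a)_(n) (D^q b)` is a multiple of
`a_(n-p-q) b`. -/
theorem map_nProd_der_pow (𝒜 : ConformalSuperalgebra δ A) {B : Type*} [AddCommGroup B]
    [Module k B] (f : A →ₗ[k] B) (hf : ∀ x, f (𝒜.der x) = 0) (n p q : ℕ) (a b : A) :
    f (𝒜.nProd n ((𝒜.der ^ p) a) ((𝒜.der ^ q) b))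
      = ((-1) ^ p * (n.descFactorial (p + q) : k)) • f (𝒜.nProd (n - (p + q)) a b) := by
  rw [nProd_der_pow_left, map_smul, map_nProd_der_pow_right 𝒜 f hf, smul_smul, Nat.sub_sub,
    mul_assoc, ← Nat.cast_mul, add_comm p q, mul_comm (n.descFactorial p)]
  have h : (n - p).descFactorial q * n.descFactorial p = n.descFactorial (q + p) := by
    rw [Nat.descFactorial_mul_descFactorial (Nat.le_add_left p q) |>.symm, Nat.add_sub_cancel]
  rw [h]

end ConformalSuperalgebra

/-! ### Brackets of generators -/

section

variable {k : Type*} [Field k]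

theorem sum_gen {M : Type*} [AddCommMonoid M] (f : Gen → M) :
    ∑ u, f u = f .L + ∑ s, f (.J s) + ∑ a, f (.G a) + ∑ a, f (.Gbar a) := by
  have h : (Finset.univ : Finset Gen) = {.L, .J 0, .J 1, .J 2, .G 0, .G 1, .Gbar 0, .Gbar 1} := by
    decide
  rw [h]
  simp [Fin.sum_univ_succ]
  abel

/-- The coefficient of `λ` in the bracket of two generators. -/
def brLam (i : k) : Gen → Gen → Gen → k
  | .L, .L => Pi.single .L 2
  | .L, .J s => Pi.single (.J s) 1
  | .L, .G a => Pi.single (.G a) (3 / 2)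
  | .L, .Gbar a => Pi.single (.Gbar a) (3 / 2)
  | .J s, .L => Pi.single (.J s) 1
  | .G a, .L => Pi.single (.G a) (3 / 2)
  | .G a, .Gbar b => -∑ s, Pi.single (.J s) (4 * pauli i s a b)
  | .Gbar a, .L => Pi.single (.Gbar a) (3 / 2)
  | .Gbar b, .G a => ∑ s, Pi.single (.J s) (4 * pauli i s a b)
  | _, _ => 0

/-- The coefficient of `∂` in the bracket of two generators. -/
def brDel (i : k) : Gen → Gen → Gen → k
  | .L, .L => Pi.single .L 1
  | .L, .J s => Pi.single (.J s) 1
  | .L, .G a => Pi.single (.G a) 1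
  | .L, .Gbar a => Pi.single (.Gbar a) 1
  | .G a, .L => Pi.single (.G a) (1 / 2)
  | .G a, .Gbar b => -∑ s, Pi.single (.J s) (2 * pauli i s a b)
  | .Gbar a, .L => Pi.single (.Gbar a) (1 / 2)
  | .Gbar b, .G a => ∑ s, Pi.single (.J s) (2 * pauli i s a b)
  | _, _ => 0

/-- The constant coefficient of the bracket of two generators. -/
def brConst (i : k) : Gen → Gen → Gen → k
  | .J m, .J n => ∑ s, Pi.single (.J s)
      (Matrix.trace ((Jmat i m * Jmat i n - Jmat i n * Jmat i m) * pauli i s))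
  | .J s, .G a => ∑ b, Pi.single (.G b) (-(1 / 2) * pauli i s a b)
  | .J s, .Gbar a => ∑ b, Pi.single (.Gbar b) ((1 / 2) * pauli i s b a)
  | .G a, .J s => ∑ b, Pi.single (.G b) ((1 / 2) * pauli i s a b)
  | .G a, .Gbar b => Pi.single .L (if a = b then 2 else 0)
  | .Gbar a, .J s => ∑ b, Pi.single (.Gbar b) (-(1 / 2) * pauli i s b a)
  | .Gbar b, .G a => Pi.single .L (if a = b then 2 else 0)
  | _, _ => 0

-- Every bracket of generators has degree at most one in `λ` and `∂` together. Hence only the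
-- products of order `0` and `1` of generators are nonzero, and three tables of constants encode the
-- whole structure.
set_option maxHeartbeats 2000000 in
theorem genBracket_eq (i : k) (u v w : Gen) : genBracket i u v w
    = Polynomial.C (Polynomial.C (brConst i u v w) + Polynomial.C (brDel i u v w) * Polynomial.X)
      + Polynomial.C (Polynomial.C (brLam i u v w)) * Polynomial.X := by
  cases u <;> cases v <;> cases w <;>
    simp only [genBracket, brConst, brDel, brLam, Pi.single_apply, Finset.sum_apply, Pi.sub_apply,
      Pi.add_apply, Pi.neg_apply, Pi.zero_apply, reduceCtorEq, if_false, if_true,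
      Finset.sum_const_zero, Gen.J.injEq, Gen.G.injEq, Gen.Gbar.injEq, Finset.sum_ite_eq,
      Finset.mem_univ, map_zero, zero_mul, add_zero, zero_add,
      sub_zero, neg_zero, map_mul, map_neg, map_ofNat, map_one, one_mul, zero_sub] <;>
    (try split_ifs) <;> (try simp only [map_zero, map_one]) <;> (try ring1)

theorem lambdaBracket_gen (i : k) (u v : Gen) :
    lambdaBracket i (gen u) (gen v) = genBracket i u v := by
  funext w
  rw [lambdaBracket, Finset.sum_eq_single u, Finset.sum_eq_single v]
  · simp [gen]
  · intro v' _ h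
    simp [gen, Pi.single_eq_of_ne h]
  · simp
  · intro u' _ h
    simp [gen, Pi.single_eq_of_ne h]
  · simp

end

/-! ### Products of combinations of generators -/

section

variable {k : Type*} [Field k]

theorem n4Prod_gen_zero (i : k) (u v : Gen) : n4Prod i 0 (gen u) (gen v)
    = ∑ w, (brConst i u v w • gen w + brDel i u v w • n4Der k (gen w)) := by
  ext1 w
  rw [n4Prod_apply, lambdaBracket_gen, genBracket_eq, Finset.sum_apply, Finset.sum_eq_single w]
  · simp [gen, n4Der, Polynomial.smul_eq_C_mul]
  · intro w' _ h
    simp [gen, n4Der, Pi.single_eq_of_ne h.symm]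
  · simp

theorem n4Prod_gen_one (i : k) (u v : Gen) : n4Prod i 1 (gen u) (gen v)
    = ∑ w, brLam i u v w • gen w := by
  ext1 w
  rw [n4Prod_apply, lambdaBracket_gen, genBracket_eq, Finset.sum_apply, Finset.sum_eq_single w]
  · simp [gen, Polynomial.smul_eq_C_mul, Polynomial.coeff_C]
  · intro w' _ h
    simp [gen, Pi.single_eq_of_ne h.symm]
  · simp

theorem n4Prod_gen_of_two_le (i : k) (u v : Gen) {n : ℕ} (hn : 2 ≤ n) :
    n4Prod i n (gen u) (gen v) = 0 := by
  ext1 w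
  rw [n4Prod_apply, lambdaBracket_gen, genBracket_eq]
  obtain ⟨n, rfl⟩ := Nat.exists_eq_add_of_le' hn
  simp

/-- The combination `∑_u w_u u` of the generators with coefficients in `Ŝ`. -/
def iota : (Gen → Shat k) →ₗ[Shat k] Shat k ⊗[k] N4 k where
  toFun w := ∑ u, w u ⊗ₜ[k] gen u
  map_add' x y := by simp [TensorProduct.add_tmul, Finset.sum_add_distrib]
  map_smul' c x := by simp [Finset.smul_sum, TensorProduct.smul_tmul']

theorem iota_apply (w : Gen → Shat k) : iota w = ∑ u, w u ⊗ₜ[k] gen u := rfl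

theorem iota_single (u : Gen) (r : Shat k) : iota (Pi.single u r) = r ⊗ₜ[k] gen u := by
  rw [iota_apply, Finset.sum_eq_single u]
  · simp
  · intro v _ h
    simp [Pi.single_eq_of_ne h]
  · simp

variable [CharZero k]

/-- The `N = 4` conformal superalgebra over `Ŝ`. -/
abbrev n4Shat (i : k) : ConformalSuperalgebra (ddt k) (Shat k ⊗[k] N4 k) :=
  (n4 i).baseChange (ddt k)

theorem der_tmul (i : k) (r : Shat k) (a : N4 k) :
    (n4Shat i).der (r ⊗ₜ a) = r ⊗ₜ n4Der k a + ddt k r ⊗ₜ a := rfl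

/-- Generators have no products of order two or more, so only the summands `j = 0` and `j = 1` of
the base-changed product survive. -/
theorem nProd_tmul_gen (i : k) (n : ℕ) (r s : Shat k) (u v : Gen) :
    (n4Shat i).nProd n (r ⊗ₜ gen u) (s ⊗ₜ gen v)
      = (r * s) ⊗ₜ n4Prod i n (gen u) (gen v)
        + (ddt k r * s) ⊗ₜ n4Prod i (n + 1) (gen u) (gen v) := by
  have h := ConformalSuperalgebra.bcProd_tmul (n4 i) (ddt k) n r s (gen u) (gen v) (N := 2)
    (fun m hm => n4Prod_gen_of_two_le i u v hm) (M := 2) (by omega)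
  refine h.trans ?_
  rw [Finset.sum_range_succ, Finset.sum_range_one]
  simp only [dpow_zero_apply]
  simp [dpow, n4]

/-- The coefficient of `λ` in the bracket of two combinations of generators. -/
def prodLam (i : k) (x y : Gen → Shat k) : Gen → Shat k := fun w =>
  ∑ u, ∑ v, brLam i u v w • (x u * y v)

/-- The coefficient of the derivation in the bracket of two combinations of generators. -/
def prodDel (i : k) (x y : Gen → Shat k) : Gen → Shat k := fun w =>
  ∑ u, ∑ v, brDel i u v w • (x u * y v)

/-- The constant coefficient of the bracket of two combinations of generators. -/
def prodConst (i : k) (x y : Gen → Shat k) : Gen → Shat k := fun w =>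
  ∑ u, ∑ v, (brConst i u v w • (x u * y v) + brLam i u v w • (ddt k (x u) * y v)
    - brDel i u v w • ddt k (x u * y v))

theorem nProd_iota_eq_sum (i : k) (n : ℕ) (x y : Gen → Shat k) :
    (n4Shat i).nProd n (iota x) (iota y)
      = ∑ u, ∑ v, ((x u * y v) ⊗ₜ n4Prod i n (gen u) (gen v)
        + (ddt k (x u) * y v) ⊗ₜ n4Prod i (n + 1) (gen u) (gen v)) := by
  simp only [iota_apply, map_sum, LinearMap.sum_apply]
  rw [Finset.sum_comm]
  exact Finset.sum_congr rfl fun u _ => Finset.sum_congr rfl fun v _ =>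
    nProd_tmul_gen i n (x u) (y v) u v

theorem nProd_iota_of_two_le (i : k) {n : ℕ} (hn : 2 ≤ n) (x y : Gen → Shat k) :
    (n4Shat i).nProd n (iota x) (iota y) = 0 := by
  rw [nProd_iota_eq_sum]
  refine Finset.sum_eq_zero fun u _ => Finset.sum_eq_zero fun v _ => ?_
  rw [n4Prod_gen_of_two_le i u v hn, n4Prod_gen_of_two_le i u v (by omega)]
  simp

theorem nProd_iota_one (i : k) (x y : Gen → Shat k) :
    (n4Shat i).nProd 1 (iota x) (iota y) = iota (prodLam i x y) := by
  rw [nProd_iota_eq_sum, iota_apply]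
  simp only [prodLam, TensorProduct.sum_tmul]
  rw [Finset.sum_comm (f := fun w u => ∑ v, _)]
  refine Finset.sum_congr rfl fun u _ => ?_
  rw [Finset.sum_comm]
  refine Finset.sum_congr rfl fun v _ => ?_
  rw [n4Prod_gen_one, n4Prod_gen_of_two_le i u v le_rfl, TensorProduct.tmul_zero, add_zero,
    TensorProduct.tmul_sum]
  exact Finset.sum_congr rfl fun w _ => by rw [TensorProduct.smul_tmul]

/-- Multiplication by `∂` on the second tensor factor is traded for `D` through `f ⊗ ∂u = D(f ⊗ u) -
f' ⊗ u`. This is the source of the `brDel` term in `prodConst`; the `brLam` term there comes from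
the summand `j = 1`. -/
theorem nProd_iota_zero (i : k) (x y : Gen → Shat k) :
    (n4Shat i).nProd 0 (iota x) (iota y)
      = (n4Shat i).der (iota (prodDel i x y)) + iota (prodConst i x y) := by
  rw [nProd_iota_eq_sum, iota_apply, iota_apply, map_sum, ← Finset.sum_add_distrib]
  simp only [prodDel, prodConst, TensorProduct.sum_tmul, map_sum]
  simp only [← Finset.sum_add_distrib]
  rw [Finset.sum_comm (f := fun w u => ∑ v, _)]
  refine Finset.sum_congr rfl fun u _ => ?_
  rw [Finset.sum_comm]
  refine Finset.sum_congr rfl fun v _ => ?_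
  rw [n4Prod_gen_zero, n4Prod_gen_one, TensorProduct.tmul_sum, TensorProduct.tmul_sum,
    ← Finset.sum_add_distrib]
  refine Finset.sum_congr rfl fun w _ => ?_
  rw [der_tmul, Derivation.map_smul, TensorProduct.sub_tmul, TensorProduct.add_tmul,
    TensorProduct.tmul_add]
  simp only [TensorProduct.smul_tmul]
  abel

end

/-! ### Brackets in matrix coordinates -/

section

variable {k : Type*} [Field k]

/-- The inclusion of the constants in `Ŝ`. -/
def cst : k →+* Shat k := algebraMap k (Shat k)

theorem smul_eq_cst_mul (a : k) (x : Shat k) : a • x = cst a * x :=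
  Algebra.smul_def a x

theorem cst_two : (cst 2 : Shat k) = 2 := map_ofNat _ 2

theorem cst_four : (cst 4 : Shat k) = 4 := map_ofNat _ 4

theorem cst_mul_self {i : k} (hi : i * i = -1) : (cst i : Shat k) * cst i = -1 := by
  rw [← map_mul, hi, map_neg, map_one]

theorem cst_inv_two_mul_two [CharZero k] : (cst (2⁻¹ : k) : Shat k) * 2 = 1 := by
  rw [← cst_two, ← map_mul]
  simp

theorem cst_injective : Function.Injective (cst : k → Shat k) :=
  FaithfulSMul.algebraMap_injective k (Shat k)

/-- The coordinates of `L ⊗ r + M + G(v) + Ḡ(w)`. -/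
def vec (i : k) (r : Shat k) (M : Matrix (Fin 2) (Fin 2) (Shat k)) (v w : Fin 2 → Shat k) :
    Gen → Shat k
  | .L => r
  | .J s => Matrix.trace (M * (pauli i s).map (algebraMap k (Shat k)))
  | .G a => v a
  | .Gbar a => w a

theorem trace_mul_pauli (i : k) (M : Matrix (Fin 2) (Fin 2) (Shat k)) (s : Fin 3) :
    Matrix.trace (M * (pauli i s).map (algebraMap k (Shat k)))
      = ![M 0 1 + M 1 0, cst i * (M 0 1 - M 1 0), M 0 0 - M 1 1] s := by
  change Matrix.trace (M * (pauli i s).map cst) = _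
  fin_cases s <;>
    simp [pauli, Matrix.trace_fin_two, Matrix.mul_apply, Fin.sum_univ_two] <;> ring

theorem iota_vec (i : k) (r : Shat k) (M : Matrix (Fin 2) (Fin 2) (Shat k))
    (v w : Fin 2 → Shat k) :
    iota (vec i r M v w) = r ⊗ₜ[k] gen .L + ofSl2 i M + gVec v + gbarVec w := by
  rw [iota_apply, sum_gen]
  rfl

theorem vec_add (i : k) (r r' : Shat k) (M M' : Matrix (Fin 2) (Fin 2) (Shat k))
    (v w v' w' : Fin 2 → Shat k) : vec i r M v w + vec i r' M' v' w'
      = vec i (r + r') (M + M') (v + v') (w + w') := by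
  ext1 u
  cases u <;> simp [vec, add_mul]

theorem smul_vec (i : k) (c r : Shat k) (M : Matrix (Fin 2) (Fin 2) (Shat k))
    (v w : Fin 2 → Shat k) : c • vec i r M v w = vec i (c * r) (c • M) (c • v) (c • w) := by
  ext1 u
  cases u <;> simp [vec]

variable [CharZero k]

theorem ddt_cst (a : k) : ddt k (cst a) = 0 := (ddt k).map_algebraMap a

theorem ddt_mul (x y : Shat k) : ddt k (x * y) = x * ddt k y + y * ddt k x :=
  (ddt k).leibniz x y

theorem prodLam_vec (i : k) (r r' : Shat k) (M M' : Matrix (Fin 2) (Fin 2) (Shat k))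
    (v w v' w' : Fin 2 → Shat k) :
    prodLam i (vec i r M v w) (vec i r' M' v' w')
      = vec i (2 * (r * r'))
        (r • M' + r' • M + (4 : Shat k) • (Matrix.vecMulVec w v' - Matrix.vecMulVec w' v))
        ((3 / 2 : k) • (r • v' + r' • v)) ((3 / 2 : k) • (r • w' + r' • w)) := by
  ext1 u
  rcases u with _ | s | a | a
  · simp [prodLam, sum_gen, brLam, vec, smul_eq_cst_mul, cst_two]
  · simp only [vec, trace_mul_pauli, prodLam, sum_gen, brLam, Finset.sum_apply, Pi.single_apply]
    fin_cases s <;>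
    simp [Fin.sum_univ_succ, pauli, smul_eq_cst_mul, cst_four, Matrix.vecMulVec_apply] <;> ring
  · fin_cases a <;>
    simp [prodLam, sum_gen, brLam, vec, Pi.single_apply, Fin.sum_univ_succ,
      smul_eq_cst_mul] <;> ring
  · fin_cases a <;>
    simp [prodLam, sum_gen, brLam, vec, Pi.single_apply, Fin.sum_univ_succ,
      smul_eq_cst_mul] <;> ring

theorem prodDel_vec (i : k) (r r' : Shat k) (M M' : Matrix (Fin 2) (Fin 2) (Shat k))
    (v w v' w' : Fin 2 → Shat k) :
    prodDel i (vec i r M v w) (vec i r' M' v' w')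
      = vec i (r * r')
        (r • M' + (2 : Shat k) • (Matrix.vecMulVec w v' - Matrix.vecMulVec w' v))
        (r • v' + (1 / 2 : k) • r' • v) (r • w' + (1 / 2 : k) • r' • w) := by
  ext1 u
  rcases u with _ | s | a | a
  · simp [prodDel, sum_gen, brDel, vec, Finset.sum_apply]
  · simp only [vec, trace_mul_pauli, prodDel, sum_gen, brDel, Finset.sum_apply, Pi.single_apply]
    fin_cases s <;>
    simp [Fin.sum_univ_succ, pauli, smul_eq_cst_mul, cst_two, Matrix.vecMulVec_apply] <;> ring
  · fin_cases a <;>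
    simp [prodDel, sum_gen, brDel, vec, Pi.single_apply, Fin.sum_univ_succ,
      smul_eq_cst_mul] <;> ring
  · fin_cases a <;>
    simp [prodDel, sum_gen, brDel, vec, Pi.single_apply, Fin.sum_univ_succ,
      smul_eq_cst_mul] <;> ring

/-- These are the structure constants `i ε_{mns}` of `sl₂` in the basis `J^s`. -/
theorem trace_commutator_Jmat (i : k) (m n s : Fin 3) :
    Matrix.trace ((Jmat i m * Jmat i n - Jmat i n * Jmat i m) * pauli i s)
      = ![![![0, 0, 0], ![0, 0, i], ![0, -i, 0]], ![![0, 0, -i], ![0, 0, 0], ![i, 0, 0]],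
        ![![0, i, 0], ![-i, 0, 0], ![0, 0, 0]]] m n s := by
  fin_cases m <;> fin_cases n <;> fin_cases s <;>
    simp [Jmat, pauli, Matrix.trace_fin_two] <;> ring_nf

theorem prodConst_L (i : k) (x y : Gen → Shat k) : prodConst i x y .L
    = ddt k (x .L) * y .L - x .L * ddt k (y .L)
      + ∑ a, 2 * (x (.G a) * y (.Gbar a) + x (.Gbar a) * y (.G a)) := by
  simp [prodConst, sum_gen, brConst, brLam, brDel, Fin.sum_univ_succ, smul_eq_cst_mul, cst_two]
  ring

theorem prodConst_J (i : k) (x y : Gen → Shat k) (s : Fin 3) :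
    prodConst i x y (.J s)
    = ddt k (x (.J s)) * y .L - x .L * ddt k (y (.J s))
      + cst i * ![x (.J 1) * y (.J 2) - x (.J 2) * y (.J 1),
          x (.J 2) * y (.J 0) - x (.J 0) * y (.J 2), x (.J 0) * y (.J 1) - x (.J 1) * y (.J 0)] s
      + ∑ a, ∑ b, 2 * cst (pauli i s a b) *
          (x (.G a) * ddt k (y (.Gbar b)) - ddt k (x (.G a)) * y (.Gbar b)
            + ddt k (x (.Gbar b)) * y (.G a) - x (.Gbar b) * ddt k (y (.G a))) := by
  simp only [prodConst, sum_gen, brConst, brLam, brDel, Pi.single_apply,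
    trace_commutator_Jmat i, smul_eq_cst_mul, ddt_mul, Pi.zero_apply, reduceCtorEq, if_false,
    map_zero, zero_mul, add_zero, sub_zero, zero_add,
    Gen.J.injEq, Pi.neg_apply, map_neg,
    Fin.sum_univ_two, Fin.sum_univ_three]
  fin_cases s <;> simp [cst_two, cst_four] <;> ring

theorem prodConst_G (i : k) (x y : Gen → Shat k) (a : Fin 2) : prodConst i x y (.G a)
    = cst (1 / 2) * (ddt k (x .L) * y (.G a) - x (.G a) * ddt k (y .L))
      + ddt k (x (.G a)) * y .L - x .L * ddt k (y (.G a))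
      + ∑ s, ∑ b, cst (1 / 2) * cst (pauli i s b a) *
          (x (.G b) * y (.J s) - x (.J s) * y (.G b)) := by
  -- The constants `cst (3 / 2)` and `cst 2⁻¹` are unrelated atoms for `ring`; this is the one
  -- relation between them that the cancellation of derivative terms needs.
  have h3 : (cst (3 / 2 : k) : Shat k) = 1 + cst 2⁻¹ := by
    rw [← map_one cst, ← map_add]
    norm_num
  simp only [prodConst, sum_gen, brConst, brLam, brDel, Pi.single_apply,
    smul_eq_cst_mul, ddt_mul, Pi.zero_apply, reduceCtorEq, if_false,
    map_zero, zero_mul, add_zero, sub_zero, zero_add,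
    Gen.G.injEq,
    Fin.sum_univ_two, Fin.sum_univ_three]
  fin_cases a <;> simp [h3] <;> ring

theorem prodConst_Gbar (i : k) (x y : Gen → Shat k) (a : Fin 2) : prodConst i x y (.Gbar a)
    = cst (1 / 2) * (ddt k (x .L) * y (.Gbar a) - x (.Gbar a) * ddt k (y .L))
      + ddt k (x (.Gbar a)) * y .L - x .L * ddt k (y (.Gbar a))
      + ∑ s, ∑ b, cst (1 / 2) * cst (pauli i s a b) *
          (x (.J s) * y (.Gbar b) - x (.Gbar b) * y (.J s)) := by
  have h3 : (cst (3 / 2 : k) : Shat k) = 1 + cst 2⁻¹ := by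
    rw [← map_one cst, ← map_add]
    norm_num
  simp only [prodConst, sum_gen, brConst, brLam, brDel, Pi.single_apply,
    smul_eq_cst_mul, ddt_mul, Pi.zero_apply, reduceCtorEq, if_false,
    map_zero, zero_mul, add_zero, sub_zero, zero_add,
    Gen.Gbar.injEq,
    Fin.sum_univ_two, Fin.sum_univ_three]
  fin_cases a <;> simp [h3] <;> ring

/-- Tracelessness is essential in the odd coordinates: the Pauli coordinates see `M` only modulo
scalar matrices, whereas `M` itself acts on the vectors. The relation `i² = -1` enters wherever two
second Pauli coordinates meet. -/
theorem prodConst_vec {i : k} (hi : i * i = -1) (r r' : Shat k)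
    (M M' : Matrix (Fin 2) (Fin 2) (Shat k)) (hM : M.trace = 0) (hM' : M'.trace = 0)
    (v w v' w' : Fin 2 → Shat k) :
    prodConst i (vec i r M v w) (vec i r' M' v' w')
      = vec i (ddt k r * r' - r * ddt k r' + 2 * (v ⬝ᵥ w') + 2 * (w ⬝ᵥ v'))
        (r' • M.map (ddt k) - r • M'.map (ddt k) + (M * M' - M' * M)
          + (2 : Shat k) • (Matrix.vecMulVec (ddt k ∘ w') v - Matrix.vecMulVec w' (ddt k ∘ v))
          + (2 : Shat k) • (Matrix.vecMulVec (ddt k ∘ w) v' - Matrix.vecMulVec w (ddt k ∘ v')))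
        ((1 / 2 : k) • (ddt k r • v' - ddt k r' • v) + r' • (ddt k ∘ v) - r • (ddt k ∘ v')
          + (M'ᵀ *ᵥ v - Mᵀ *ᵥ v'))
        ((1 / 2 : k) • (ddt k r • w' - ddt k r' • w) + r' • (ddt k ∘ w) - r • (ddt k ∘ w')
          + (M *ᵥ w' - M' *ᵥ w)) := by
  have hI := cst_mul_self hi
  have h2 := cst_inv_two_mul_two (k := k)
  rw [Matrix.trace_fin_two] at hM hM'
  have hM1 := eq_neg_of_add_eq_zero_right hM
  have hM1' := eq_neg_of_add_eq_zero_right hM'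
  ext1 u
  rcases u with _ | s | a | a
  · simp [prodConst_L, vec, dotProduct]
    ring
  · rw [prodConst_J i]
    simp only [vec, trace_mul_pauli]
    fin_cases s <;>
    simp [Fin.sum_univ_succ, pauli, Matrix.vecMulVec_apply, Matrix.mul_apply, ddt_cst,
      hM1, hM1']
    · linear_combination (2 * M' 0 0 * (M 0 1 - M 1 0) - 2 * M 0 0 * (M' 0 1 - M' 1 0)) * hI
    · ring
    · linear_combination (2 * M 1 0 * M' 0 1 - 2 * M 0 1 * M' 1 0) * hI
  · rw [prodConst_G]
    simp only [vec, trace_mul_pauli]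
    fin_cases a <;>
    simp [Fin.sum_univ_succ, pauli,
      smul_eq_cst_mul, hM1, hM1']
    · linear_combination (cst 2⁻¹ * (v 1 * M' 0 1 - v 1 * M' 1 0 - M 0 1 * v' 1 + M 1 0 * v' 1))
        * hI
        + (v 0 * M' 0 0 - v' 0 * M 0 0 + v 1 * M' 1 0 - M 1 0 * v' 1) * h2
    · linear_combination (cst 2⁻¹ * (v 0 * M' 1 0 - v 0 * M' 0 1 + M 0 1 * v' 0 - M 1 0 * v' 0))
        * hI
        + (v' 1 * M 0 0 - v 1 * M' 0 0 + v 0 * M' 0 1 - M 0 1 * v' 0) * h2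
  · rw [prodConst_Gbar]
    simp only [vec, trace_mul_pauli]
    fin_cases a <;>
    simp [Fin.sum_univ_succ, pauli,
      smul_eq_cst_mul, hM1, hM1']
    · linear_combination (cst 2⁻¹ * (M 1 0 * w' 1 - M 0 1 * w' 1 + w 1 * M' 0 1 - w 1 * M' 1 0))
        * hI
        + (w' 0 * M 0 0 - w 0 * M' 0 0 + M 0 1 * w' 1 - w 1 * M' 0 1) * h2
    · linear_combination (cst 2⁻¹ * (M 0 1 * w' 0 - M 1 0 * w' 0 - w 0 * M' 0 1 + w 0 * M' 1 0))
        * hI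
        + (w 1 * M' 0 0 - w' 1 * M 0 0 + M 1 0 * w' 0 - w 0 * M' 1 0) * h2

end

/-! ### Expansion in powers of the derivation -/

section

variable {k : Type*} [Field k]

/-- The matrix `∑_s w_s J^s` of the `J`-coordinates. -/
def toMat (i : k) (w : Gen → Shat k) : Matrix (Fin 2) (Fin 2) (Shat k) :=
  ∑ s, w (.J s) • (Jmat i s).map cst

theorem trace_toMat (i : k) (w : Gen → Shat k) : (toMat i w).trace = 0 := by
  simp [toMat, Fin.sum_univ_three, Jmat, pauli, Matrix.trace_fin_two]

/-- The matrices `J^s = σ^s / 2` and `σ^s` are dual bases for the trace form on `sl₂`. -/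
theorem vec_coords [CharZero k] {i : k} (hi : i * i = -1) (w : Gen → Shat k) :
    vec i (w .L) (toMat i w) (fun a => w (.G a)) (fun a => w (.Gbar a)) = w := by
  have hI := cst_mul_self hi
  have h2 := cst_inv_two_mul_two (k := k)
  ext1 u
  rcases u with _ | s | a | a
  · rfl
  · simp only [vec, trace_mul_pauli]
    fin_cases s <;> simp [toMat, Fin.sum_univ_three, Jmat, pauli]
    · linear_combination (w (.J 0)) * h2
    · linear_combination (-2 * cst 2⁻¹ * w (.J 1)) * hI + (w (.J 1)) * h2
    · linear_combination (w (.J 2)) * h2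
  · rfl
  · rfl

/-- The three Pauli coordinates together with the trace determine the four entries of a matrix,
since `2` and `i` are invertible. This is the device by which identities between elements become
identities between matrices. -/
theorem eq_of_vec_eq [CharZero k] {i : k} (hi : i * i = -1)
    {M N : Matrix (Fin 2) (Fin 2) (Shat k)} (hM : M.trace = 0) (hN : N.trace = 0)
    {r r' : Shat k} {v w v' w' : Fin 2 → Shat k} (h : vec i r M v w = vec i r' N v' w') :
    r = r' ∧ M = N ∧ v = v' ∧ w = w' := by
  obtain ⟨t, h2⟩ : ∃ t : Shat k, t * 2 = 1 := ⟨_, cst_inv_two_mul_two⟩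
  refine ⟨congrFun h .L, ?_, funext fun a => congrFun h (.G a),
    funext fun a => congrFun h (.Gbar a)⟩
  have e0 := congrFun h (.J 0)
  have e1 := congrFun h (.J 1)
  have e2 := congrFun h (.J 2)
  rw [Matrix.trace_fin_two] at hM hN
  simp only [vec, trace_mul_pauli] at e0 e1 e2
  simp at e0 e1 e2
  -- The second coordinate carries a factor `i`, which may be cancelled because `i² = -1` excludes
  -- `i = 0`.
  have e1' : M 0 1 - M 1 0 = N 0 1 - N 1 0 := by
    refine e1.resolve_right fun h => ?_
    simp [h] at hi
  refine Matrix.ext fun a b => ?_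
  fin_cases a <;> fin_cases b <;> simp
  · linear_combination t * (hM - hN + e2) - (M 0 0 - N 0 0) * h2
  · linear_combination t * (e0 + e1') - (M 0 1 - N 0 1) * h2
  · linear_combination t * (e0 - e1') - (M 1 0 - N 1 0) * h2
  · linear_combination t * (hM - hN - e2) - (M 1 1 - N 1 1) * h2

theorem n4Der_pow_gen (u : Gen) (n : ℕ) :
    (n4Der k ^ n) (gen u) = Pi.single u (Polynomial.X ^ n) := by
  induction n with
  | zero => rfl
  | succ n ih =>
    rw [pow_succ', Module.End.mul_apply, ih]
    ext1 v
    by_cases h : v = u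
    · subst h
      simp [n4Der, pow_succ']
    · simp [n4Der, Pi.single_eq_of_ne h]

theorem n4_eq_sum (x : N4 k) :
    x = ∑ u, (x u).sum fun n c => c • (n4Der k ^ n) (gen u) := by
  ext1 v
  rw [Finset.sum_apply, Finset.sum_eq_single v]
  · rw [Polynomial.sum_def, Finset.sum_apply]
    simp only [n4Der_pow_gen, Pi.smul_apply, Pi.single_eq_same]
    conv_lhs => rw [(x v).as_sum_support]
    simp [Polynomial.smul_X_eq_monomial]
  · intro u _ h
    rw [Polynomial.sum_def, Finset.sum_apply]
    simp [n4Der_pow_gen, Pi.single_eq_of_ne h.symm]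
  · simp

variable [CharZero k]

/-- Induction on elements of `𝒜 ⊗ Ŝ`, built from multiples of generators by sums and the
derivation. -/
theorem der_induction (i : k) {P : Shat k ⊗[k] N4 k → Prop} (hz : P 0)
    (ha : ∀ x y, P x → P y → P (x + y)) (hd : ∀ x, P x → P ((n4Shat i).der x))
    (hg : ∀ (r : Shat k) u, P (r ⊗ₜ gen u)) (x : Shat k ⊗[k] N4 k) : P x := by
  have key : ∀ (n : ℕ) (r : Shat k) (u : Gen), P (r ⊗ₜ (n4Der k ^ n) (gen u)) := by
    intro n
    induction n with
    | zero => exact hg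
    | succ n ih =>
      intro r u
      -- The Leibniz rule for `D` is solved for the term with one more `∂`; the correction has the
      -- same power of `∂` as before but a differentiated coefficient, which is why `r` is kept
      -- general in the induction.
      have h : r ⊗ₜ[k] (n4Der k ^ (n + 1)) (gen u)
          = (n4Shat i).der (r ⊗ₜ (n4Der k ^ n) (gen u)) + (-ddt k r) ⊗ₜ (n4Der k ^ n) (gen u) := by
        rw [der_tmul, pow_succ', Module.End.mul_apply, TensorProduct.neg_tmul,
          add_neg_cancel_right]
      rw [h]
      exact ha _ _ (hd _ (ih r u)) (ih _ u)
  induction x using TensorProduct.induction_on with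
  | zero => exact hz
  | add x y hx hy => exact ha x y hx hy
  | tmul r x =>
    rw [n4_eq_sum x, TensorProduct.tmul_sum]
    refine Finset.sum_induction _ P ha hz fun u _ => ?_
    rw [Polynomial.sum_def, TensorProduct.tmul_sum]
    refine Finset.sum_induction _ P ha hz fun n _ => ?_
    rw [← TensorProduct.smul_tmul]
    exact key n _ u

/-- The map `(w_n)_n ↦ ∑_n D^n w_n`. -/
def derSum (i : k) : (ℕ →₀ (Gen → Shat k)) →ₗ[k] Shat k ⊗[k] N4 k :=
  Finsupp.lsum k fun n => ((n4Shat i).der ^ n) ∘ₗ (iota.restrictScalars k)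

theorem derSum_single (i : k) (n : ℕ) (w : Gen → Shat k) :
    derSum i (Finsupp.single n w) = ((n4Shat i).der ^ n) (iota w) := by
  simp [derSum]

/-- The coefficients of an element with respect to the powers of `∂`. -/
def delCoeff (n : ℕ) (u : Gen) : Shat k ⊗[k] N4 k →ₗ[k] Shat k :=
  TensorProduct.lift ((LinearMap.lsmul k (Shat k)).flip.compl₂
    ((Polynomial.lcoeff k n) ∘ₗ LinearMap.proj u))

theorem delCoeff_tmul (n : ℕ) (u : Gen) (r : Shat k) (x : N4 k) :
    delCoeff n u (r ⊗ₜ x) = (x u).coeff n • r := rfl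

theorem delCoeff_der_succ (i : k) (n : ℕ) (u : Gen) (x : Shat k ⊗[k] N4 k) :
    delCoeff (n + 1) u ((n4Shat i).der x) = delCoeff n u x + ddt k (delCoeff (n + 1) u x) := by
  induction x using TensorProduct.induction_on with
  | zero => simp
  | add x y hx hy =>
    simp only [map_add, hx, hy]
    abel
  | tmul r x =>
    rw [der_tmul, map_add, delCoeff_tmul, delCoeff_tmul, delCoeff_tmul, delCoeff_tmul,
      Derivation.map_smul]
    simp [n4Der]

theorem delCoeff_iota (n : ℕ) (u : Gen) (w : Gen → Shat k) :
    delCoeff n u (iota w) = if n = 0 then w u else 0 := by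
  rw [iota_apply, map_sum, Finset.sum_eq_single u]
  · simp [delCoeff_tmul, gen, Polynomial.coeff_one]
  · intro v _ h
    simp [delCoeff_tmul, gen, Pi.single_eq_of_ne h.symm]
  · simp

/-- Triangularity: `D^m w` equals `∂^m w` plus terms of lower degree in `∂`. -/
theorem delCoeff_der_pow (i : k) (m n : ℕ) (hmn : m ≤ n) (u : Gen) (w : Gen → Shat k) :
    delCoeff n u (((n4Shat i).der ^ m) (iota w)) = if m = n then w u else 0 := by
  induction m generalizing n with
  | zero => simp [delCoeff_iota, eq_comm]
  | succ m ih =>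
    obtain ⟨n, rfl⟩ : ∃ l, n = l + 1 := ⟨n - 1, by omega⟩
    rw [pow_succ', Module.End.mul_apply, delCoeff_der_succ, ih n (by omega),
      ih (n + 1) (by omega), if_neg (by omega : ¬m = n + 1)]
    simp

/-- In a vanishing sum `∑ D^n w_n`, the coefficient of the highest occurring power of `∂` is the
last `w_n`, by triangularity. -/
theorem derSum_injective (i : k) : Function.Injective (derSum i) := by
  rw [injective_iff_map_eq_zero]
  intro f hf
  by_contra h
  have hs : f.support.Nonempty := Finsupp.support_nonempty_iff.2 h
  have hN := Finset.max'_mem _ hs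
  refine Finsupp.mem_support_iff.1 hN ?_
  ext1 u
  have e := congrArg (delCoeff (f.support.max' hs) u) hf
  rw [map_zero, derSum, Finsupp.lsum_apply, Finsupp.sum, map_sum, Finset.sum_eq_single _ _
    (fun h => absurd hN h)] at e
  · simpa [delCoeff_der_pow] using e
  · intro m hm hne
    simp [delCoeff_der_pow i m _ (Finset.le_max' _ m hm), hne]

theorem der_derSum (i : k) (f : ℕ →₀ (Gen → Shat k)) :
    (n4Shat i).der (derSum i f) = derSum i (f.mapDomain (· + 1)) := by
  induction f using Finsupp.induction_linear with
  | zero => simp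
  | add f g hf hg => rw [map_add, map_add, hf, hg, Finsupp.mapDomain_add, map_add]
  | single n w =>
    rw [Finsupp.mapDomain_single, derSum_single, derSum_single, pow_succ', Module.End.mul_apply]

theorem derSum_surjective (i : k) : Function.Surjective (derSum i) := by
  intro x
  induction x using der_induction i with
  | hz => exact ⟨0, map_zero _⟩
  | ha x y hx hy =>
    obtain ⟨f, rfl⟩ := hx
    obtain ⟨g, rfl⟩ := hy
    exact ⟨f + g, map_add _ _ _⟩
  | hd x hx =>
    obtain ⟨f, rfl⟩ := hx
    exact ⟨_, (der_derSum i f).symm⟩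
  | hg r u => exact ⟨Finsupp.single 0 (Pi.single u r), by simp [derSum_single, iota_single]⟩

/-- The coefficients `w_n` in the expansion `∑_n D^n w_n` of an element. -/
def coeffs (i : k) : Shat k ⊗[k] N4 k ≃ₗ[k] (ℕ →₀ (Gen → Shat k)) :=
  (LinearEquiv.ofBijective (derSum i) ⟨derSum_injective i, derSum_surjective i⟩).symm

theorem coeffs_derSum (i : k) (f : ℕ →₀ (Gen → Shat k)) : coeffs i (derSum i f) = f :=
  (LinearEquiv.ofBijective (derSum i) _).symm_apply_apply f

theorem derSum_coeffs (i : k) (x : Shat k ⊗[k] N4 k) : derSum i (coeffs i x) = x :=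
  (LinearEquiv.ofBijective (derSum i) _).apply_symm_apply x

theorem eq_sum_coeffs (i : k) (x : Shat k ⊗[k] N4 k) :
    x = ∑ n ∈ (coeffs i x).support, ((n4Shat i).der ^ n) (iota (coeffs i x n)) :=
  (derSum_coeffs i x).symm

theorem coeffs_iota (i : k) (w : Gen → Shat k) : coeffs i (iota w) = Finsupp.single 0 w := by
  rw [← coeffs_derSum i (Finsupp.single 0 w), derSum_single, pow_zero, Module.End.one_apply]

theorem iota_injective : Function.Injective (iota : (Gen → Shat k) → Shat k ⊗[k] N4 k) := by
  intro w w' h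
  -- The derivation does not involve `i`, so the expansion for any value of the parameter serves.
  have := congrArg (coeffs (0 : k)) h
  rwa [coeffs_iota, coeffs_iota, (Finsupp.single_injective 0).eq_iff] at this

theorem coeffs_der (i : k) (x : Shat k ⊗[k] N4 k) :
    coeffs i ((n4Shat i).der x) = (coeffs i x).mapDomain (· + 1) := by
  obtain ⟨f, rfl⟩ := derSum_surjective i x
  rw [der_derSum, coeffs_derSum, coeffs_derSum]

theorem coeffs_der_zero (i : k) (x : Shat k ⊗[k] N4 k) : coeffs i ((n4Shat i).der x) 0 = 0 := by
  rw [coeffs_der, Finsupp.mapDomain_of_notMem_range]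
  simp

/-! ### Extension of maps that commute with the derivation -/

theorem hom_ext_gen (i : k) {f g : Shat k ⊗[k] N4 k →ₗ[Shat k] Shat k ⊗[k] N4 k}
    (hf : ∀ x, f ((n4Shat i).der x) = (n4Shat i).der (f x))
    (hg : ∀ x, g ((n4Shat i).der x) = (n4Shat i).der (g x))
    (h : ∀ u, f (1 ⊗ₜ gen u) = g (1 ⊗ₜ gen u)) : f = g := by
  refine LinearMap.ext fun x => ?_
  induction x using der_induction i with
  | hz => simp
  | ha x y hx hy => rw [map_add, map_add, hx, hy]
  | hd x hx => rw [hf, hg, hx]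
  | hg r u =>
    have e : r ⊗ₜ[k] gen u = r • ((1 : Shat k) ⊗ₜ[k] (gen u : N4 k)) := by
      rw [TensorProduct.smul_tmul', smul_eq_mul, mul_one]
    rw [e, map_smul, map_smul, h]

/-- Sesquilinearity in `D` and in `Ŝ` propagates multiplicativity from the generators. All orders
`n` are handled at once, because moving `D` or a coefficient out of an argument changes the order.
-/
theorem map_nProd_of_gen (i : k) {f : Shat k ⊗[k] N4 k ≃ₗ[Shat k] Shat k ⊗[k] N4 k}
    (hf : ∀ x, f ((n4Shat i).der x) = (n4Shat i).der (f x))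
    (h : ∀ n u v, f ((n4Shat i).nProd n (1 ⊗ₜ gen u) (1 ⊗ₜ gen v))
      = (n4Shat i).nProd n (f (1 ⊗ₜ gen u)) (f (1 ⊗ₜ gen v))) (n : ℕ) (x y : Shat k ⊗[k] N4 k) :
    f ((n4Shat i).nProd n x y) = (n4Shat i).nProd n (f x) (f y) := by
  have hk : ∀ (c : k) x, f (c • x) = c • f x := fun c x => f.toLinearMap.map_smul_of_tower c x
  have e : ∀ (r : Shat k) u, r ⊗ₜ[k] gen u = r • ((1 : Shat k) ⊗ₜ[k] (gen u : N4 k)) := by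
    intro r u
    rw [TensorProduct.smul_tmul', smul_eq_mul, mul_one]
  induction x using der_induction i generalizing n with
  | hz => simp
  | ha x x' hx hx' => simp only [map_add, LinearMap.add_apply, hx, hx']
  | hd x hx =>
    rw [hf, (n4Shat i).nProd_der_left, (n4Shat i).nProd_der_left, map_neg, hk, hx]
  | hg r u =>
    induction y using der_induction i generalizing n with
    | hz => simp
    | ha x x' hx hx' => simp only [map_add, hx, hx']
    | hd x hx =>
      rw [hf, (n4Shat i).nProd_der_right, (n4Shat i).nProd_der_right, map_add, hf, hk, hx, hx]
    | hg s v =>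
      rw [e r, e s, (n4Shat i).nProd_smul_right, f.map_smul, f.map_smul, f.map_smul,
        (n4Shat i).nProd_smul_right, (n4Shat i).nProd_smul_left, (n4Shat i).nProd_smul_left]
      congr 1
      refine (AddEquiv.map_finsum f.toAddEquiv _).trans (finsum_congr fun j => ?_)
      change f (_ • _) = _
      rw [f.map_smul, h]

end

/-! ### Extension of endomorphisms of the span of the generators -/

section

variable {k : Type*} [Field k] [CharZero k]

/-- The extension of an `Ŝ`-linear map between combinations of generators to the `k`-linear map
that commutes with the derivation. -/
def extendAux (i : k) (θ : Module.End (Shat k) (Gen → Shat k)) :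
    Shat k ⊗[k] N4 k →ₗ[k] Shat k ⊗[k] N4 k :=
  derSum i ∘ₗ Finsupp.mapRange.linearMap (θ.restrictScalars k) ∘ₗ (coeffs i).toLinearMap

theorem extendAux_der_pow (i : k) (θ : Module.End (Shat k) (Gen → Shat k)) (n : ℕ)
    (w : Gen → Shat k) : extendAux i θ (((n4Shat i).der ^ n) (iota w))
      = ((n4Shat i).der ^ n) (iota (θ w)) := by
  rw [← derSum_single, ← derSum_single, extendAux]
  simp [coeffs_derSum]

theorem extendAux_iota (i : k) (θ : Module.End (Shat k) (Gen → Shat k))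
    (w : Gen → Shat k) : extendAux i θ (iota w) = iota (θ w) :=
  extendAux_der_pow i θ 0 w

theorem extendAux_der (i : k) (θ : Module.End (Shat k) (Gen → Shat k))
    (x : Shat k ⊗[k] N4 k) :
    extendAux i θ ((n4Shat i).der x) = (n4Shat i).der (extendAux i θ x) := by
  rw [eq_sum_coeffs i x]
  simp only [map_sum]
  refine Finset.sum_congr rfl fun n _ => ?_
  have h := extendAux_der_pow i θ (n + 1) (coeffs i x n)
  rwa [pow_succ', Module.End.mul_apply, Module.End.mul_apply, ← extendAux_der_pow] at h

/-- The extension of an `Ŝ`-linear map between combinations of generators to the `Ŝ`-linear map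
that commutes with the derivation. -/
def extend (i : k) (θ : Module.End (Shat k) (Gen → Shat k)) :
    Module.End (Shat k) (Shat k ⊗[k] N4 k) :=
  { extendAux i θ with
    map_smul' := fun r x => by
      change extendAux i θ (r • x) = r • extendAux i θ x
      induction x using der_induction i generalizing r with
      | hz => simp
      | ha x y hx hy => rw [smul_add, map_add, map_add, smul_add, hx, hy]
      | hd x hx =>
        -- Since `r D x = D(r x) - r' x`, linearity at `D x` follows from linearity at `x` for the
        -- two coefficients `r` and `r'`.
        have h := (n4Shat i).der_smul r x
        rw [← sub_eq_iff_eq_add] at h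
        rw [← h, map_sub, extendAux_der, extendAux_der, hx, hx, (n4Shat i).der_smul,
          add_sub_cancel_right]
      | hg s u =>
        rw [← iota_single, ← map_smul, extendAux_iota, extendAux_iota, map_smul, map_smul] }

theorem extend_iota (i : k) (θ : Module.End (Shat k) (Gen → Shat k))
    (w : Gen → Shat k) : extend i θ (iota w) = iota (θ w) := extendAux_iota i θ w

theorem extend_der (i : k) (θ : Module.End (Shat k) (Gen → Shat k))
    (x : Shat k ⊗[k] N4 k) :
    extend i θ ((n4Shat i).der x) = (n4Shat i).der (extend i θ x) := extendAux_der i θ x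

theorem coeffs_extend (i : k) (θ : Module.End (Shat k) (Gen → Shat k))
    (x : Shat k ⊗[k] N4 k) (n : ℕ) : coeffs i (extend i θ x) n = θ (coeffs i x n) := by
  change coeffs i (derSum i (Finsupp.mapRange.linearMap (θ.restrictScalars k) (coeffs i x))) n = _
  rw [coeffs_derSum]
  rfl

/-- `extend` as a homomorphism of monoids. -/
def extendHom (i : k) :
    Module.End (Shat k) (Gen → Shat k) →* Module.End (Shat k) (Shat k ⊗[k] N4 k) where
  toFun := extend i
  map_one' := by
    refine hom_ext_gen i (extend_der i 1) (fun x => rfl) fun u => ?_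
    rw [← iota_single, extend_iota]
    rfl
  map_mul' θ θ' := by
    refine hom_ext_gen i (extend_der i _) (fun x => ?_) fun u => ?_
    · rw [Module.End.mul_apply, extend_der, extend_der, Module.End.mul_apply]
    · rw [← iota_single, Module.End.mul_apply, extend_iota, extend_iota, extend_iota,
        Module.End.mul_apply]

/-- A family of endomorphisms of the combinations of generators, indexed by a group, as a group of
automorphisms of the module `𝒜 ⊗ Ŝ`. -/
def extendGroup (i : k) {Γ : Type*} [Group Γ] (ρ : Γ →* Module.End (Shat k) (Gen → Shat k)) :
    Γ →* (Shat k ⊗[k] N4 k ≃ₗ[Shat k] Shat k ⊗[k] N4 k) :=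
  (LinearMap.GeneralLinearGroup.generalLinearEquiv _ _).toMonoidHom.comp
    ((extendHom i).comp ρ).toHomUnits

theorem extendGroup_apply (i : k) {Γ : Type*} [Group Γ]
    (ρ : Γ →* Module.End (Shat k) (Gen → Shat k)) (g : Γ) (x : Shat k ⊗[k] N4 k) :
    extendGroup i ρ g x = extend i (ρ g) x := rfl

/-- As `D` is even, the grading can be read off coefficientwise from the expansion in powers of `D`,
although it is defined by base change. -/
theorem mem_parity_iff (i : k) (p : ZMod 2) (x : Shat k ⊗[k] N4 k) :
    x ∈ (n4Shat i).parity p ↔ ∀ n u, u.parity ≠ p → coeffs i x n u = 0 := by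
  have hg : ∀ (r : Shat k) u, r ⊗ₜ[k] (gen u : N4 k) ∈ (n4Shat i).parity u.parity := by
    intro r u
    refine Submodule.tmul_mem_baseChange_of_mem r fun v hv => ?_
    exact Pi.single_eq_of_ne (fun h => hv (by rw [h])) _
  have hs : ∀ p (f : ℕ →₀ (Gen → Shat k)), (∀ n u, u.parity ≠ p → f n u = 0) →
      derSum i f ∈ (n4Shat i).parity p := by
    intro p f hf
    rw [derSum, Finsupp.lsum_apply]
    refine Submodule.sum_mem _ fun n _ => ?_
    have : iota (f n) ∈ (n4Shat i).parity p := by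
      rw [iota_apply]
      refine Submodule.sum_mem _ fun u _ => ?_
      by_cases h : u.parity = p
      · exact h ▸ hg _ u
      · rw [hf n u h, TensorProduct.zero_tmul]
        exact Submodule.zero_mem _
    exact (fun m => m.rec this fun m ih => by
      rw [pow_succ', Module.End.mul_apply]
      exact (n4Shat i).der_mem p _ ih : ∀ m : ℕ, ((n4Shat i).der ^ m) (iota (f n)) ∈ _) n
  refine ⟨fun hx n u hu => ?_, fun h => derSum_coeffs i x ▸ hs p _ h⟩
  -- The expansion is split into its parts of parity `p` and `p + 1`. The second part is then
  -- homogeneous of both parities, hence zero.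
  set f' : ℕ →₀ (Gen → Shat k) := (coeffs i x).mapRange
    (fun w u => if u.parity = p then w u else 0) (by ext1; simp) with hf'
  set f'' : ℕ →₀ (Gen → Shat k) := (coeffs i x).mapRange
    (fun w u => if u.parity = p then 0 else w u) (by ext1; simp) with hf''
  have e : f' + f'' = coeffs i x := by
    refine Finsupp.ext fun n => funext fun u => ?_
    by_cases h : u.parity = p <;> simp [hf', hf'', h]
  have h1 : derSum i f' ∈ (n4Shat i).parity p := hs p f' fun n u hu => by simp [hf', hu]
  have h2 : derSum i f'' ∈ (n4Shat i).parity (p + 1) := hs (p + 1) f'' fun n u hu => by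
    have : u.parity = p :=
      (by decide : ∀ p q : ZMod 2, q ≠ p + 1 → q = p) p u.parity hu
    simp [hf'', this]
  have h3 : derSum i f'' ∈ (n4Shat i).parity p := by
    have : derSum i f'' = x - derSum i f' := by
      rw [eq_sub_iff_add_eq', ← map_add, e, derSum_coeffs]
    rw [this]
    exact Submodule.sub_mem _ hx h1
  have hd : Disjoint ((n4Shat i).parity p) ((n4Shat i).parity (p + 1)) := by
    rcases zmod_two_cases p with rfl | rfl
    · exact (n4Shat i).parity_isCompl.disjoint
    · exact (n4Shat i).parity_isCompl.disjoint.symm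
  have h0 := derSum_injective i ((Submodule.disjoint_def.1 hd _ h3 h2).trans (map_zero _).symm)
  have := congrFun (DFunLike.congr_fun h0 n) u
  simpa [hf'', hu] using this

/-- The extension of a family of endomorphisms of the combinations of generators acts by
automorphisms of the conformal superalgebra, provided that the family respects the parity and
brackets of generators. -/
theorem extendGroup_mem_Aut (i : k) {Γ : Type*} [Group Γ]
    (ρ : Γ →* Module.End (Shat k) (Gen → Shat k)) (g : Γ)
    (hp : ∀ p w, (∀ u : Gen, u.parity ≠ p → w u = 0) → ∀ u : Gen, u.parity ≠ p → ρ g w u = 0)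
    (h1 : ∀ x y, (∀ u, ddt k (x u) = 0) → (∀ u, ddt k (y u) = 0) →
      prodLam i (ρ g x) (ρ g y) = ρ g (prodLam i x y))
    (hd : ∀ x y, (∀ u, ddt k (x u) = 0) → (∀ u, ddt k (y u) = 0) →
      prodDel i (ρ g x) (ρ g y) = ρ g (prodDel i x y))
    (h0 : ∀ x y, (∀ u, ddt k (x u) = 0) → (∀ u, ddt k (y u) = 0) →
      prodConst i (ρ g x) (ρ g y) = ρ g (prodConst i x y)) :
    extendGroup i ρ g ∈ (n4Shat i).Aut := by
  refine ⟨fun p x hx => ?_, map_nProd_of_gen i (extend_der i (ρ g)) fun n u v => ?_,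
    extend_der i (ρ g)⟩
  · rw [mem_parity_iff] at hx ⊢
    intro n u hu
    rw [extendGroup_apply, coeffs_extend]
    exact hp p _ (hx n) u hu
  · have hc : ∀ u v, ddt k ((Pi.single u 1 : Gen → Shat k) v) = 0 := by
      intro u v
      rw [Pi.single_apply]
      split_ifs <;> simp
    rw [← iota_single, ← iota_single, extendGroup_apply, extendGroup_apply, extendGroup_apply,
      extend_iota, extend_iota]
    rcases n with _ | _ | n
    · rw [nProd_iota_zero, nProd_iota_zero, map_add, extend_der, extend_iota, extend_iota,
        hd _ _ (hc u) (hc v), h0 _ _ (hc u) (hc v)]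
    · rw [zero_add, nProd_iota_one, nProd_iota_one, extend_iota, h1 _ _ (hc u) (hc v)]
    · rw [nProd_iota_of_two_le i (by omega), nProd_iota_of_two_le i (by omega), map_zero]

end

/-! ### The action of `SL₂(Ŝ)` -/

section

variable {k : Type*} [Field k] [CharZero k]

theorem vec_congr (i : k) {r r' : Shat k} {M M' : Matrix (Fin 2) (Fin 2) (Shat k)}
    {v w v' w' : Fin 2 → Shat k} (hr : r = r') (hM : M = M') (hv : v = v') (hw : w = w') :
    vec i r M v w = vec i r' M' v' w' := by
  rw [hr, hM, hv, hw]

/-- The Pauli matrices are traceless, so scalar matrices are invisible in the coordinates. This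
allows matrices that are not traceless to appear in intermediate formulas. -/
theorem vec_add_scalar (i : k) (r c : Shat k) (M : Matrix (Fin 2) (Fin 2) (Shat k))
    (v w : Fin 2 → Shat k) : vec i r (M + c • 1) v w = vec i r M v w := by
  ext1 u
  rcases u with _ | s | a | a
  · rfl
  · simp only [vec, trace_mul_pauli]
    fin_cases s <;> simp
  · rfl
  · rfl

theorem toMat_vec {i : k} (hi : i * i = -1) (r : Shat k) {M : Matrix (Fin 2) (Fin 2) (Shat k)}
    (hM : M.trace = 0) (v w : Fin 2 → Shat k) : toMat i (vec i r M v w) = M :=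
  (eq_of_vec_eq hi (trace_toMat i _) hM (vec_coords hi (vec i r M v w))).2.1

theorem exists_toMat_vec {i : k} (hi : i * i = -1) (r : Shat k)
    (M : Matrix (Fin 2) (Fin 2) (Shat k)) (v w : Fin 2 → Shat k) :
    ∃ c : Shat k, toMat i (vec i r M v w) = M + c • 1 := by
  refine ⟨-(cst 2⁻¹ * M.trace), ?_⟩
  rw [← vec_add_scalar i r (-(cst 2⁻¹ * M.trace)) M v w, toMat_vec hi]
  rw [Matrix.trace_add, Matrix.trace_smul, Matrix.trace_one]
  simp only [Fintype.card_fin, smul_eq_mul]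
  linear_combination (-M.trace) * cst_inv_two_mul_two (k := k)

theorem toMat_add (i : k) (x y : Gen → Shat k) : toMat i (x + y) = toMat i x + toMat i y := by
  simp [toMat, add_smul, Finset.sum_add_distrib]

theorem toMat_smul (i : k) (c : Shat k) (x : Gen → Shat k) :
    toMat i (c • x) = c • toMat i x := by
  simp [toMat, Finset.smul_sum, smul_smul]

theorem map_ddt_mul (M N : Matrix (Fin 2) (Fin 2) (Shat k)) :
    (M * N).map (ddt k) = M.map (ddt k) * N + M * N.map (ddt k) := by
  refine Matrix.ext fun a b => ?_
  simp only [Matrix.map_apply, Matrix.add_apply, Matrix.mul_apply, map_sum, ddt_mul,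
    ← Finset.sum_add_distrib]
  exact Finset.sum_congr rfl fun _ _ => by ring

theorem ddt_mulVec (M : Matrix (Fin 2) (Fin 2) (Shat k)) (v : Fin 2 → Shat k) :
    ddt k ∘ (M *ᵥ v) = M.map (ddt k) *ᵥ v + M *ᵥ (ddt k ∘ v) := by
  funext a
  simp only [Function.comp_apply, Pi.add_apply, Matrix.mulVec, dotProduct, map_sum, ddt_mul,
    ← Finset.sum_add_distrib, Matrix.map_apply]
  exact Finset.sum_congr rfl fun _ _ => by ring

theorem map_ddt_toMat (i : k) {x : Gen → Shat k} (hx : ∀ u, ddt k (x u) = 0) :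
    (toMat i x).map (ddt k) = 0 := by
  refine Matrix.ext fun a b => ?_
  simp [toMat, Matrix.sum_apply, ddt_cst, hx]

theorem ddt_one : ddt k 1 = 0 := (ddt k).map_one_eq_zero

theorem map_ddt_one : (1 : Matrix (Fin 2) (Fin 2) (Shat k)).map (ddt k) = 0 := by
  refine Matrix.ext fun a b => ?_
  rw [Matrix.map_apply, Matrix.one_apply]
  split_ifs <;> simp

/-- Obtained by differentiating `Y Z = 1`. -/
theorem map_ddt_inv {Y Z : Matrix (Fin 2) (Fin 2) (Shat k)} (hYZ : Y * Z = 1) (hZY : Z * Y = 1) :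
    Z.map (ddt k) = -(Z * (Y.map (ddt k) * Z)) := by
  have h := congrArg (fun M => Z * M.map (ddt k)) hYZ
  simp only [map_ddt_mul, Matrix.mul_add, map_ddt_one, Matrix.mul_zero] at h
  rw [← Matrix.mul_assoc Z Y, hZY, Matrix.one_mul] at h
  rw [eq_neg_iff_add_eq_zero, add_comm, h]

/-- Jacobi's formula: the trace is the derivative of `det Y`. Hence the logarithmic derivative of an
element of `SL₂(Ŝ)` lies in `sl₂(Ŝ)`. -/
theorem trace_map_ddt_mul_adjugate {Y : Matrix (Fin 2) (Fin 2) (Shat k)} (hY : Y.det = 1) :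
    (Y.map (ddt k) * Y.adjugate).trace = 0 := by
  have h := congrArg (ddt k) hY
  rw [Matrix.det_fin_two, map_sub, ddt_mul, ddt_mul, ddt_one] at h
  rw [Matrix.adjugate_fin_two, Matrix.trace_fin_two]
  simp [Matrix.mul_apply, Fin.sum_univ_two]
  linear_combination h

/-- The action on combinations of generators of a matrix `Y` with inverse `Z`. -/
def gaugeEnd (i : k) (Y Z : Matrix (Fin 2) (Fin 2) (Shat k)) :
    Module.End (Shat k) (Gen → Shat k) where
  toFun x := vec i (x .L) (x .L • (Y.map (ddt k) * Z) + Y * toMat i x * Z)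
    (Zᵀ *ᵥ fun a => x (.G a)) (Y *ᵥ fun a => x (.Gbar a))
  map_add' x y := by
    rw [vec_add]
    refine vec_congr i rfl ?_ ?_ ?_
    · rw [toMat_add, Pi.add_apply, add_smul, Matrix.mul_add, Matrix.add_mul]
      abel
    · rw [← Matrix.mulVec_add]
      rfl
    · rw [← Matrix.mulVec_add]
      rfl
  map_smul' c x := by
    rw [RingHom.id_apply, smul_vec]
    refine vec_congr i rfl ?_ ?_ ?_
    · rw [toMat_smul, Pi.smul_apply, smul_eq_mul, mul_smul, Matrix.mul_smul, Matrix.smul_mul,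
        smul_add]
    · rw [← Matrix.mulVec_smul]
      rfl
    · rw [← Matrix.mulVec_smul]
      rfl

/-- The formula extends from traceless `M` to all `M` because conjugation fixes scalar matrices,
which the coordinates ignore. -/
theorem gaugeEnd_vec {i : k} (hi : i * i = -1) {Y Z : Matrix (Fin 2) (Fin 2) (Shat k)}
    (hYZ : Y * Z = 1) (r : Shat k) (M : Matrix (Fin 2) (Fin 2) (Shat k)) (v w : Fin 2 → Shat k) :
    gaugeEnd i Y Z (vec i r M v w)
      = vec i r (r • (Y.map (ddt k) * Z) + Y * M * Z) (Zᵀ *ᵥ v) (Y *ᵥ w) := by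
  obtain ⟨c, hc⟩ := exists_toMat_vec hi r M v w
  have h : gaugeEnd i Y Z (vec i r M v w) = vec i r
    (r • (Y.map (ddt k) * Z) + Y * toMat i (vec i r M v w) * Z) (Zᵀ *ᵥ v) (Y *ᵥ w) := rfl
  rw [h, hc, Matrix.mul_add, Matrix.add_mul, ← add_assoc, Matrix.mul_smul, Matrix.mul_one,
    Matrix.smul_mul, hYZ, vec_add_scalar]

theorem gaugeEnd_one {i : k} (hi : i * i = -1) : gaugeEnd i 1 1 = 1 := by
  refine LinearMap.ext fun x => ?_
  rw [← vec_coords hi x, gaugeEnd_vec hi (Matrix.one_mul 1), map_ddt_one]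
  simp

theorem gaugeEnd_mul {i : k} (hi : i * i = -1) {Y Z Y' Z' : Matrix (Fin 2) (Fin 2) (Shat k)}
    (hYZ : Y * Z = 1) (hYZ' : Y' * Z' = 1) :
    gaugeEnd i (Y * Y') (Z' * Z) = gaugeEnd i Y Z * gaugeEnd i Y' Z' := by
  refine LinearMap.ext fun x => ?_
  have h : Y * Y' * (Z' * Z) = 1 := by
    rw [Matrix.mul_assoc, ← Matrix.mul_assoc Y', hYZ', Matrix.one_mul, hYZ]
  rw [Module.End.mul_apply, ← vec_coords hi x, gaugeEnd_vec hi h, gaugeEnd_vec hi hYZ',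
    gaugeEnd_vec hi hYZ]
  refine vec_congr i rfl ?_ ?_ ?_
  -- The logarithmic derivative is a cocycle for conjugation; this is exactly what makes the shift
  -- of `L` compatible with composition.
  · have e : (Y * Y').map (ddt k) * (Z' * Z)
        = Y.map (ddt k) * Z + Y * (Y'.map (ddt k) * Z') * Z := by
      rw [map_ddt_mul, Matrix.add_mul, Matrix.mul_assoc (Y.map _), ← Matrix.mul_assoc Y', hYZ',
        Matrix.one_mul]
      simp only [Matrix.mul_assoc]
    rw [e, smul_add, Matrix.mul_add, Matrix.add_mul, Matrix.mul_smul, Matrix.smul_mul]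
    simp only [Matrix.mul_assoc, add_assoc]
  · rw [Matrix.transpose_mul, Matrix.mulVec_mulVec]
  · rw [Matrix.mulVec_mulVec]

/-- The polarised Cayley–Hamilton identity for two by two matrices, with one of them traceless. It
serves to recognise an anticommutator as a multiple of `A` modulo scalars. -/
theorem mul_add_mul_of_trace_eq_zero {R : Type*} [CommRing R] {A : Matrix (Fin 2) (Fin 2) R}
    (hA : A.trace = 0) (N : Matrix (Fin 2) (Fin 2) R) :
    A * N + N * A = N.trace • A + (A * N).trace • 1 := by
  rw [Matrix.trace_fin_two] at hA
  have h := eq_neg_of_add_eq_zero_right hA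
  refine Matrix.ext fun a b => ?_
  fin_cases a <;> fin_cases b <;>
    simp [Matrix.trace_fin_two, Matrix.mul_apply, Fin.sum_univ_two, h] <;> ring

theorem vecMulVec_mulVec_transpose (Y : Matrix (Fin 2) (Fin 2) (Shat k))
    (Z : Matrix (Fin 2) (Fin 2) (Shat k)) (v w : Fin 2 → Shat k) :
    Matrix.vecMulVec (Y *ᵥ w) (Zᵀ *ᵥ v) = Y * Matrix.vecMulVec w v * Z := by
  rw [Matrix.mul_vecMulVec, Matrix.vecMulVec_mul, Matrix.mulVec_transpose]

theorem prodLam_gauge {i : k} (hi : i * i = -1) {Y Z : Matrix (Fin 2) (Fin 2) (Shat k)}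
    (hYZ : Y * Z = 1) (x y : Gen → Shat k) :
    prodLam i (gaugeEnd i Y Z x) (gaugeEnd i Y Z y) = gaugeEnd i Y Z (prodLam i x y) := by
  rw [← vec_coords hi x, ← vec_coords hi y, gaugeEnd_vec hi hYZ, gaugeEnd_vec hi hYZ, prodLam_vec,
    prodLam_vec, gaugeEnd_vec hi hYZ]
  refine vec_congr i rfl ?_ ?_ ?_
  · rw [vecMulVec_mulVec_transpose, vecMulVec_mulVec_transpose]
    simp only [Matrix.mul_add, Matrix.add_mul, Matrix.mul_sub, Matrix.sub_mul, Matrix.mul_smul,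
      Matrix.smul_mul]
    module
  · simp only [Matrix.mulVec_smul, Matrix.mulVec_add]
  · simp only [Matrix.mulVec_smul, Matrix.mulVec_add]

theorem prodDel_gauge {i : k} (hi : i * i = -1) {Y Z : Matrix (Fin 2) (Fin 2) (Shat k)}
    (hYZ : Y * Z = 1) (x y : Gen → Shat k) :
    prodDel i (gaugeEnd i Y Z x) (gaugeEnd i Y Z y) = gaugeEnd i Y Z (prodDel i x y) := by
  rw [← vec_coords hi x, ← vec_coords hi y, gaugeEnd_vec hi hYZ, gaugeEnd_vec hi hYZ, prodDel_vec,
    prodDel_vec, gaugeEnd_vec hi hYZ]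
  refine vec_congr i rfl ?_ ?_ ?_
  · rw [vecMulVec_mulVec_transpose, vecMulVec_mulVec_transpose]
    simp only [Matrix.mul_add, Matrix.add_mul, Matrix.mul_sub, Matrix.sub_mul, Matrix.mul_smul,
      Matrix.smul_mul]
    module
  · simp only [Matrix.mulVec_smul, Matrix.mulVec_add]
  · simp only [Matrix.mulVec_smul, Matrix.mulVec_add]

/-- A conjugate of a constant matrix satisfies the Lax equation `P' = [A, P]`, where `A` is the
logarithmic derivative of `Y`. -/
theorem map_ddt_conj {Y Z M : Matrix (Fin 2) (Fin 2) (Shat k)} (hYZ : Y * Z = 1)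
    (hZY : Z * Y = 1) (hM : M.map (ddt k) = 0) :
    (Y * M * Z).map (ddt k)
      = Y.map (ddt k) * Z * (Y * M * Z) - Y * M * Z * (Y.map (ddt k) * Z) := by
  have e : Y.map (ddt k) * Z * (Y * M * Z) = Y.map (ddt k) * M * Z := by
    rw [Matrix.mul_assoc, ← Matrix.mul_assoc Z, ← Matrix.mul_assoc Z, hZY, Matrix.one_mul,
      Matrix.mul_assoc]
  rw [e, map_ddt_mul, map_ddt_mul, hM, Matrix.mul_zero, add_zero, map_ddt_inv hYZ hZY,
    Matrix.mul_neg, sub_eq_add_neg, Matrix.mul_assoc (Y * M)]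

/-- Let `A` be the logarithmic derivative of `Y`. On transforms of constants, differentiation is the
action of `A`: by commutator on matrices, by `-Aᵀ` on the `G`-vectors and by `A` on the `Ḡ`-vectors.
These terms cancel against the brackets with the shift `A` of `L`. The one delicate case is the
bracket of `G` with `Ḡ`, where the differentiated vectors produce an anticommutator with `A` that
must equal the shift of the resulting multiple of `L`. -/
theorem prodConst_gauge {i : k} (hi : i * i = -1) {Y Z : Matrix (Fin 2) (Fin 2) (Shat k)}
    (hYZ : Y * Z = 1) (hZY : Z * Y = 1) (ht : (Y.map (ddt k) * Z).trace = 0)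
    {x y : Gen → Shat k} (hx : ∀ u, ddt k (x u) = 0) (hy : ∀ u, ddt k (y u) = 0) :
    prodConst i (gaugeEnd i Y Z x) (gaugeEnd i Y Z y) = gaugeEnd i Y Z (prodConst i x y) := by
  have key : ∀ {x : Gen → Shat k}, (∀ u, ddt k (x u) = 0) →
      ∃ (r : Shat k) (M : Matrix (Fin 2) (Fin 2) (Shat k)) (v w : Fin 2 → Shat k),
        x = vec i r M v w ∧ M.trace = 0 ∧ ddt k r = 0 ∧ M.map (ddt k) = 0 ∧ ddt k ∘ v = 0 ∧
          ddt k ∘ w = 0 := fun {x} hx =>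
    ⟨x .L, toMat i x, _, _, (vec_coords hi x).symm, trace_toMat i x, hx _, map_ddt_toMat i hx,
      funext fun _ => hx _, funext fun _ => hx _⟩
  obtain ⟨r, M, v, w, rfl, hM, hr, hM', hv, hw⟩ := key hx
  obtain ⟨s, N, f, g, rfl, hN, hs, hN', hf, hg⟩ := key hy
  have htr : ∀ (r : Shat k) (M : Matrix (Fin 2) (Fin 2) (Shat k)), M.trace = 0 →
      (r • (Y.map (ddt k) * Z) + Y * M * Z).trace = 0 := by
    intro r M hM
    rw [Matrix.trace_add, Matrix.trace_smul, ht, smul_zero, zero_add, Matrix.trace_mul_comm,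
      ← Matrix.mul_assoc, hZY, Matrix.one_mul, hM]
  have hYd : Y.map (ddt k) = Y.map (ddt k) * Z * Y := by
    rw [Matrix.mul_assoc, hZY, Matrix.mul_one]
  have hw' : ∀ {w : Fin 2 → Shat k}, ddt k ∘ w = 0 →
      ddt k ∘ (Y *ᵥ w) = (Y.map (ddt k) * Z) *ᵥ (Y *ᵥ w) := by
    intro w hw
    rw [ddt_mulVec, hw, Matrix.mulVec_zero, add_zero, Matrix.mulVec_mulVec, ← hYd]
  have hv' : ∀ {v : Fin 2 → Shat k}, ddt k ∘ v = 0 →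
      ddt k ∘ (Zᵀ *ᵥ v) = -((Y.map (ddt k) * Z)ᵀ *ᵥ (Zᵀ *ᵥ v)) := by
    intro v hv
    rw [ddt_mulVec, hv, Matrix.mulVec_zero, add_zero, Matrix.mulVec_mulVec, ← Matrix.transpose_mul,
      Matrix.transpose_map, map_ddt_inv hYZ hZY, Matrix.transpose_neg, Matrix.neg_mulVec]
  have hd : ∀ {r : Shat k} {M : Matrix (Fin 2) (Fin 2) (Shat k)}, ddt k r = 0 →
      M.map (ddt k) = 0 → (r • (Y.map (ddt k) * Z) + Y * M * Z).map (ddt k)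
        = r • (Y.map (ddt k) * Z).map (ddt k)
          + (Y.map (ddt k) * Z * (Y * M * Z) - Y * M * Z * (Y.map (ddt k) * Z)) := by
    intro r M hr hM
    rw [← map_ddt_conj hYZ hZY hM]
    refine Matrix.ext fun a b => ?_
    simp only [Matrix.map_apply, Matrix.add_apply, Matrix.smul_apply, smul_eq_mul, map_add,
      ddt_mul r, hr, mul_zero, add_zero]
  have hdot : ∀ v w : Fin 2 → Shat k, (Zᵀ *ᵥ v) ⬝ᵥ (Y *ᵥ w) = v ⬝ᵥ w := by
    intro v w
    rw [Matrix.mulVec_transpose, Matrix.dotProduct_mulVec, Matrix.vecMul_vecMul, hZY,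
      Matrix.vecMul_one]
  have hdot' : ∀ v w : Fin 2 → Shat k, (Y *ᵥ w) ⬝ᵥ (Zᵀ *ᵥ v) = w ⬝ᵥ v := by
    intro v w
    rw [dotProduct_comm, hdot, dotProduct_comm]
  rw [gaugeEnd_vec hi hYZ, gaugeEnd_vec hi hYZ, prodConst_vec hi _ _ _ _ (htr r M hM) (htr s N hN),
    prodConst_vec hi _ _ _ _ hM hN, gaugeEnd_vec hi hYZ, hd hr hM', hd hs hN', hw' hw, hw' hg,
    hv' hv, hv' hf, hr, hs, hM', hN', hv, hw, hf, hg, hdot, hdot']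
  -- The left side is the anticommutator of the logarithmic derivative with the rank-one matrix
  -- built from the transformed vectors. Up to a scalar matrix it is the logarithmic derivative
  -- times `w ⬝ᵥ v`, and `2 (w ⬝ᵥ v)` is a contribution to the `L`-coefficient of the bracket.
  have ac : ∀ v w : Fin 2 → Shat k,
      Matrix.vecMulVec ((Y.map (ddt k) * Z) *ᵥ (Y *ᵥ w)) (Zᵀ *ᵥ v)
        - Matrix.vecMulVec (Y *ᵥ w) (-((Y.map (ddt k) * Z)ᵀ *ᵥ (Zᵀ *ᵥ v)))
      = (w ⬝ᵥ v) • (Y.map (ddt k) * Z)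
        + (Y.map (ddt k) * Z * Matrix.vecMulVec (Y *ᵥ w) (Zᵀ *ᵥ v)).trace • 1 := by
    intro v w
    rw [← hdot', ← Matrix.trace_vecMulVec, ← mul_add_mul_of_trace_eq_zero ht, Matrix.vecMulVec_neg,
      sub_neg_eq_add, Matrix.mul_vecMulVec, Matrix.vecMulVec_mul,
      Matrix.mulVec_transpose (Y.map (ddt k) * Z)]
  rw [ac, ac]
  generalize (Y.map (ddt k) * Z * Matrix.vecMulVec (Y *ᵥ w) (Zᵀ *ᵥ f)).trace = c₁
  generalize (Y.map (ddt k) * Z * Matrix.vecMulVec (Y *ᵥ g) (Zᵀ *ᵥ v)).trace = c₂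
  -- The scalar matrices left over from the two anticommutators are added to the right side, where
  -- they do not affect the coordinates.
  rw [← vec_add_scalar i _ (2 * c₁ + 2 * c₂) (_ + Y * _ * Z)]
  have hc : Y * (M * N - N * M) * Z = Y * M * Z * (Y * N * Z) - Y * N * Z * (Y * M * Z) := by
    have e : ∀ M N, Y * M * Z * (Y * N * Z) = Y * (M * N) * Z := by
      intro M N
      rw [Matrix.mul_assoc (Y * M), ← Matrix.mul_assoc Z, ← Matrix.mul_assoc Z, hZY,
        Matrix.one_mul]
      simp only [Matrix.mul_assoc]
    rw [e, e, Matrix.mul_sub, Matrix.sub_mul]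
  refine vec_congr i (by simp) ?_ ?_ ?_
  · simp only [Matrix.vecMulVec_zero, Matrix.zero_vecMulVec, sub_zero, smul_zero, add_zero,
      zero_add, mul_zero, zero_mul, hc]
    generalize Y.map (ddt k) * Z = A
    generalize Y * M * Z = P
    generalize Y * N * Z = Q
    rw [dotProduct_comm v g]
    simp only [Matrix.mul_add, Matrix.add_mul, Matrix.mul_smul, Matrix.smul_mul]
    module
  · have e : ∀ (M : Matrix (Fin 2) (Fin 2) (Shat k)) v, (Y * M * Z)ᵀ *ᵥ (Zᵀ *ᵥ v)
        = Zᵀ *ᵥ (Mᵀ *ᵥ v) := by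
      intro M v
      rw [Matrix.mulVec_mulVec, Matrix.mulVec_mulVec, ← Matrix.transpose_mul,
        ← Matrix.transpose_mul, ← Matrix.mul_assoc, ← Matrix.mul_assoc, hZY, Matrix.one_mul]
    simp only [zero_smul, smul_zero, sub_zero, zero_add, Matrix.mulVec_sub, Matrix.transpose_add,
      Matrix.transpose_smul, Matrix.add_mulVec, Matrix.smul_mulVec, e]
    module
  · have e : ∀ (M : Matrix (Fin 2) (Fin 2) (Shat k)) v, (Y * M * Z) *ᵥ (Y *ᵥ v)
        = Y *ᵥ (M *ᵥ v) := by
      intro M v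
      rw [Matrix.mulVec_mulVec, Matrix.mulVec_mulVec, Matrix.mul_assoc, hZY, Matrix.mul_one]
    simp only [zero_smul, smul_zero, sub_zero, zero_add, Matrix.mulVec_sub, Matrix.add_mulVec,
      Matrix.smul_mulVec, e]
    module

end

/-! ### The action of `SL₂(k)` -/

section

variable {k : Type*} [Field k] [CharZero k]

/-- The matrix of the standard symplectic form. -/
def eps (k : Type*) [Field k] : Matrix (Fin 2) (Fin 2) (Shat k) := !![0, 1; -1, 0]

theorem eps_mulVec_zero (v : Fin 2 → Shat k) : (eps k *ᵥ v) 0 = v 1 := by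
  simp [eps, Matrix.mulVec, dotProduct]

theorem eps_mulVec_one (v : Fin 2 → Shat k) : (eps k *ᵥ v) 1 = -v 0 := by
  simp [eps, Matrix.mulVec, dotProduct]

theorem fin_two_ext {α : Type*} {v w : Fin 2 → α} (h0 : v 0 = w 0) (h1 : v 1 = w 1) : v = w :=
  funext (Fin.forall_fin_two.2 ⟨h0, h1⟩)

theorem vec_congr_mod_scalar (i : k) {r r' : Shat k} {M M' : Matrix (Fin 2) (Fin 2) (Shat k)}
    {v w v' w' : Fin 2 → Shat k} (hr : r = r') (h01 : M 0 1 = M' 0 1) (h10 : M 1 0 = M' 1 0)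
    (hd : M 0 0 - M 1 1 = M' 0 0 - M' 1 1) (hv : v = v') (hw : w = w') :
    vec i r M v w = vec i r' M' v' w' := by
  rw [hr, hv, hw]
  ext1 u
  rcases u with _ | s | a | a
  · rfl
  · simp only [vec, trace_mul_pauli, h01, h10, hd]
  · rfl
  · rfl

/-- The action on combinations of generators of a matrix over `k`. -/
def rotEnd (i : k) (X : Matrix (Fin 2) (Fin 2) k) : Module.End (Shat k) (Gen → Shat k) where
  toFun x := vec i (x .L) (toMat i x)
    (X 0 0 • (fun a => x (.G a)) - X 0 1 • eps k *ᵥ (fun a => x (.Gbar a)))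
    (X 1 0 • (eps k *ᵥ fun a => x (.G a)) + X 1 1 • fun a => x (.Gbar a))
  map_add' x y := by
    rw [vec_add]
    refine vec_congr i rfl (toMat_add i x y) ?_ ?_ <;> apply fin_two_ext <;>
      simp only [eps_mulVec_zero, eps_mulVec_one, smul_eq_cst_mul, Pi.add_apply,
      Pi.sub_apply, Pi.smul_apply] <;> ring
  map_smul' c x := by
    rw [RingHom.id_apply, smul_vec]
    refine vec_congr i rfl (toMat_smul i c x) ?_ ?_ <;> apply fin_two_ext <;>
      simp only [eps_mulVec_zero, eps_mulVec_one, smul_eq_cst_mul, smul_eq_mul, Pi.add_apply,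
      Pi.sub_apply, Pi.smul_apply] <;> ring

theorem rotEnd_vec {i : k} (hi : i * i = -1) (X : Matrix (Fin 2) (Fin 2) k) (r : Shat k)
    (M : Matrix (Fin 2) (Fin 2) (Shat k)) (v w : Fin 2 → Shat k) :
    rotEnd i X (vec i r M v w)
      = vec i r M (X 0 0 • v - X 0 1 • eps k *ᵥ w) (X 1 0 • (eps k *ᵥ v) + X 1 1 • w) := by
  obtain ⟨c, hc⟩ := exists_toMat_vec hi r M v w
  have h : rotEnd i X (vec i r M v w) = vec i r (toMat i (vec i r M v w))
    (X 0 0 • v - X 0 1 • eps k *ᵥ w) (X 1 0 • (eps k *ᵥ v) + X 1 1 • w) := rfl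
  rw [h, hc, vec_add_scalar]

theorem rotEnd_one {i : k} (hi : i * i = -1) : rotEnd i 1 = 1 := by
  refine LinearMap.ext fun x => ?_
  rw [← vec_coords hi x, rotEnd_vec hi]
  simp

theorem rotEnd_mul {i : k} (hi : i * i = -1) (X X' : Matrix (Fin 2) (Fin 2) k) :
    rotEnd i (X * X') = rotEnd i X * rotEnd i X' := by
  refine LinearMap.ext fun x => ?_
  rw [Module.End.mul_apply, ← vec_coords hi x, rotEnd_vec hi, rotEnd_vec hi, rotEnd_vec hi]
  refine vec_congr i rfl rfl ?_ ?_ <;> apply fin_two_ext <;>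
      simp only [eps_mulVec_zero, eps_mulVec_one, smul_eq_cst_mul, Pi.add_apply,
      Pi.sub_apply, Pi.smul_apply,
      Matrix.mul_apply, Fin.sum_univ_two, map_add, map_mul] <;> ring

theorem cst_det {X : Matrix (Fin 2) (Fin 2) k} (hX : X.det = 1) :
    (cst (X 0 0) : Shat k) * cst (X 1 1) - cst (X 0 1) * cst (X 1 0) = 1 := by
  rw [← map_mul, ← map_mul, ← map_sub, ← Matrix.det_fin_two, hX, map_one]

/-- Modulo scalars, the rotation multiplies the matrix of the odd-odd bracket by `det X = 1`. The
terms pairing two `G`-vectors or two `Ḡ`-vectors are products of `ε` with a skew matrix, hence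
scalar, and are invisible. -/
theorem prodLam_rot {i : k} (hi : i * i = -1) {X : Matrix (Fin 2) (Fin 2) k} (hX : X.det = 1)
    (x y : Gen → Shat k) :
    prodLam i (rotEnd i X x) (rotEnd i X y) = rotEnd i X (prodLam i x y) := by
  have h := cst_det hX
  rw [← vec_coords hi x, ← vec_coords hi y, rotEnd_vec hi, rotEnd_vec hi, prodLam_vec,
    prodLam_vec, rotEnd_vec hi]
  generalize toMat i x = M, (fun a => x (.G a)) = v, (fun a => x (.Gbar a)) = w
  generalize toMat i y = N, (fun a => y (.G a)) = f, (fun a => y (.Gbar a)) = g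
  refine vec_congr_mod_scalar i rfl ?_ ?_ ?_ ?_ ?_
  · simp only [eps_mulVec_zero, eps_mulVec_one, smul_eq_cst_mul, smul_eq_mul, Pi.add_apply,
      Pi.sub_apply, Pi.smul_apply,
      Matrix.vecMulVec_apply, Matrix.add_apply, Matrix.sub_apply, Matrix.smul_apply]
    linear_combination 4 * (w 0 * f 1 - v 1 * g 0) * h
  · simp only [eps_mulVec_zero, eps_mulVec_one, smul_eq_cst_mul, smul_eq_mul, Pi.add_apply,
      Pi.sub_apply, Pi.smul_apply,
      Matrix.vecMulVec_apply, Matrix.add_apply, Matrix.sub_apply, Matrix.smul_apply]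
    linear_combination 4 * (w 1 * f 0 - v 0 * g 1) * h
  · simp only [eps_mulVec_zero, eps_mulVec_one, smul_eq_cst_mul, smul_eq_mul, Pi.add_apply,
      Pi.sub_apply, Pi.smul_apply,
      Matrix.vecMulVec_apply, Matrix.add_apply, Matrix.sub_apply, Matrix.smul_apply]
    linear_combination 4 * (w 0 * f 0 - v 0 * g 0
      - w 1 * f 1 + v 1 * g 1) * h
  · apply fin_two_ext <;>
      simp only [eps_mulVec_zero, eps_mulVec_one, smul_eq_cst_mul, smul_eq_mul, Pi.add_apply,
      Pi.sub_apply, Pi.smul_apply] <;> ring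
  · apply fin_two_ext <;>
      simp only [eps_mulVec_zero, eps_mulVec_one, smul_eq_cst_mul, smul_eq_mul, Pi.add_apply,
      Pi.smul_apply] <;> ring

theorem prodDel_rot {i : k} (hi : i * i = -1) {X : Matrix (Fin 2) (Fin 2) k} (hX : X.det = 1)
    (x y : Gen → Shat k) :
    prodDel i (rotEnd i X x) (rotEnd i X y) = rotEnd i X (prodDel i x y) := by
  have h := cst_det hX
  rw [← vec_coords hi x, ← vec_coords hi y, rotEnd_vec hi, rotEnd_vec hi, prodDel_vec,
    prodDel_vec, rotEnd_vec hi]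
  generalize toMat i x = M, (fun a => x (.G a)) = v, (fun a => x (.Gbar a)) = w
  generalize toMat i y = N, (fun a => y (.G a)) = f, (fun a => y (.Gbar a)) = g
  refine vec_congr_mod_scalar i rfl ?_ ?_ ?_ ?_ ?_
  · simp only [eps_mulVec_zero, eps_mulVec_one, smul_eq_cst_mul, smul_eq_mul, Pi.add_apply,
      Pi.sub_apply, Pi.smul_apply,
      Matrix.vecMulVec_apply, Matrix.add_apply, Matrix.sub_apply, Matrix.smul_apply]
    linear_combination 2 * (w 0 * f 1 - v 1 * g 0) * h
  · simp only [eps_mulVec_zero, eps_mulVec_one, smul_eq_cst_mul, smul_eq_mul, Pi.add_apply,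
      Pi.sub_apply, Pi.smul_apply,
      Matrix.vecMulVec_apply, Matrix.add_apply, Matrix.sub_apply, Matrix.smul_apply]
    linear_combination 2 * (w 1 * f 0 - v 0 * g 1) * h
  · simp only [eps_mulVec_zero, eps_mulVec_one, smul_eq_cst_mul, smul_eq_mul, Pi.add_apply,
      Pi.sub_apply, Pi.smul_apply,
      Matrix.vecMulVec_apply, Matrix.add_apply, Matrix.sub_apply, Matrix.smul_apply]
    linear_combination 2 * (w 0 * f 0 - v 0 * g 0
      - w 1 * f 1 + v 1 * g 1) * h
  · apply fin_two_ext <;>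
      simp only [eps_mulVec_zero, eps_mulVec_one, smul_eq_cst_mul, smul_eq_mul, Pi.add_apply,
      Pi.sub_apply, Pi.smul_apply] <;> ring
  · apply fin_two_ext <;>
      simp only [eps_mulVec_zero, eps_mulVec_one, smul_eq_cst_mul, smul_eq_mul, Pi.add_apply,
      Pi.smul_apply] <;> ring

/-- Because `X` has entries in `k`, rotated constants are constant and no derivative survives. The
`L`-coordinate is multiplied by `det X`; the odd coordinates agree because `ε M = -Mᵀ ε` for
traceless `M`. -/
theorem prodConst_rot {i : k} (hi : i * i = -1) {X : Matrix (Fin 2) (Fin 2) k} (hX : X.det = 1)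
    {x y : Gen → Shat k} (hx : ∀ u, ddt k (x u) = 0) (hy : ∀ u, ddt k (y u) = 0) :
    prodConst i (rotEnd i X x) (rotEnd i X y) = rotEnd i X (prodConst i x y) := by
  have h := cst_det hX
  have hM := trace_toMat i x
  have hN := trace_toMat i y
  have hd : ∀ {x : Gen → Shat k}, (∀ u, ddt k (x u) = 0) →
      ddt k ∘ (X 0 0 • (fun a => x (.G a)) - X 0 1 • eps k *ᵥ (fun a => x (.Gbar a))) = 0 ∧
      ddt k ∘ (X 1 0 • (eps k *ᵥ fun a => x (.G a)) + X 1 1 • fun a => x (.Gbar a)) = 0 ∧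
      (ddt k ∘ fun a => x (.G a)) = 0 ∧ (ddt k ∘ fun a => x (.Gbar a)) = 0 := by
    intro x hx
    refine ⟨?_, ?_, ?_, ?_⟩ <;> apply fin_two_ext <;>
      simp only [Function.comp_apply, eps_mulVec_zero, eps_mulVec_one, Pi.add_apply, Pi.sub_apply,
        Pi.smul_apply, Pi.zero_apply, map_add, map_sub, map_neg, Derivation.map_smul, hx,
        smul_zero, sub_zero, add_zero, neg_zero]
  rw [← vec_coords hi x, ← vec_coords hi y, rotEnd_vec hi, rotEnd_vec hi,
    prodConst_vec hi _ _ _ _ hM hN, prodConst_vec hi _ _ _ _ hM hN, rotEnd_vec hi,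
    map_ddt_toMat i hx, map_ddt_toMat i hy, (hd hx).1, (hd hx).2.1, (hd hx).2.2.1, (hd hx).2.2.2,
    (hd hy).1, (hd hy).2.1, (hd hy).2.2.1, (hd hy).2.2.2, hx, hy]
  rw [Matrix.trace_fin_two] at hM hN
  have hM1 := eq_neg_of_add_eq_zero_right hM
  have hN1 := eq_neg_of_add_eq_zero_right hN
  clear hd
  generalize toMat i x = M, (fun a => x (.G a)) = v, (fun a => x (.Gbar a)) = w at *
  generalize toMat i y = N, (fun a => y (.G a)) = f, (fun a => y (.Gbar a)) = g at *
  refine vec_congr i ?_ ?_ ?_ ?_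
  · simp only [eps_mulVec_zero, eps_mulVec_one, smul_eq_cst_mul, Pi.add_apply,
      Pi.sub_apply, Pi.smul_apply,
      dotProduct, Fin.sum_univ_two]
    linear_combination 2 * (v 0 * g 0 + v 1 * g 1
      + w 0 * f 0 + w 1 * f 1) * h
  · simp
  · apply fin_two_ext <;>
      simp only [smul_eq_cst_mul, smul_eq_mul, Pi.add_apply,
      Pi.sub_apply, Pi.smul_apply, Matrix.mulVec, dotProduct,
      Fin.sum_univ_two, hM1, hN1, Matrix.transpose_apply, eps, Matrix.of_apply,
      Matrix.cons_val_zero, Matrix.cons_val_one, Pi.zero_apply, Matrix.cons_val',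
      Matrix.cons_val_fin_one] <;> ring
  · apply fin_two_ext <;>
      simp only [smul_eq_cst_mul, smul_eq_mul, Pi.add_apply,
      Pi.sub_apply, Pi.smul_apply, Matrix.mulVec, dotProduct,
      Fin.sum_univ_two, hM1, hN1, Matrix.transpose_apply, eps, Matrix.of_apply,
      Matrix.cons_val_zero, Matrix.cons_val_one, Pi.zero_apply, Matrix.cons_val',
      Matrix.cons_val_fin_one] <;> ring

end

/-! ### The homomorphism to the automorphism group -/

section

variable {k : Type*} [Field k] [CharZero k]

theorem SL_mul_inv {R : Type*} [CommRing R] (Y : SL(2, R)) : Y.1 * (Y⁻¹).1 = 1 :=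
  congrArg Subtype.val (mul_inv_cancel Y)

theorem SL_inv_mul {R : Type*} [CommRing R] (Y : SL(2, R)) : (Y⁻¹).1 * Y.1 = 1 :=
  congrArg Subtype.val (inv_mul_cancel Y)

theorem SL_trace (Y : SL(2, Shat k)) : (Y.1.map (ddt k) * (Y⁻¹).1).trace = 0 :=
  trace_map_ddt_mul_adjugate Y.2

/-- The action of `SL₂(Ŝ)` on combinations of generators. -/
def gaugeHom {i : k} (hi : i * i = -1) :
    SL(2, Shat k) →* Module.End (Shat k) (Gen → Shat k) where
  toFun Y := gaugeEnd i Y.1 (Y⁻¹).1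
  map_one' := by
    rw [inv_one]
    exact gaugeEnd_one hi
  map_mul' Y Z := by
    rw [mul_inv_rev]
    exact gaugeEnd_mul hi (SL_mul_inv Y) (SL_mul_inv Z)

/-- The action of `SL₂(k)` on combinations of generators. -/
def rotHom {i : k} (hi : i * i = -1) : SL(2, k) →* Module.End (Shat k) (Gen → Shat k) where
  toFun X := rotEnd i X.1
  map_one' := rotEnd_one hi
  map_mul' X X' := rotEnd_mul hi X.1 X'.1

/-- The identity `(Y⁻¹)ᵀ ε = ε Y`, valid in determinant one, says that `ε` intertwines the two odd
representations of `SL₂(Ŝ)`. -/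
theorem gaugeEnd_commute_rotEnd {i : k} (hi : i * i = -1) (Y : SL(2, Shat k))
    (X : Matrix (Fin 2) (Fin 2) k) :
    Commute (gaugeEnd i Y.1 (Y⁻¹).1) (rotEnd i X) := by
  refine LinearMap.ext fun x => ?_
  have hY := SL_mul_inv Y
  have hinv : (Y⁻¹).1 = Y.1.adjugate := rfl
  rw [Module.End.mul_apply, Module.End.mul_apply, ← vec_coords hi x, rotEnd_vec hi,
    gaugeEnd_vec hi hY, gaugeEnd_vec hi hY, rotEnd_vec hi]
  rw [hinv, Matrix.adjugate_fin_two]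
  generalize Y.1 = Z
  refine vec_congr i rfl rfl ?_ ?_ <;> apply fin_two_ext <;>
    simp [Matrix.mulVec, dotProduct, eps, smul_eq_cst_mul] <;> ring

theorem coeffs_vec_parity (i : k) (p : ZMod 2) {r : Shat k}
    {M : Matrix (Fin 2) (Fin 2) (Shat k)} {v w : Fin 2 → Shat k}
    (he : p = 1 → r = 0 ∧ M = 0) (ho : p = 0 → v = 0 ∧ w = 0) (u : Gen) (hu : u.parity ≠ p) :
    vec i r M v w u = 0 := by
  rcases zmod_two_cases p with rfl | rfl <;>
    rcases u with _ | s | a | a <;> simp_all [Gen.parity, vec]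

theorem toMat_eq_zero (i : k) {x : Gen → Shat k} (hx : ∀ s, x (.J s) = 0) : toMat i x = 0 := by
  simp [toMat, hx]

theorem gauge_mem_Aut {i : k} (hi : i * i = -1) (Y : SL(2, Shat k)) :
    extendGroup i (gaugeHom hi) Y ∈ (n4Shat i).Aut := by
  refine extendGroup_mem_Aut i (gaugeHom hi) Y (fun p x hx => ?_)
    (fun x y _ _ => prodLam_gauge hi (SL_mul_inv Y) x y)
    (fun x y _ _ => prodDel_gauge hi (SL_mul_inv Y) x y)
    (fun x y hx hy => prodConst_gauge hi (SL_mul_inv Y) (SL_inv_mul Y) (SL_trace Y) hx hy)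
  refine coeffs_vec_parity i p ?_ ?_
  · rintro rfl
    have hL : x .L = 0 := hx .L (by decide)
    rw [toMat_eq_zero i fun s => hx (.J s) (by decide : (0 : ZMod 2) ≠ 1), hL]
    simp
  · rintro rfl
    have h1 : (fun a => x (.G a)) = 0 := funext fun a => hx (.G a) (by decide : (1 : ZMod 2) ≠ 0)
    have h2 : (fun a => x (.Gbar a)) = 0 :=
      funext fun a => hx (.Gbar a) (by decide : (1 : ZMod 2) ≠ 0)
    rw [h1, h2]
    simp

theorem rot_mem_Aut {i : k} (hi : i * i = -1) (X : SL(2, k)) :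
    extendGroup i (rotHom hi) X ∈ (n4Shat i).Aut := by
  refine extendGroup_mem_Aut i (rotHom hi) X (fun p x hx => ?_)
    (fun x y _ _ => prodLam_rot hi X.2 x y) (fun x y _ _ => prodDel_rot hi X.2 x y)
    (fun x y hx hy => prodConst_rot hi X.2 hx hy)
  refine coeffs_vec_parity i p ?_ ?_
  · rintro rfl
    exact ⟨hx .L (by decide), toMat_eq_zero i fun s => hx (.J s) (by decide : (0 : ZMod 2) ≠ 1)⟩
  · rintro rfl
    have h1 : (fun a => x (.G a)) = 0 := funext fun a => hx (.G a) (by decide : (1 : ZMod 2) ≠ 0)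
    have h2 : (fun a => x (.Gbar a)) = 0 :=
      funext fun a => hx (.Gbar a) (by decide : (1 : ZMod 2) ≠ 0)
    rw [h1, h2]
    simp

/-- The homomorphism `SL₂(Ŝ) × SL₂(k) → Aut(𝒜 ⊗ Ŝ)`. -/
def autHom {i : k} (hi : i * i = -1) : SL(2, Shat k) × SL(2, k) →* (n4Shat i).Aut :=
  MonoidHom.noncommCoprod
    ((extendGroup i (gaugeHom hi)).codRestrict _ (gauge_mem_Aut hi))
    ((extendGroup i (rotHom hi)).codRestrict _ (rot_mem_Aut hi)) fun Y X => by
      refine Subtype.ext (LinearEquiv.ext fun x => ?_)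
      have h := congrArg (extendHom i) (gaugeEnd_commute_rotEnd hi Y X.1).eq
      rw [map_mul, map_mul] at h
      exact LinearMap.congr_fun h x

theorem autHom_apply_iota {i : k} (hi : i * i = -1) (Y : SL(2, Shat k)) (X : SL(2, k)) (r : Shat k)
    (M : Matrix (Fin 2) (Fin 2) (Shat k)) (v w : Fin 2 → Shat k) :
    (autHom hi (Y, X)).1 (iota (vec i r M v w))
      = iota (vec i r (r • (Y.1.map (ddt k) * (Y⁻¹).1) + Y.1 * M * (Y⁻¹).1)
        ((Y⁻¹).1ᵀ *ᵥ (X.1 0 0 • v - X.1 0 1 • eps k *ᵥ w))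
        (Y.1 *ᵥ (X.1 1 0 • (eps k *ᵥ v) + X.1 1 1 • w))) := by
  change extend i (gaugeEnd i Y.1 (Y⁻¹).1) (extend i (rotEnd i X.1) (iota (vec i r M v w))) = _
  rw [extend_iota, extend_iota, rotEnd_vec hi, gaugeEnd_vec hi (SL_mul_inv Y)]

end

/-! ### Leading coefficients of products -/

section

variable {k : Type*} [Field k] [CharZero k]

theorem sum_support_eq_sum_antidiagonal {B : Type*} [AddCommMonoid B] (s t : Finset ℕ) (m : ℕ)
    (F : ℕ → ℕ → B) (hs : ∀ p q, p ∉ s → F p q = 0) (ht : ∀ p q, q ∉ t → F p q = 0) :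
    (∑ p ∈ s, ∑ q ∈ t, if p + q = m then F p q else 0)
      = ∑ z ∈ Finset.HasAntidiagonal.antidiagonal m, F z.1 z.2 := by
  rw [← Finset.sum_product', ← Finset.sum_filter]
  refine Finset.sum_subset (fun z hz => ?_) fun z hz hz' => ?_
  · exact Finset.HasAntidiagonal.mem_antidiagonal.2 (Finset.mem_filter.1 hz).2
  · have hz := Finset.HasAntidiagonal.mem_antidiagonal.1 hz
    by_cases h1 : z.1 ∈ s
    · by_cases h2 : z.2 ∈ t
      · exact absurd (Finset.mem_filter.2 ⟨Finset.mem_product.2 ⟨h1, h2⟩, hz⟩) hz'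
      · exact ht _ _ h2
    · exact hs _ _ h1

theorem prodConst_zero_left (i : k) (y : Gen → Shat k) : prodConst i 0 y = 0 := by
  funext w
  simp [prodConst]

theorem prodConst_zero_right (i : k) (x : Gen → Shat k) : prodConst i x 0 = 0 := by
  funext w
  simp [prodConst]

theorem prodLam_zero_left (i : k) (y : Gen → Shat k) : prodLam i 0 y = 0 := by
  funext w
  simp [prodLam]

theorem prodLam_zero_right (i : k) (x : Gen → Shat k) : prodLam i x 0 = 0 := by
  funext w
  simp [prodLam]

/-- Taking the coefficient of `D^0` kills total derivatives, so `(D^p a)_(N) (D^q b)` reduces to a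
multiple of the product of `a` and `b` of order `N - p - q`. Only the orders `0` and `1` contribute,
and in both cases the descending factorial is `N!`. -/
theorem coeffs_nProd_eq_sum (i : k) (N : ℕ) (x y : Shat k ⊗[k] N4 k) :
    coeffs i ((n4Shat i).nProd N x y) 0
      = ∑ p ∈ (coeffs i x).support, ∑ q ∈ (coeffs i y).support,
        ((if p + q = N then
          ((-1) ^ p * (N.factorial : k)) • prodConst i (coeffs i x p) (coeffs i y q) else 0)
        + (if p + q + 1 = N then
          ((-1) ^ p * (N.factorial : k)) • prodLam i (coeffs i x p) (coeffs i y q) else 0)) := by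
  let f : Shat k ⊗[k] N4 k →ₗ[k] Gen → Shat k := Finsupp.lapply 0 ∘ₗ (coeffs i).toLinearMap
  have hf : ∀ x, f ((n4Shat i).der x) = 0 := coeffs_der_zero i
  change f _ = _
  conv_lhs => rw [eq_sum_coeffs i x, eq_sum_coeffs i y]
  simp only [map_sum, LinearMap.sum_apply]
  rw [Finset.sum_comm]
  refine Finset.sum_congr rfl fun p _ => Finset.sum_congr rfl fun q _ => ?_
  rw [ConformalSuperalgebra.map_nProd_der_pow _ f hf]
  generalize coeffs i x p = a, coeffs i y q = b
  have hfi : ∀ w, f (iota w) = w := fun w => by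
    change coeffs i (iota w) 0 = w
    rw [coeffs_iota, Finsupp.single_eq_same]
  rcases lt_trichotomy (p + q) N with h | h | h
  · rw [if_neg h.ne, zero_add]
    by_cases h1 : p + q + 1 = N
    · rw [if_pos h1, ← h1, Nat.add_sub_cancel_left, nProd_iota_one, hfi]
      have hd := Nat.factorial_mul_descFactorial (Nat.le_succ (p + q))
      rw [Nat.succ_eq_add_one, Nat.add_sub_cancel_left, Nat.factorial_one, one_mul] at hd
      rw [hd]
    · rw [if_neg h1, nProd_iota_of_two_le i (by omega), map_zero, smul_zero]
  · rw [if_pos h, if_neg (by omega), add_zero, h, Nat.sub_self, Nat.descFactorial_self,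
      nProd_iota_zero, map_add, hf, zero_add, hfi]
  · rw [if_neg h.ne', if_neg (by omega), Nat.descFactorial_of_lt h]
    simp

theorem coeffs_nProd_zero (i : k) (x y : Shat k ⊗[k] N4 k) :
    coeffs i ((n4Shat i).nProd 0 x y) 0 = prodConst i (coeffs i x 0) (coeffs i y 0) := by
  rw [coeffs_nProd_eq_sum]
  simp only [Nat.add_eq_zero_iff, one_ne_zero, and_false, if_false, add_zero]
  simp only [← Nat.add_eq_zero_iff]
  rw [sum_support_eq_sum_antidiagonal _ _ _ (fun p q => ((-1) ^ p * ((0 : ℕ).factorial : k)) •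
    prodConst i (coeffs i x p) (coeffs i y q))]
  · simp
  · intro p q h
    rw [Finsupp.notMem_support_iff.1 h, prodConst_zero_left, smul_zero]
  · intro p q h
    rw [Finsupp.notMem_support_iff.1 h, prodConst_zero_right, smul_zero]

theorem coeffs_nProd_succ (i : k) (n : ℕ) (x y : Shat k ⊗[k] N4 k) :
    coeffs i ((n4Shat i).nProd (n + 1) x y) 0
      = (∑ z ∈ Finset.HasAntidiagonal.antidiagonal (n + 1), ((-1) ^ z.1 * ((n + 1).factorial : k)) •
          prodConst i (coeffs i x z.1) (coeffs i y z.2))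
        + ∑ z ∈ Finset.HasAntidiagonal.antidiagonal n, ((-1) ^ z.1 * ((n + 1).factorial : k)) •
          prodLam i (coeffs i x z.1) (coeffs i y z.2) := by
  rw [coeffs_nProd_eq_sum]
  simp only [Finset.sum_add_distrib, add_left_inj]
  congr 1
  · refine sum_support_eq_sum_antidiagonal _ _ _ (fun p q => ((-1) ^ p * ((n + 1).factorial : k)) •
      prodConst i (coeffs i x p) (coeffs i y q)) ?_ ?_
    · intro p q h
      rw [Finsupp.notMem_support_iff.1 h, prodConst_zero_left, smul_zero]
    · intro p q h
      rw [Finsupp.notMem_support_iff.1 h, prodConst_zero_right, smul_zero]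
  · refine sum_support_eq_sum_antidiagonal _ _ _ (fun p q => ((-1) ^ p * ((n + 1).factorial : k)) •
      prodLam i (coeffs i x p) (coeffs i y q)) ?_ ?_
    · intro p q h
      rw [Finsupp.notMem_support_iff.1 h, prodLam_zero_left, smul_zero]
    · intro p q h
      rw [Finsupp.notMem_support_iff.1 h, prodLam_zero_right, smul_zero]

theorem coeffs_iota_zero (i : k) (w : Gen → Shat k) : coeffs i (iota w) 0 = w := by
  rw [coeffs_iota, Finsupp.single_eq_same]

theorem coeffs_iota_succ (i : k) (w : Gen → Shat k) (n : ℕ) : coeffs i (iota w) (n + 1) = 0 := by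
  rw [coeffs_iota, Finsupp.single_eq_of_ne (Nat.succ_ne_zero n)]

theorem coeffs_nProd_succ_iota_right (i : k) (n : ℕ) (x : Shat k ⊗[k] N4 k) (w : Gen → Shat k) :
    coeffs i ((n4Shat i).nProd (n + 1) x (iota w)) 0
      = ((-1) ^ n * ((n + 1).factorial : k)) •
        (prodLam i (coeffs i x n) w - prodConst i (coeffs i x (n + 1)) w) := by
  rw [coeffs_nProd_succ, Finset.sum_eq_single (n + 1, 0), Finset.sum_eq_single (n, 0)]
  · simp only [coeffs_iota_zero, pow_succ]
    module
  · rintro ⟨p, q⟩ hz h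
    obtain ⟨q, rfl⟩ : ∃ l, q = l + 1 := ⟨q - 1, by
      rcases q with _ | q
      · exact absurd (by simpa using hz) h
      · rfl⟩
    rw [coeffs_iota_succ, prodLam_zero_right, smul_zero]
  · simp
  · rintro ⟨p, q⟩ hz h
    obtain ⟨q, rfl⟩ : ∃ l, q = l + 1 := ⟨q - 1, by
      rcases q with _ | q
      · exact absurd (by simpa using hz) h
      · rfl⟩
    rw [coeffs_iota_succ, prodConst_zero_right, smul_zero]
  · simp

theorem coeffs_nProd_succ_iota_left (i : k) (n : ℕ) (x : Shat k ⊗[k] N4 k) (w : Gen → Shat k) :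
    coeffs i ((n4Shat i).nProd (n + 1) (iota w) x) 0
      = ((n + 1).factorial : k) •
        (prodConst i w (coeffs i x (n + 1)) + prodLam i w (coeffs i x n)) := by
  rw [coeffs_nProd_succ, Finset.sum_eq_single (0, n + 1), Finset.sum_eq_single (0, n)]
  · simp only [coeffs_iota_zero, pow_zero, one_mul, smul_add]
  · rintro ⟨p, q⟩ hz h
    obtain ⟨p, rfl⟩ : ∃ l, p = l + 1 := ⟨p - 1, by
      rcases p with _ | p
      · exact absurd (by simpa using hz) h
      · rfl⟩
    rw [coeffs_iota_succ, prodLam_zero_left, smul_zero]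
  · simp
  · rintro ⟨p, q⟩ hz h
    obtain ⟨p, rfl⟩ : ∃ l, p = l + 1 := ⟨p - 1, by
      rcases p with _ | p
      · exact absurd (by simpa using hz) h
      · rfl⟩
    rw [coeffs_iota_succ, prodConst_zero_left, smul_zero]
  · simp

end

/-! ### The current subalgebra is stable under automorphisms -/

section

variable {k : Type*} [Field k] [CharZero k]

theorem vec_zero (i : k) : vec i 0 0 0 0 = 0 := by
  funext u
  rcases u with _ | s | a | a <;> simp [vec]

theorem prodLam_current (i : k) (M : Matrix (Fin 2) (Fin 2) (Shat k)) (r : Shat k)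
    (N : Matrix (Fin 2) (Fin 2) (Shat k)) (v w : Fin 2 → Shat k) :
    prodLam i (vec i 0 M 0 0) (vec i r N v w) = vec i 0 (r • M) 0 0 := by
  rw [prodLam_vec]
  simp

theorem prodDel_current (i : k) (M : Matrix (Fin 2) (Fin 2) (Shat k)) (r : Shat k)
    (N : Matrix (Fin 2) (Fin 2) (Shat k)) (v w : Fin 2 → Shat k) :
    prodDel i (vec i 0 M 0 0) (vec i r N v w) = 0 := by
  rw [prodDel_vec]
  simp [vec_zero]

theorem prodConst_current {i : k} (hi : i * i = -1) {M N : Matrix (Fin 2) (Fin 2) (Shat k)}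
    (hM : M.trace = 0) (hN : N.trace = 0) (v w : Fin 2 → Shat k) :
    prodConst i (vec i 0 M 0 0) (vec i 0 N v w)
      = vec i 0 (M * N - N * M) (-(Mᵀ *ᵥ v)) (M *ᵥ w) := by
  rw [prodConst_vec hi _ _ _ _ hM hN]
  have h0 : (ddt k ∘ (0 : Fin 2 → Shat k)) = 0 := by
    funext a
    simp
  simp [h0]

theorem nProd_succ_current (i : k) (n : ℕ) (M N : Matrix (Fin 2) (Fin 2) (Shat k))
    (v w : Fin 2 → Shat k) :
    (n4Shat i).nProd (n + 1) (iota (vec i 0 M 0 0)) (iota (vec i 0 N v w)) = 0 := by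
  rcases n with _ | n
  · rw [zero_add, nProd_iota_one, prodLam_current, zero_smul, vec_zero, map_zero]
  · exact nProd_iota_of_two_le i (by omega) _ _

theorem nProd_zero_current {i : k} (hi : i * i = -1) {M N : Matrix (Fin 2) (Fin 2) (Shat k)}
    (hM : M.trace = 0) (hN : N.trace = 0) (v w : Fin 2 → Shat k) :
    (n4Shat i).nProd 0 (iota (vec i 0 M 0 0)) (iota (vec i 0 N v w))
      = iota (vec i 0 (M * N - N * M) (-(Mᵀ *ᵥ v)) (M *ᵥ w)) := by
  rw [nProd_iota_zero, prodDel_current, prodConst_current hi hM hN, map_zero, map_zero, zero_add]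

/-- The differential submodule generated by `J^1, J^2, J^3`. -/
def currents (i : k) : Submodule k (Shat k ⊗[k] N4 k) where
  carrier := {x | ∀ n, coeffs i x n .L = 0 ∧ (∀ a, coeffs i x n (.G a) = 0) ∧
    ∀ a, coeffs i x n (.Gbar a) = 0}
  zero_mem' n := by simp
  add_mem' {x y} hx hy n := by
    refine ⟨?_, fun a => ?_, fun a => ?_⟩
    · rw [map_add, Finsupp.add_apply, Pi.add_apply, (hx n).1, (hy n).1, add_zero]
    · rw [map_add, Finsupp.add_apply, Pi.add_apply, (hx n).2.1, (hy n).2.1, add_zero]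
    · rw [map_add, Finsupp.add_apply, Pi.add_apply, (hx n).2.2, (hy n).2.2, add_zero]
  smul_mem' c x hx n := by
    refine ⟨?_, fun a => ?_, fun a => ?_⟩
    · rw [map_smul, Finsupp.smul_apply, Pi.smul_apply, (hx n).1, smul_zero]
    · rw [map_smul, Finsupp.smul_apply, Pi.smul_apply, (hx n).2.1, smul_zero]
    · rw [map_smul, Finsupp.smul_apply, Pi.smul_apply, (hx n).2.2, smul_zero]

theorem iota_mem_currents (i : k) (M : Matrix (Fin 2) (Fin 2) (Shat k)) :
    iota (vec i 0 M 0 0) ∈ currents i := by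
  intro n
  rcases n with _ | n
  · rw [coeffs_iota_zero]
    exact ⟨rfl, fun _ => rfl, fun _ => rfl⟩
  · rw [coeffs_iota_succ]
    exact ⟨rfl, fun _ => rfl, fun _ => rfl⟩

theorem coeffs_eq_vec {i : k} (hi : i * i = -1) {x : Shat k ⊗[k] N4 k} (hx : x ∈ currents i)
    (n : ℕ) : coeffs i x n = vec i 0 (toMat i (coeffs i x n)) 0 0 := by
  have h := vec_coords hi (coeffs i x n)
  rw [(hx n).1, funext (hx n).2.1, funext (hx n).2.2] at h
  exact h.symm

theorem map_der_pow {i : k} {σ : Shat k ⊗[k] N4 k ≃ₗ[Shat k] Shat k ⊗[k] N4 k}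
    (hσ : σ ∈ (n4Shat i).Aut) (n : ℕ) (x : Shat k ⊗[k] N4 k) :
    σ (((n4Shat i).der ^ n) x) = ((n4Shat i).der ^ n) (σ x) := by
  induction n with
  | zero => rfl
  | succ n ih => rw [pow_succ', Module.End.mul_apply, Module.End.mul_apply, hσ.2.2, ih]

/-- If `P` is the largest degree in which `L` occurs, with coefficient `f`, then the product of `x`
with itself of order `2P + 1` has `L`-coefficient `± (2P + 1)! · 2 f²` in degree zero. This cannot
vanish in the domain `Ŝ`. -/
theorem coeffs_apply_L_eq_zero {i : k} (hi : i * i = -1) {x : Shat k ⊗[k] N4 k}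
    (hx : x ∈ (n4Shat i).parity 0) (h : ∀ n, (n4Shat i).nProd (n + 1) x x = 0) (n : ℕ) :
    coeffs i x n .L = 0 := by
  classical
  by_contra hn
  have hne : ((coeffs i x).support.filter fun n => coeffs i x n .L ≠ 0).Nonempty :=
    ⟨n, Finset.mem_filter.2 ⟨Finsupp.mem_support_iff.2 fun h0 => hn (by rw [h0]; rfl), hn⟩⟩
  obtain ⟨P, hP, hmax⟩ := Finset.exists_max_image _ id hne
  have hbig : ∀ m, P < m → coeffs i x m .L = 0 := by
    intro m hm
    by_contra hc
    exact absurd (hmax m (Finset.mem_filter.2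
      ⟨Finsupp.mem_support_iff.2 fun h0 => hc (by rw [h0]; rfl), hc⟩)) (not_le.2 hm)
  have hPL := (Finset.mem_filter.1 hP).2
  have hG : ∀ m, (fun a => coeffs i x m (.G a)) = 0 := fun m =>
    funext fun a => (mem_parity_iff i 0 x).1 hx m (.G a) (by decide : (1 : ZMod 2) ≠ 0)
  have hGb : ∀ m, (fun a => coeffs i x m (.Gbar a)) = 0 := fun m =>
    funext fun a => (mem_parity_iff i 0 x).1 hx m (.Gbar a) (by decide : (1 : ZMod 2) ≠ 0)
  have hC : ∀ m l, prodConst i (coeffs i x m) (coeffs i x l) .L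
      = ddt k (coeffs i x m .L) * coeffs i x l .L - coeffs i x m .L * ddt k (coeffs i x l .L) := by
    intro m l
    conv_lhs => rw [← vec_coords hi (coeffs i x m), ← vec_coords hi (coeffs i x l),
      prodConst_vec hi _ _ _ _ (trace_toMat i _) (trace_toMat i _), hG, hG, hGb, hGb]
    simp [vec]
  have hL : ∀ m l, prodLam i (coeffs i x m) (coeffs i x l) .L
      = 2 * (coeffs i x m .L * coeffs i x l .L) := by
    intro m l
    conv_lhs => rw [← vec_coords hi (coeffs i x m), ← vec_coords hi (coeffs i x l), prodLam_vec]
    rfl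
  -- In the first sum the indices add up to `2P + 1`, so one of them exceeds `P` and the term
  -- vanishes; in the second sum they add up to `2P`, which leaves only `(P, P)`.
  have key := congrFun (coeffs_nProd_succ i (2 * P) x x) .L
  rw [h, Pi.add_apply, Finset.sum_apply, Finset.sum_apply, Finset.sum_eq_zero,
    Finset.sum_eq_single (P, P), zero_add] at key
  · rw [Pi.smul_apply, hL, (coeffs i).map_zero, Finsupp.zero_apply, Pi.zero_apply] at key
    have hc : ((-1) ^ P * ((2 * P + 1).factorial : k)) ≠ 0 :=
      mul_ne_zero (pow_ne_zero _ (neg_ne_zero.2 one_ne_zero))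
        (Nat.cast_ne_zero.2 (Nat.factorial_ne_zero _))
    have h2 := (smul_eq_zero.1 key.symm).resolve_left hc
    have h3 : coeffs i x P .L * coeffs i x P .L = 0 := by
      linear_combination (cst 2⁻¹ : Shat k) * h2
        - (coeffs i x P .L * coeffs i x P .L) * cst_inv_two_mul_two (k := k)
    exact hPL (mul_self_eq_zero.1 h3)
  · rintro ⟨p, q⟩ hz hne
    have hz := Finset.HasAntidiagonal.mem_antidiagonal.1 hz
    rw [Pi.smul_apply, hL]
    rcases lt_trichotomy p P with h | h | h
    · rw [hbig q (by simp only at hz; omega), mul_zero, mul_zero, smul_zero]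
    · exact absurd (Prod.ext h (by simp only at hz ⊢; omega)) hne
    · rw [hbig p h, zero_mul, mul_zero, smul_zero]
  · intro hn
    exact absurd (Finset.HasAntidiagonal.mem_antidiagonal.2 (two_mul P).symm) hn
  · rintro ⟨p, q⟩ hz
    have hz := Finset.HasAntidiagonal.mem_antidiagonal.1 hz
    rw [Pi.smul_apply, hC]
    rcases le_or_gt p P with h | h
    · rw [hbig q (by simp only at hz; omega), map_zero, mul_zero, mul_zero, sub_zero, smul_zero]
    · rw [hbig p h, map_zero, zero_mul, zero_mul, sub_zero, smul_zero]

variable {i : k} {σ : Shat k ⊗[k] N4 k ≃ₗ[Shat k] Shat k ⊗[k] N4 k}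

theorem currents_le_even {x : Shat k ⊗[k] N4 k} (hx : x ∈ currents i) :
    x ∈ (n4Shat i).parity 0 := by
  rw [mem_parity_iff]
  intro n u hu
  rcases u with _ | s | a | a
  · exact absurd rfl hu
  · exact absurd rfl hu
  · exact (hx n).2.1 a
  · exact (hx n).2.2 a

theorem map_iota_mem_currents (hi : i * i = -1) (hσ : σ ∈ (n4Shat i).Aut)
    (M : Matrix (Fin 2) (Fin 2) (Shat k)) : σ (iota (vec i 0 M 0 0)) ∈ currents i := by
  have he : σ (iota (vec i 0 M 0 0)) ∈ (n4Shat i).parity 0 :=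
    hσ.1 0 _ (currents_le_even (iota_mem_currents i M))
  intro n
  refine ⟨coeffs_apply_L_eq_zero hi he (fun n => ?_) n, fun a => ?_, fun a => ?_⟩
  · rw [← hσ.2.1, nProd_succ_current, map_zero]
  · exact (mem_parity_iff i 0 _).1 he n (.G a) (by decide : (1 : ZMod 2) ≠ 0)
  · exact (mem_parity_iff i 0 _).1 he n (.Gbar a) (by decide : (1 : ZMod 2) ≠ 0)

/-- Expand the preimage of `C` as `∑ D^n y_n`. Since `σ` commutes with `D`, only `y_0` contributes
to degree zero of its image, so `y_0` is the required matrix. -/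
theorem exists_coeffs_zero_eq (hi : i * i = -1) (hσ : σ ∈ (n4Shat i).Aut)
    (C : Matrix (Fin 2) (Fin 2) (Shat k)) :
    ∃ A : Matrix (Fin 2) (Fin 2) (Shat k), A.trace = 0 ∧
      coeffs i (σ (iota (vec i 0 A 0 0))) 0 = vec i 0 C 0 0 := by
  have hy := map_iota_mem_currents hi (inv_mem hσ) C
  set y := σ⁻¹ (iota (vec i 0 C 0 0)) with hyd
  have hσy : σ y = iota (vec i 0 C 0 0) := σ.apply_symm_apply _
  refine ⟨toMat i (coeffs i y 0), trace_toMat i _, ?_⟩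
  rw [← coeffs_eq_vec hi hy 0, ← coeffs_iota_zero i (vec i 0 C 0 0), ← hσy]
  conv_rhs => rw [eq_sum_coeffs i y, map_sum, map_sum, Finsupp.finsetSum_apply]
  have hz : ∀ n, n ≠ 0 →
      coeffs i (σ (((n4Shat i).der ^ n) (iota (coeffs i y n)))) 0 = 0 := by
    intro n hn
    obtain ⟨m, rfl⟩ := Nat.exists_eq_succ_of_ne_zero hn
    rw [map_der_pow hσ, pow_succ', Module.End.mul_apply, coeffs_der_zero]
  rw [Finset.sum_eq_single 0]
  · rfl
  · exact fun n _ hn => hz n hn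
  · intro h0
    rw [Finsupp.notMem_support_iff.1 h0]
    simp

/-- A total derivative on the left has zero product of order `0`, and this product commutes with `D`
on the right. The bracket of two currents also has no `D`-part, so the expansion of `x` is
transformed term by term. -/
theorem coeffs_nProd_zero_currents (hi : i * i = -1) {x y : Shat k ⊗[k] N4 k}
    (hx : x ∈ currents i) (hy : y ∈ currents i) (q : ℕ) :
    coeffs i ((n4Shat i).nProd 0 y x) q = prodConst i (coeffs i y 0) (coeffs i x q) := by
  have hd : ∀ p z, (n4Shat i).nProd 0 (((n4Shat i).der ^ (p + 1)) z) = 0 := by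
    intro p z
    refine LinearMap.ext fun w => ?_
    rw [pow_succ', Module.End.mul_apply, (n4Shat i).nProd_der_left]
    simp
  have hl : (n4Shat i).nProd 0 y = (n4Shat i).nProd 0 (iota (coeffs i y 0)) := by
    conv_lhs => rw [eq_sum_coeffs i y, map_sum]
    rw [Finset.sum_eq_single 0]
    · rfl
    · intro p _ hp
      obtain ⟨m, rfl⟩ := Nat.exists_eq_succ_of_ne_zero hp
      exact hd m _
    · intro h0
      rw [Finsupp.notMem_support_iff.1 h0]
      simp
  have hr : ∀ q w, (n4Shat i).nProd 0 (iota (coeffs i y 0)) (((n4Shat i).der ^ q) w)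
      = ((n4Shat i).der ^ q) ((n4Shat i).nProd 0 (iota (coeffs i y 0)) w) := by
    intro q w
    induction q with
    | zero => rfl
    | succ q ih =>
      rw [pow_succ', Module.End.mul_apply, Module.End.mul_apply, (n4Shat i).nProd_der_right, ih]
      simp
  have hf : (n4Shat i).nProd 0 y x = derSum i ((coeffs i x).mapRange
      (prodConst i (coeffs i y 0)) (prodConst_zero_right i _)) := by
    conv_lhs => rw [hl, eq_sum_coeffs i x, map_sum]
    rw [derSum, Finsupp.lsum_apply, Finsupp.sum_mapRange_index (fun _ => map_zero _)]
    refine Finset.sum_congr rfl fun q _ => ?_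
    rw [hr, nProd_iota_zero]
    conv_lhs => rw [coeffs_eq_vec hi hy 0, coeffs_eq_vec hi hx q, prodDel_current, map_zero,
      map_zero, zero_add, ← coeffs_eq_vec hi hy 0, ← coeffs_eq_vec hi hx q]
    rfl
  rw [hf, coeffs_derSum, Finsupp.mapRange_apply]

/-- The hypothesis says that `ad e` squares to zero on `sl₂`. Testing it on the two elementary
nilpotent matrices gives multiples of the squares of the off-diagonal entries and then of the
diagonal one. -/
theorem eq_zero_of_double_commutator {R : Type*} [CommRing R] [IsDomain R]
    (h4 : (2 : R) ≠ 0)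
    {e : Matrix (Fin 2) (Fin 2) R} (he : e.trace = 0)
    (h : ∀ c : Matrix (Fin 2) (Fin 2) R, c.trace = 0 →
      (c * e - e * c) * e - e * (c * e - e * c) = 0) : e = 0 := by
  rw [Matrix.trace_fin_two] at he
  have he1 := eq_neg_of_add_eq_zero_right he
  have h1 := h !![0, 1; 0, 0] (by simp [Matrix.trace_fin_two])
  have h2 := h !![0, 0; 1, 0] (by simp [Matrix.trace_fin_two])
  have hz : e 1 0 = 0 := by
    have := congrFun (congrFun h1 1) 0
    simp [Matrix.mul_apply, Matrix.vecMul, dotProduct, Fin.sum_univ_two, he1] at this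
    have h3 : 2 * (e 1 0 * e 1 0) = 0 := by linear_combination -this
    exact mul_self_eq_zero.1 ((mul_eq_zero.1 h3).resolve_left h4)
  have hy : e 0 1 = 0 := by
    have := congrFun (congrFun h2 0) 1
    simp [Matrix.mul_apply, Matrix.vecMul, dotProduct, Fin.sum_univ_two, he1] at this
    have h3 : 2 * (e 0 1 * e 0 1) = 0 := by linear_combination -this
    exact mul_self_eq_zero.1 ((mul_eq_zero.1 h3).resolve_left h4)
  have hx : e 0 0 = 0 := by
    have := congrFun (congrFun h1 0) 1
    simp [Matrix.mul_apply, Matrix.vecMul, dotProduct, Fin.sum_univ_two, he1] at this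
    have h3 : 2 * (2 * (e 0 0 * e 0 0)) = 0 := by linear_combination this - 2 * e 0 1 * hz
    exact mul_self_eq_zero.1 ((mul_eq_zero.1 ((mul_eq_zero.1 h3).resolve_left h4)).resolve_left h4)
  ext a b
  fin_cases a <;> fin_cases b <;> simp [hx, hy, hz, he1]

theorem two_ne_zero_Shat : (2 : Shat k) ≠ 0 := by
  intro h
  have := cst_inv_two_mul_two (k := k)
  rw [h, mul_zero] at this
  exact zero_ne_one this

/-- Suppose the image `x` of a current `N` has top degree `P > 0` in `D`. For a current `A` whose
image has degree-zero part `c`, the currents `[A, N]` and `N` have zero product of order `2P`.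
Applying `σ` and taking degree zero isolates `[[c, x_P], x_P] = 0`. As `c` is arbitrary in `sl₂`,
`x_P = 0`. -/
theorem exists_map_iota_current (hi : i * i = -1) (hσ : σ ∈ (n4Shat i).Aut)
    {N : Matrix (Fin 2) (Fin 2) (Shat k)} (hN : N.trace = 0) :
    ∃ N' : Matrix (Fin 2) (Fin 2) (Shat k), N'.trace = 0 ∧
      σ (iota (vec i 0 N 0 0)) = iota (vec i 0 N' 0 0) := by
  have hx := map_iota_mem_currents hi hσ N
  set x := σ (iota (vec i 0 N 0 0)) with hxd
  have hs : ∀ P ∈ (coeffs i x).support, P = 0 := by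
    by_contra! hc
    obtain ⟨P', hP', hP'0⟩ := hc
    obtain ⟨P, hP, hmax⟩ := Finset.exists_max_image (coeffs i x).support id ⟨P', hP'⟩
    have hbig : ∀ m, P < m → coeffs i x m = 0 := by
      intro m hm
      by_contra hc
      exact absurd (hmax m (Finsupp.mem_support_iff.2 hc)) (not_le.2 hm)
    have hP0 : 0 < P := lt_of_lt_of_le (Nat.pos_of_ne_zero hP'0) (hmax P' hP')
    have hMP := trace_toMat i (coeffs i x P)
    refine Finsupp.mem_support_iff.1 hP ?_
    rw [coeffs_eq_vec hi hx P, eq_zero_of_double_commutator two_ne_zero_Shat hMP, vec_zero]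
    intro c hc
    obtain ⟨A, hA, hAc⟩ := exists_coeffs_zero_eq hi hσ c
    have hy := map_iota_mem_currents hi hσ A
    have hx' := map_iota_mem_currents hi hσ (A * N - N * A)
    have hq : ∀ q, coeffs i (σ (iota (vec i 0 (A * N - N * A) 0 0))) q
        = prodConst i (vec i 0 c 0 0) (coeffs i x q) := by
      intro q
      rw [← hAc, ← coeffs_nProd_zero_currents hi hx hy, hxd, ← hσ.2.1, nProd_zero_current hi hA hN]
      simp
    -- Here `P > 0` is used: only products of positive order of currents vanish.
    obtain ⟨n, hn⟩ : ∃ n, 2 * P = n + 1 := ⟨2 * P - 1, by omega⟩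
    have key := coeffs_nProd_succ i n (σ (iota (vec i 0 (A * N - N * A) 0 0))) x
    rw [hxd, ← hσ.2.1, nProd_succ_current, ← hxd, σ.map_zero,
      (coeffs i).map_zero, Finsupp.zero_apply, ← hn,
      Finset.sum_eq_single (P, P), Finset.sum_eq_zero, add_zero] at key
    · have hcf : ((-1) ^ P * ((2 * P).factorial : k)) ≠ 0 :=
        mul_ne_zero (pow_ne_zero _ (neg_ne_zero.2 one_ne_zero))
          (Nat.cast_ne_zero.2 (Nat.factorial_ne_zero _))
      have h2 := (smul_eq_zero.1 key.symm).resolve_left hcf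
      have htr : ∀ A B : Matrix (Fin 2) (Fin 2) (Shat k), (A * B - B * A).trace = 0 := by
        intro A B
        rw [Matrix.trace_sub, Matrix.trace_mul_comm, sub_self]
      simp only [hq] at h2
      rw [coeffs_eq_vec hi hx P, prodConst_current hi hc hMP, Matrix.mulVec_zero,
        Matrix.mulVec_zero, neg_zero, prodConst_current hi (htr _ _) hMP, Matrix.mulVec_zero,
        Matrix.mulVec_zero, neg_zero, ← vec_zero i] at h2
      exact (eq_of_vec_eq hi (htr _ _) (Matrix.trace_zero _ _) h2).2.1
    · rintro ⟨p, q⟩ _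
      rw [coeffs_eq_vec hi hx' p, coeffs_eq_vec hi hx q, prodLam_current, zero_smul, vec_zero,
        smul_zero]
    · rintro ⟨p, q⟩ hz hne
      have hz := Finset.HasAntidiagonal.mem_antidiagonal.1 hz
      rcases lt_trichotomy p P with h | h | h
      · rw [hbig q (by simp only at hz; omega), prodConst_zero_right, smul_zero]
      · exact absurd (Prod.ext h (by simp only at hz ⊢; omega)) hne
      · rw [hq, hbig p h, prodConst_zero_right, prodConst_zero_left, smul_zero]
    · intro hn
      exact absurd (Finset.HasAntidiagonal.mem_antidiagonal.2 (two_mul P).symm) hn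
  refine ⟨toMat i (coeffs i x 0), trace_toMat i _, ?_⟩
  rw [← coeffs_eq_vec hi hx 0]
  conv_lhs => rw [eq_sum_coeffs i x]
  rw [Finset.sum_eq_single 0]
  · rfl
  · exact fun n hn h0 => absurd (hs n hn) h0
  · intro h0
    rw [Finsupp.notMem_support_iff.1 h0]
    simp

end

/-! ### Automorphisms preserve the span of the generators -/

section

variable {k : Type*} [Field k] [CharZero k]
  {i : k} {σ : Shat k ⊗[k] N4 k ≃ₗ[Shat k] Shat k ⊗[k] N4 k}

theorem exists_map_iota_eq_current (hi : i * i = -1) (hσ : σ ∈ (n4Shat i).Aut)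
    {C : Matrix (Fin 2) (Fin 2) (Shat k)} (hC : C.trace = 0) :
    ∃ A : Matrix (Fin 2) (Fin 2) (Shat k), A.trace = 0 ∧
      σ (iota (vec i 0 A 0 0)) = iota (vec i 0 C 0 0) := by
  obtain ⟨A, hA, h⟩ := exists_map_iota_current hi (inv_mem hσ) hC
  exact ⟨A, hA, by rw [← h]; exact σ.apply_symm_apply _⟩

theorem eq_iota_of_coeffs_succ (i : k) {x : Shat k ⊗[k] N4 k}
    (h : ∀ n, coeffs i x (n + 1) = 0) : x = iota (coeffs i x 0) := by
  refine (coeffs i).injective (Finsupp.ext fun n => ?_)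
  rcases n with _ | n
  · rw [coeffs_iota_zero]
  · rw [h, coeffs_iota_succ]

/-- Products of positive order of a current with an odd combination of generators vanish. Every
current is the image of a current, so all of `sl₂` annihilates each coefficient of positive degree
of the image, and these coefficients are zero. -/
theorem exists_map_iota_odd (hi : i * i = -1) (hσ : σ ∈ (n4Shat i).Aut) (v w : Fin 2 → Shat k) :
    ∃ v' w', σ (iota (vec i 0 0 v w)) = iota (vec i 0 0 v' w') := by
  have ho : σ (iota (vec i 0 0 v w)) ∈ (n4Shat i).parity 1 := by
    refine hσ.1 1 _ ((mem_parity_iff i 1 _).2 fun n u hu => ?_)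
    rcases n with _ | n
    · rw [coeffs_iota_zero]
      exact coeffs_vec_parity i 1 (fun _ => ⟨rfl, rfl⟩) (fun h => absurd h (by decide)) u hu
    · rw [coeffs_iota_succ]
      rfl
  set x := σ (iota (vec i 0 0 v w)) with hxd
  have hx : ∀ n, coeffs i x n = vec i 0 0 (fun a => coeffs i x n (.G a))
      fun a => coeffs i x n (.Gbar a) := by
    intro n
    have hL : coeffs i x n .L = 0 :=
      (mem_parity_iff i 1 _).1 ho n .L (by decide : (0 : ZMod 2) ≠ 1)
    have hJ : toMat i (coeffs i x n) = 0 := toMat_eq_zero i fun s =>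
      (mem_parity_iff i 1 _).1 ho n (.J s) (by decide : (0 : ZMod 2) ≠ 1)
    have h := vec_coords hi (coeffs i x n)
    rw [hL, hJ] at h
    exact h.symm
  have hz : ∀ n, coeffs i x (n + 1) = 0 := by
    intro n
    have key : ∀ C : Matrix (Fin 2) (Fin 2) (Shat k), C.trace = 0 →
        (Cᵀ *ᵥ fun a => coeffs i x (n + 1) (.G a)) = 0 ∧
        (C *ᵥ fun a => coeffs i x (n + 1) (.Gbar a)) = 0 := by
      intro C hC
      obtain ⟨A, hA, h⟩ := exists_map_iota_eq_current hi hσ hC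
      have h2 := coeffs_nProd_succ_iota_left i n x (vec i 0 C 0 0)
      rw [← h, hxd, ← hσ.2.1, nProd_succ_current, σ.map_zero, (coeffs i).map_zero,
        Finsupp.zero_apply, ← hxd] at h2
      have h3 := (smul_eq_zero.1 h2.symm).resolve_left
        (Nat.cast_ne_zero.2 (Nat.factorial_ne_zero _))
      rw [hx n, hx (n + 1), prodLam_current, zero_smul, vec_zero, add_zero,
        prodConst_current hi hC (Matrix.trace_zero _ _), Matrix.mul_zero, Matrix.zero_mul, sub_zero,
        ← vec_zero i] at h3
      have h4 := eq_of_vec_eq hi (Matrix.trace_zero _ _) (Matrix.trace_zero _ _) h3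
      exact ⟨neg_eq_zero.1 h4.2.2.1, h4.2.2.2⟩
    obtain ⟨h1, h2⟩ := key !![0, 1; 0, 0] (by simp [Matrix.trace_fin_two])
    obtain ⟨h3, h4⟩ := key !![0, 0; 1, 0] (by simp [Matrix.trace_fin_two])
    have e1 := congrFun h1 1
    have e2 := congrFun h2 0
    have e3 := congrFun h3 0
    have e4 := congrFun h4 1
    simp [Matrix.mulVec, dotProduct, Fin.sum_univ_two] at e1 e2 e3 e4
    rw [hx (n + 1), fin_two_ext (v := fun a => coeffs i x (n + 1) (.G a)) (w := 0) e1 e3,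
      fin_two_ext (v := fun a => coeffs i x (n + 1) (.Gbar a)) (w := 0) e4 e2, vec_zero]
  exact ⟨_, _, (eq_iota_of_coeffs_succ i hz).trans (congrArg iota (hx 0))⟩

/-- A commutator with a diagonal matrix has zero diagonal, which gives `r = 0`; then the traceless
`M` commutes with a basis of `sl₂`. -/
theorem eq_zero_of_smul_eq_commutator {R : Type*} [CommRing R] [IsDomain R] (h2 : (2 : R) ≠ 0)
    {r : R} {M : Matrix (Fin 2) (Fin 2) R} (hM : M.trace = 0)
    (h : ∀ C ∈ ({!![0, 1; 0, 0], !![0, 0; 1, 0], !![1, 0; 0, -1]} :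
      Set (Matrix (Fin 2) (Fin 2) R)), r • C = M * C - C * M) : r = 0 ∧ M = 0 := by
  rw [Matrix.trace_fin_two] at hM
  have hM1 := eq_neg_of_add_eq_zero_right hM
  have h3 := h !![1, 0; 0, -1] (by simp)
  have hr : r = 0 := by
    have := congrFun (congrFun h3 0) 0
    simpa [Matrix.mul_apply, Matrix.vecMul, dotProduct, Fin.sum_univ_two] using this
  have h01 : M 0 1 = 0 := by
    have := congrFun (congrFun h3 0) 1
    simp [Matrix.mul_apply, Matrix.vecMul, dotProduct, Fin.sum_univ_two] at this
    exact (mul_eq_zero.1 (by linear_combination this : 2 * M 0 1 = 0)).resolve_left h2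
  have h10 : M 1 0 = 0 := by
    have := congrFun (congrFun h3 1) 0
    simp [Matrix.mul_apply, Matrix.vecMul, dotProduct, Fin.sum_univ_two] at this
    exact (mul_eq_zero.1 (by linear_combination -this : 2 * M 1 0 = 0)).resolve_left h2
  have h00 : M 0 0 = 0 := by
    have := congrFun (congrFun (h !![0, 1; 0, 0] (by simp)) 0) 1
    simp [Matrix.mul_apply, Matrix.vecMul, dotProduct, Fin.sum_univ_two, hr, hM1] at this
    exact (mul_eq_zero.1 (by linear_combination -this : 2 * M 0 0 = 0)).resolve_left h2
  refine ⟨hr, ?_⟩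
  ext a b
  fin_cases a <;> fin_cases b <;> simp [h00, h01, h10, hM1]

theorem ddt_comp_zero : (ddt k ∘ (0 : Fin 2 → Shat k)) = 0 := by
  funext a
  simp

/-- Let the image of `L` have coefficients `(f_n, M_n)`. The products of positive order of `L` with
a current are the current itself in order one and zero beyond. Transported to constant currents `C`,
this reads `(f_n - δ_{n0}) C = [M_{n+1}, C]`, so that `f_n = δ_{n0}` and `M_{n+1} = 0`. -/
theorem exists_map_iota_L (hi : i * i = -1) (hσ : σ ∈ (n4Shat i).Aut) :
    ∃ M : Matrix (Fin 2) (Fin 2) (Shat k), M.trace = 0 ∧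
      σ (iota (vec i 1 0 0 0)) = iota (vec i 1 M 0 0) := by
  have he : σ (iota (vec i 1 0 0 0)) ∈ (n4Shat i).parity 0 := by
    refine hσ.1 0 _ ((mem_parity_iff i 0 _).2 fun n u hu => ?_)
    rcases n with _ | n
    · rw [coeffs_iota_zero]
      exact coeffs_vec_parity i 0 (fun h => absurd h (by decide)) (fun _ => ⟨rfl, rfl⟩) u hu
    · rw [coeffs_iota_succ]
      rfl
  set x := σ (iota (vec i 1 0 0 0)) with hxd
  have hx : ∀ n, coeffs i x n = vec i (coeffs i x n .L) (toMat i (coeffs i x n)) 0 0 := by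
    intro n
    have hG : (fun a => coeffs i x n (.G a)) = 0 := funext fun a =>
      (mem_parity_iff i 0 _).1 he n (.G a) (by decide : (1 : ZMod 2) ≠ 0)
    have hG' : (fun a => coeffs i x n (.Gbar a)) = 0 := funext fun a =>
      (mem_parity_iff i 0 _).1 he n (.Gbar a) (by decide : (1 : ZMod 2) ≠ 0)
    have h := vec_coords hi (coeffs i x n)
    rw [hG, hG'] at h
    exact h.symm
  have key : ∀ n, ∀ C : Matrix (Fin 2) (Fin 2) (Shat k), C.trace = 0 → C.map (ddt k) = 0 →
      (coeffs i x n .L - if n = 0 then 1 else 0) • C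
        = toMat i (coeffs i x (n + 1)) * C - C * toMat i (coeffs i x (n + 1)) := by
    intro n C hC hC'
    obtain ⟨A, hA, h⟩ := exists_map_iota_eq_current hi hσ hC
    have h1 : (n4Shat i).nProd (n + 1) x (iota (vec i 0 C 0 0))
        = iota (vec i 0 ((if n = 0 then (1 : Shat k) else 0) • C) 0 0) := by
      rw [← h, hxd, ← hσ.2.1]
      rcases n with _ | n
      · rw [zero_add, nProd_iota_one, prodLam_vec, if_pos rfl]
        simp [h]
      · rw [nProd_iota_of_two_le i (by omega), if_neg (Nat.succ_ne_zero n), zero_smul, vec_zero,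
          map_zero, map_zero]
    have h2 := coeffs_nProd_succ_iota_right i n x (vec i 0 C 0 0)
    rw [h1, coeffs_iota_zero] at h2
    have h3 : vec i 0 ((if n = 0 then (1 : Shat k) else 0) • C) 0 0
        = prodLam i (coeffs i x n) (vec i 0 C 0 0)
          - prodConst i (coeffs i x (n + 1)) (vec i 0 C 0 0) := by
      rcases n with _ | n
      · simpa using h2
      · rw [if_neg (Nat.succ_ne_zero n), zero_smul, vec_zero] at h2 ⊢
        exact ((smul_eq_zero.1 h2.symm).resolve_left
          (mul_ne_zero (pow_ne_zero _ (neg_ne_zero.2 one_ne_zero))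
            (Nat.cast_ne_zero.2 (Nat.factorial_ne_zero _)))).symm
    rw [eq_sub_iff_add_eq, hx n, hx (n + 1), prodLam_vec,
      prodConst_vec hi _ _ _ _ (trace_toMat i _) hC, vec_add] at h3
    have htr : ∀ A B : Matrix (Fin 2) (Fin 2) (Shat k), (A * B - B * A).trace = 0 := by
      intro A B
      rw [Matrix.trace_sub, Matrix.trace_mul_comm, sub_self]
    simp only [hC', ddt_comp_zero] at h3
    have h4 := (eq_of_vec_eq hi ?_ ?_ h3).2.1
    · simp at h4
      rw [sub_smul, ← h4]
      simp
    · rw [Matrix.trace_add, Matrix.trace_smul, hC]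
      simp [htr]
    · simp [hC]
  have hcst : ∀ n, coeffs i x n .L - (if n = 0 then 1 else 0) = 0 ∧
      toMat i (coeffs i x (n + 1)) = 0 := by
    intro n
    refine eq_zero_of_smul_eq_commutator two_ne_zero_Shat (trace_toMat i _) fun C hC => ?_
    refine key n C ?_ ?_
    · rcases hC with rfl | rfl | rfl <;> simp [Matrix.trace_fin_two]
    · have h1 : ddt k 1 = 0 := ddt_one
      rcases hC with rfl | rfl | rfl <;> ext a b <;> fin_cases a <;> fin_cases b <;>
        simp [h1]
  refine ⟨toMat i (coeffs i x 0), trace_toMat i _, ?_⟩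
  have h1 : coeffs i x 0 .L = 1 := by
    have := (hcst 0).1
    rw [if_pos rfl] at this
    exact sub_eq_zero.1 this
  rw [← h1, ← hx 0]
  refine eq_iota_of_coeffs_succ i fun n => ?_
  have h2 := (hcst (n + 1)).1
  rw [if_neg (Nat.succ_ne_zero n), sub_zero] at h2
  rw [hx, h2, (hcst n).2, vec_zero]

/-- `σ` acts on the generators through the maps and matrices `φ`, `M`, `A`, `B`, `C`, `E`. -/
structure ActsBy (i : k) (σ : Shat k ⊗[k] N4 k ≃ₗ[Shat k] Shat k ⊗[k] N4 k)
    (φ : Matrix (Fin 2) (Fin 2) (Shat k) → Matrix (Fin 2) (Fin 2) (Shat k))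
    (M A B C E : Matrix (Fin 2) (Fin 2) (Shat k)) : Prop where
  trace_φ : ∀ N, N.trace = 0 → (φ N).trace = 0
  map_J : ∀ N, N.trace = 0 → σ (iota (vec i 0 N 0 0)) = iota (vec i 0 (φ N) 0 0)
  trace_M : M.trace = 0
  map_L : σ (iota (vec i 1 0 0 0)) = iota (vec i 1 M 0 0)
  map_G : ∀ v w, σ (iota (vec i 0 0 v w))
    = iota (vec i 0 0 (A *ᵥ v + C *ᵥ w) (B *ᵥ v + E *ᵥ w))

theorem exists_actsBy (hi : i * i = -1) (hσ : σ ∈ (n4Shat i).Aut) :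
    ∃ φ M A B C E, ActsBy i σ φ M A B C E := by
  -- The trace condition sits inside the existential so that a total function `φ` can be chosen; its
  -- values off the traceless matrices carry no information.
  have hJ : ∀ N : Matrix (Fin 2) (Fin 2) (Shat k), ∃ N' : Matrix (Fin 2) (Fin 2) (Shat k),
      N.trace = 0 → N'.trace = 0 ∧ σ (iota (vec i 0 N 0 0)) = iota (vec i 0 N' 0 0) := by
    intro N
    by_cases hN : N.trace = 0
    · obtain ⟨N', h⟩ := exists_map_iota_current hi hσ hN
      exact ⟨N', fun _ => h⟩
    · exact ⟨0, fun h => absurd h hN⟩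
  choose φ hφ using hJ
  obtain ⟨M, hM, hL⟩ := exists_map_iota_L hi hσ
  choose A B hG using fun b : Fin 2 => exists_map_iota_odd hi hσ (Pi.single b 1) 0
  choose C E hG' using fun b : Fin 2 => exists_map_iota_odd hi hσ 0 (Pi.single b 1)
  refine ⟨φ, M, Matrix.of fun a b => A b a, Matrix.of fun a b => B b a,
    Matrix.of fun a b => C b a, Matrix.of fun a b => E b a, fun N hN => (hφ N hN).1,
    fun N hN => (hφ N hN).2, hM, hL, fun v w => ?_⟩
  have h : vec i 0 0 v w = v 0 • vec i 0 0 (Pi.single 0 1) 0 + v 1 • vec i 0 0 (Pi.single 1 1) 0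
      + (w 0 • vec i 0 0 0 (Pi.single 0 1) + w 1 • vec i 0 0 0 (Pi.single 1 1)) := by
    simp only [smul_vec, vec_add]
    refine vec_congr i (by simp) (by simp) ?_ ?_ <;> apply fin_two_ext <;> simp
  simp only [h, map_add, map_smul, hG, hG']
  rw [← map_smul, ← map_smul, ← map_smul, ← map_smul, ← map_add, ← map_add, ← map_add]
  simp only [smul_vec, vec_add]
  refine congrArg iota (vec_congr i (by simp) (by simp) ?_ ?_) <;> apply fin_two_ext <;>
    simp <;> ring

end

/-! ### Every automorphism is given by a pair of matrices -/

section

variable {k : Type*} [Field k] [CharZero k]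

theorem coeff_ddt (f : Shat k) (q : ℚ) : (ddt k f).coeff (q - 1) = (q : k) * f.coeff q := by
  induction f using AddMonoidAlgebra.induction_linear with
  | zero => simp
  | add f g hf hg =>
    rw [map_add, AddMonoidAlgebra.coeff_add, AddMonoidAlgebra.coeff_add, Finsupp.add_apply,
      Finsupp.add_apply, hf, hg, mul_add]
  | single p c =>
    change (ddtLinear k (AddMonoidAlgebra.single p c)).coeff (q - 1) = _
    rw [ddtLinear_single, AddMonoidAlgebra.coeff_single, AddMonoidAlgebra.coeff_single]
    by_cases h : p = q
    · rw [h, Finsupp.single_eq_same, Finsupp.single_eq_same]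
    · rw [Finsupp.single_eq_of_ne (fun h' => h (sub_left_injective h').symm),
        Finsupp.single_eq_of_ne (Ne.symm h), mul_zero]

/-- The coefficient of `t^(q-1)` in `f'` is `q` times that of `t^q` in `f`, and a nonzero rational
`q` is invertible in characteristic zero. -/
theorem exists_eq_cst_of_ddt_eq_zero {f : Shat k} (h : ddt k f = 0) : ∃ c, f = cst c := by
  refine ⟨f.coeff 0, ?_⟩
  apply AddMonoidAlgebra.coeff_injective
  ext q
  change f.coeff q = (AddMonoidAlgebra.single 0 (f.coeff 0)).coeff q
  rw [AddMonoidAlgebra.coeff_single]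
  by_cases hq : q = 0
  · rw [hq, Finsupp.single_eq_same]
  · rw [Finsupp.single_eq_of_ne hq]
    have := coeff_ddt f q
    rw [h, AddMonoidAlgebra.coeff_zero, Finsupp.zero_apply] at this
    exact (mul_eq_zero.1 this.symm).resolve_left (Rat.cast_ne_zero.2 hq)

theorem matrix_ext_mulVec {R : Type*} [CommRing R] {A B : Matrix (Fin 2) (Fin 2) R}
    (h : ∀ v, A *ᵥ v = B *ᵥ v) : A = B :=
  Matrix.mulVec_injective (funext h)

variable {i : k} {σ : Shat k ⊗[k] N4 k ≃ₗ[Shat k] Shat k ⊗[k] N4 k}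
  {φ : Matrix (Fin 2) (Fin 2) (Shat k) → Matrix (Fin 2) (Fin 2) (Shat k)}
  {M A B C E : Matrix (Fin 2) (Fin 2) (Shat k)}

/-- The result of applying `σ` to the action of currents on odd elements: the four blocks are
intertwiners between the natural representations and those twisted by `φ`. -/
theorem ActsBy.intertwine (h : ActsBy i σ φ M A B C E) (hi : i * i = -1)
    (hσ : σ ∈ (n4Shat i).Aut) {N : Matrix (Fin 2) (Fin 2) (Shat k)} (hN : N.trace = 0) :
    (φ N)ᵀ * A = A * Nᵀ ∧ φ N * B = -(B * Nᵀ) ∧ (φ N)ᵀ * C = -(C * N) ∧ φ N * E = E * N := by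
  have key : ∀ v w, A *ᵥ -(Nᵀ *ᵥ v) + C *ᵥ (N *ᵥ w) = -((φ N)ᵀ *ᵥ (A *ᵥ v + C *ᵥ w)) ∧
      B *ᵥ -(Nᵀ *ᵥ v) + E *ᵥ (N *ᵥ w) = φ N *ᵥ (B *ᵥ v + E *ᵥ w) := by
    intro v w
    have e := hσ.2.1 0 (iota (vec i 0 N 0 0)) (iota (vec i 0 0 v w))
    have h0 : (0 : Matrix (Fin 2) (Fin 2) (Shat k)).trace = 0 := Matrix.trace_zero _ _
    rw [nProd_zero_current hi hN h0, h.map_J N hN, h.map_G,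
      nProd_zero_current hi (h.trace_φ N hN) h0, Matrix.mul_zero, Matrix.zero_mul, sub_zero,
      Matrix.mul_zero, Matrix.zero_mul, sub_zero, h.map_G] at e
    exact (eq_of_vec_eq hi h0 h0 (iota_injective e)).2.2
  refine ⟨?_, ?_, ?_, ?_⟩ <;> refine matrix_ext_mulVec fun v => ?_
  · have := (key v 0).1
    simp only [Matrix.mulVec_zero, add_zero, Matrix.mulVec_neg, Matrix.mulVec_mulVec,
      neg_inj] at this
    exact this.symm
  · have := (key v 0).2
    simp only [Matrix.mulVec_zero, add_zero, Matrix.mulVec_neg, Matrix.mulVec_mulVec] at this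
    rw [Matrix.neg_mulVec]
    exact this.symm
  · have := (key 0 v).1
    simp only [Matrix.mulVec_zero, neg_zero, zero_add, Matrix.mulVec_mulVec] at this
    rw [Matrix.neg_mulVec, this, neg_neg]
  · have := (key 0 v).2
    simp only [Matrix.mulVec_zero, neg_zero, zero_add, Matrix.mulVec_mulVec] at this
    exact this.symm

theorem prodDel_L_odd (i : k) (M : Matrix (Fin 2) (Fin 2) (Shat k)) (v w : Fin 2 → Shat k) :
    prodDel i (vec i 1 M 0 0) (vec i 0 0 v w) = vec i 0 0 v w := by
  rw [prodDel_vec]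
  simp only [Matrix.zero_vecMulVec, Matrix.vecMulVec_zero, sub_self, smul_zero,
    one_smul, mul_zero, add_zero]

theorem prodConst_L_odd {i : k} (hi : i * i = -1) {M : Matrix (Fin 2) (Fin 2) (Shat k)}
    (hM : M.trace = 0) (v w : Fin 2 → Shat k) :
    prodConst i (vec i 1 M 0 0) (vec i 0 0 v w)
      = vec i 0 0 (-(ddt k ∘ v) - Mᵀ *ᵥ v) (-(ddt k ∘ w) + M *ᵥ w) := by
  have hm0 : (0 : Matrix (Fin 2) (Fin 2) (Shat k)).map (ddt k) = 0 := by
    ext a b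
    simp
  rw [prodConst_vec hi _ _ _ _ hM (Matrix.trace_zero _ _)]
  simp only [Matrix.zero_vecMulVec, Matrix.vecMulVec_zero, sub_self, smul_zero, zero_smul,
    one_smul, mul_zero, add_zero, ddt_comp_zero, ddt_one, hm0, map_zero, zero_mul,
    zero_dotProduct, Matrix.mulVec_zero, zero_sub]
  rw [sub_zero, sub_eq_add_neg]

/-- On constant odd elements the product of order `0` with `L` is just `D`. After applying `σ`, the
shift `M` of `L` must compensate the derivatives of the new coordinates. -/
theorem ActsBy.deriv_apply (h : ActsBy i σ φ M A B C E) (hi : i * i = -1)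
    (hσ : σ ∈ (n4Shat i).Aut) {v w : Fin 2 → Shat k} (hv : ddt k ∘ v = 0) (hw : ddt k ∘ w = 0) :
    ddt k ∘ (A *ᵥ v + C *ᵥ w) = -(Mᵀ *ᵥ (A *ᵥ v + C *ᵥ w)) ∧
      ddt k ∘ (B *ᵥ v + E *ᵥ w) = M *ᵥ (B *ᵥ v + E *ᵥ w) := by
  have h0 : (0 : Matrix (Fin 2) (Fin 2) (Shat k)).trace = 0 := Matrix.trace_zero _ _
  have e := hσ.2.1 0 (iota (vec i 1 0 0 0)) (iota (vec i 0 0 v w))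
  rw [h.map_L, h.map_G, nProd_iota_zero, nProd_iota_zero, prodDel_L_odd, prodDel_L_odd,
    prodConst_L_odd hi h0, prodConst_L_odd hi h.trace_M, map_add, hσ.2.2, h.map_G, add_right_inj,
    hv, hw, Matrix.transpose_zero, Matrix.zero_mulVec, Matrix.zero_mulVec, neg_zero, add_zero,
    sub_zero, vec_zero, map_zero, map_zero, ← map_zero iota, ← vec_zero i] at e
  have h2 := (eq_of_vec_eq hi h0 h0 (iota_injective e)).2.2
  refine ⟨?_, ?_⟩
  · rw [← sub_eq_zero.1 h2.1.symm, neg_neg]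
  · exact neg_add_eq_zero.1 h2.2.symm

theorem ddt_comp_single (b : Fin 2) : ddt k ∘ (Pi.single b 1 : Fin 2 → Shat k) = 0 := by
  funext a
  by_cases h : a = b
  · subst h
    simp
  · simp [Pi.single_eq_of_ne h]

theorem ActsBy.deriv (h : ActsBy i σ φ M A B C E) (hi : i * i = -1) (hσ : σ ∈ (n4Shat i).Aut) :
    A.map (ddt k) = -(Mᵀ * A) ∧ B.map (ddt k) = M * B ∧ C.map (ddt k) = -(Mᵀ * C) ∧
      E.map (ddt k) = M * E := by
  have key1 : ∀ b, _ := fun b => h.deriv_apply hi hσ (ddt_comp_single b) ddt_comp_zero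
  have key2 : ∀ b, _ := fun b => h.deriv_apply hi hσ ddt_comp_zero (ddt_comp_single b)
  simp only [Matrix.mulVec_zero, add_zero, zero_add] at key1 key2
  simp only [Matrix.mulVec_single_one] at key1 key2
  exact ⟨Matrix.ext fun a b => congrFun (key1 b).1 a, Matrix.ext fun a b => congrFun (key1 b).2 a,
    Matrix.ext fun a b => congrFun (key2 b).1 a, Matrix.ext fun a b => congrFun (key2 b).2 a⟩

/-- Comes from the `L`-coefficient in the product of order `0` of `G^1` and `Ḡ^1`, which is `2`, and
from the fact that `σ` fixes this coefficient. It provides the determinant of `X` later. -/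
theorem ActsBy.pairing (h : ActsBy i σ φ M A B C E) (hi : i * i = -1)
    (hσ : σ ∈ (n4Shat i).Aut) :
    A 0 0 * E 0 0 + A 1 0 * E 1 0 + (B 0 0 * C 0 0 + B 1 0 * C 1 0) = 1 := by
  have h0 : (0 : Matrix (Fin 2) (Fin 2) (Shat k)).trace = 0 := Matrix.trace_zero _ _
  have hm0 : (0 : Matrix (Fin 2) (Fin 2) (Shat k)).map (ddt k) = 0 := by
    ext a b
    simp
  have e := congrFun (DFunLike.congr_fun (congrArg (coeffs i)
    (hσ.2.1 0 (iota (vec i 0 0 (Pi.single 0 1) 0)) (iota (vec i 0 0 0 (Pi.single 0 1))))) 0) .L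
  rw [coeffs_nProd_zero, h.map_G, h.map_G, coeffs_iota_zero, coeffs_iota_zero,
    prodConst_vec hi _ _ _ _ h0 h0, nProd_iota_zero, map_add, hσ.2.2, map_add, Finsupp.add_apply,
    coeffs_der_zero, zero_add, prodConst_vec hi _ _ _ _ h0 h0] at e
  simp only [ddt_comp_single, ddt_comp_zero, hm0] at e
  have h1 : vec i 2 0 0 0 = (2 : Shat k) • vec i 1 0 0 0 := by
    rw [smul_vec]
    simp
  have hcol : (0 : Matrix (Fin 2) (Fin 2) (Shat k)).col 0 = 0 := rfl
  simp [h1, h.map_L, hcol] at e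
  rw [← map_smul iota, coeffs_iota_zero, smul_vec] at e
  simp [vec] at e
  refine mul_left_cancel₀ two_ne_zero_Shat ?_
  linear_combination -e

end

/-! ### Automorphisms whose first block is scalar -/

section

variable {k : Type*} [Field k] [CharZero k]
  {i : k} {σ : Shat k ⊗[k] N4 k ≃ₗ[Shat k] Shat k ⊗[k] N4 k}
  {φ : Matrix (Fin 2) (Fin 2) (Shat k) → Matrix (Fin 2) (Fin 2) (Shat k)}
  {M A B C E : Matrix (Fin 2) (Fin 2) (Shat k)}

theorem ActsBy.map_iota (h : ActsBy i σ φ M A B C E) (r : Shat k)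
    {N : Matrix (Fin 2) (Fin 2) (Shat k)} (hN : N.trace = 0) (v w : Fin 2 → Shat k) :
    σ (iota (vec i r N v w))
      = iota (vec i r (r • M + φ N) (A *ᵥ v + C *ᵥ w) (B *ᵥ v + E *ᵥ w)) := by
  have e : vec i r N v w = r • vec i 1 0 0 0 + vec i 0 N 0 0 + vec i 0 0 v w := by
    rw [smul_vec, vec_add, vec_add]
    refine vec_congr i ?_ ?_ ?_ ?_ <;> simp only [mul_one, smul_zero, add_zero, zero_add]
  rw [e, map_add, map_add, map_add, map_add, map_smul, map_smul, h.map_L, h.map_J N hN, h.map_G,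
    ← map_smul, ← map_add, ← map_add, smul_vec, vec_add, vec_add]
  refine congrArg iota (vec_congr i ?_ ?_ ?_ ?_) <;>
    simp only [mul_one, smul_zero, add_zero, zero_add]

theorem cst_smul {V : Type*} [AddCommGroup V] [Module k V] [Module (Shat k) V]
    [IsScalarTower k (Shat k) V] (c : k) (v : V) : (cst c : Shat k) • v = c • v :=
  algebraMap_smul (Shat k) c v

theorem trace_E12 {R : Type*} [CommRing R] :
    (!![0, 1; 0, 0] : Matrix (Fin 2) (Fin 2) R).trace = 0 := by
  simp [Matrix.trace_fin_two]

theorem trace_E21 {R : Type*} [CommRing R] :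
    (!![0, 0; 1, 0] : Matrix (Fin 2) (Fin 2) R).trace = 0 := by
  simp [Matrix.trace_fin_two]

/-- A form of Schur's lemma. If `det A = 0`, the intertwining relation multiplied by the adjugate
gives `A Nᵀ adj(A) = 0`; for the two elementary nilpotent `N`, the off-diagonal entries are up to
sign the squares of the four entries of `A`. -/
theorem ActsBy.det_ne_zero (h : ActsBy i σ φ M A B C E) (hi : i * i = -1)
    (hσ : σ ∈ (n4Shat i).Aut) (hA : A ≠ 0) : A.det ≠ 0 := by
  intro hd
  have key : ∀ N : Matrix (Fin 2) (Fin 2) (Shat k), N.trace = 0 → A * Nᵀ * A.adjugate = 0 := by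
    intro N hN
    rw [← (h.intertwine hi hσ hN).1, Matrix.mul_assoc, Matrix.mul_adjugate, hd, zero_smul,
      Matrix.mul_zero]
  have h1 := key _ trace_E12
  have h2 := key _ trace_E21
  rw [Matrix.adjugate_fin_two, Matrix.eta_fin_two A, Matrix.eta_fin_two (Matrix.transpose _),
    Matrix.mul_fin_two, Matrix.mul_fin_two] at h1 h2
  have e1 := congrFun (congrFun h1 0) 1
  have e2 := congrFun (congrFun h1 1) 0
  have e3 := congrFun (congrFun h2 0) 1
  have e4 := congrFun (congrFun h2 1) 0
  simp at e1 e2 e3 e4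
  apply hA
  refine Matrix.ext fun a b => ?_
  fin_cases a <;> fin_cases b <;> simp [e1, e2, e3, e4]

/-- Liouville's formula for `A' = -Mᵀ A`, with `M` traceless. -/
theorem ActsBy.ddt_det (h : ActsBy i σ φ M A B C E) (hi : i * i = -1)
    (hσ : σ ∈ (n4Shat i).Aut) : ddt k A.det = 0 := by
  have hM := h.trace_M
  rw [Matrix.trace_fin_two] at hM
  have hd : ∀ a b, ddt k (A a b) = -(M 0 a * A 0 b + M 1 a * A 1 b) := by
    intro a b
    have := congrFun (congrFun (h.deriv hi hσ).1 a) b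
    rw [Matrix.neg_apply, Matrix.mul_apply, Fin.sum_univ_two] at this
    exact this
  rw [Matrix.det_fin_two, map_sub, ddt_mul, ddt_mul, hd, hd, hd, hd]
  linear_combination -(A 0 0 * A 1 1 - A 0 1 * A 1 0) * hM

theorem eq_of_map_iota (hi : i * i = -1)
    {τ : Shat k ⊗[k] N4 k ≃ₗ[Shat k] Shat k ⊗[k] N4 k}
    (hσ : σ ∈ (n4Shat i).Aut) (hτ : τ ∈ (n4Shat i).Aut)
    (h : ∀ (r : Shat k) (N : Matrix (Fin 2) (Fin 2) (Shat k)) (v w : Fin 2 → Shat k),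
      N.trace = 0 → σ (iota (vec i r N v w)) = τ (iota (vec i r N v w))) : σ = τ := by
  have := hom_ext_gen i (f := σ.toLinearMap) (g := τ.toLinearMap) hσ.2.2 hτ.2.2 fun u => by
    rw [← iota_single, ← vec_coords hi (Pi.single u 1)]
    exact h _ _ _ _ (trace_toMat i _)
  exact LinearEquiv.ext fun x => LinearMap.congr_fun this x

/-- A constant scalar first block forces `φ` to be the identity and `M = 0`. The other blocks are
then constant intertwiners of untwisted representations, so `B` and `C` are multiples of `ε` and `E`
is scalar. The pairing relation says that the four constants form a matrix of determinant one. -/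
theorem exists_rot_eq (hi : i * i = -1) (hσ : σ ∈ (n4Shat i).Aut)
    {c : k} (hc : c ≠ 0) (h : ActsBy i σ φ M ((cst c : Shat k) • 1) B C E) :
    ∃ X : SL(2, k), (autHom hi (1, X)).1 = σ := by
  have hc' : (cst c : Shat k) ≠ 0 := (map_ne_zero_iff _ cst_injective).2 hc
  have hφ : ∀ N : Matrix (Fin 2) (Fin 2) (Shat k), N.trace = 0 → φ N = N := by
    intro N hN
    have := (h.intertwine hi hσ hN).1
    rw [Matrix.mul_smul, Matrix.smul_mul, Matrix.mul_one, Matrix.one_mul] at this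
    exact Matrix.transpose_injective (smul_right_injective _ hc' this)
  obtain ⟨dA, dB, dC, dE⟩ := h.deriv hi hσ
  have hM : M = 0 := by
    have h0 : ((cst c : Shat k) • (1 : Matrix (Fin 2) (Fin 2) (Shat k))).map (ddt k) = 0 := by
      refine Matrix.ext fun a b => ?_
      by_cases hab : a = b
      · subst hab
        simp [ddt_cst]
      · simp [Matrix.one_apply_ne hab]
    rw [h0, Matrix.mul_smul, Matrix.mul_one, eq_comm, neg_eq_zero] at dA
    exact Matrix.transpose_eq_zero.1 ((smul_eq_zero.1 dA).resolve_left hc')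
  rw [hM, Matrix.zero_mul] at dB dE
  rw [hM, Matrix.transpose_zero, Matrix.zero_mul, neg_zero] at dC
  obtain ⟨-, hB1, hC1, hE1⟩ := h.intertwine hi hσ trace_E12
  obtain ⟨-, hB2, hC2, hE2⟩ := h.intertwine hi hσ trace_E21
  rw [hφ _ trace_E12] at hB1 hC1 hE1
  rw [hφ _ trace_E21] at hB2 hC2 hE2
  -- The entries chosen are those at which `ε`, respectively the identity matrix, equals `1`.
  obtain ⟨d, hd⟩ := exists_eq_cst_of_ddt_eq_zero (congrFun (congrFun dB 0) 1)
  obtain ⟨e, he⟩ := exists_eq_cst_of_ddt_eq_zero (congrFun (congrFun dC 0) 1)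
  obtain ⟨f, hf⟩ := exists_eq_cst_of_ddt_eq_zero (congrFun (congrFun dE 0) 0)
  have entry : ∀ {P Q : Matrix (Fin 2) (Fin 2) (Shat k)}, P = Q → ∀ a b, P a b = Q a b :=
    fun h a b => by rw [h]
  have hB : B = (cst d : Shat k) • eps k := by
    have e1 := entry hB1 0 0
    have e2 := entry hB1 0 1
    have e3 := entry hB2 1 0
    simp [Matrix.mul_apply,
      Fin.sum_univ_two] at e1 e2 e3
    refine Matrix.ext fun a b => ?_
    fin_cases a <;> fin_cases b <;> simp [eps, hd, e1, e2, e3]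
  have hC : C = (cst e : Shat k) • eps k := by
    have e1 := entry hC1 1 0
    have e2 := entry hC1 1 1
    have e3 := entry hC2 0 1
    simp [Matrix.mul_apply,
      Fin.sum_univ_two] at e1 e2 e3
    have e4 : C 1 0 = -cst e := by linear_combination - he + e2
    refine Matrix.ext fun a b => ?_
    fin_cases a <;> fin_cases b <;> simp [eps, he, e1, e4, e3]
  have hE : E = (cst f : Shat k) • 1 := by
    have e1 := entry hE1 0 0
    have e2 := entry hE1 0 1
    have e3 := entry hE2 1 1
    simp [Matrix.mul_apply,
      Fin.sum_univ_two] at e1 e2 e3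
    refine Matrix.ext fun a b => ?_
    fin_cases a <;> fin_cases b <;> simp [hf, e1, e2, e3]
  have hdet : c * f + d * e = 1 := by
    have := h.pairing hi hσ
    rw [hB, hC, hE] at this
    simp [eps] at this
    apply cst_injective
    rw [map_add, map_mul, map_mul, map_one, ← this]
  let X : SL(2, k) := ⟨!![c, -e; d, f], by
    rw [Matrix.det_fin_two_of]
    linear_combination hdet⟩
  refine ⟨X, eq_of_map_iota hi (autHom hi (1, X)).2 hσ fun r N v w hN => ?_⟩
  have hX00 : X.1 0 0 = c := rfl
  have hX01 : X.1 0 1 = -e := rfl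
  have hX10 : X.1 1 0 = d := rfl
  have hX11 : X.1 1 1 = f := rfl
  have h1 : (1 : SL(2, Shat k)).1 = 1 := rfl
  rw [autHom_apply_iota, h.map_iota r hN, hφ N hN, hM, hB, hC, hE, hX00, hX01, hX10, hX11,
    inv_one, h1, map_ddt_one]
  refine congrArg iota (vec_congr i rfl ?_ ?_ ?_)
  · simp
  · simp only [Matrix.transpose_one, Matrix.one_mulVec, Matrix.smul_mulVec]
    rw [neg_smul, sub_neg_eq_add, cst_smul, cst_smul]
  · simp only [Matrix.one_mulVec, Matrix.smul_mulVec, cst_smul]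

end

/-! ### Surjectivity -/

section

variable {k : Type*} [Field k] [CharZero k]
  {i : k} {σ : Shat k ⊗[k] N4 k ≃ₗ[Shat k] Shat k ⊗[k] N4 k}
  {φ φ' : Matrix (Fin 2) (Fin 2) (Shat k) → Matrix (Fin 2) (Fin 2) (Shat k)}
  {M A B C E M' A' B' C' E' : Matrix (Fin 2) (Fin 2) (Shat k)}

theorem ActsBy.eq_of_autHom_mul (hi : i * i = -1) (h : ActsBy i σ φ M A B C E) (Y : SL(2, Shat k))
    (X : SL(2, k)) (h' : ActsBy i ((autHom hi (Y, X)).1 * σ) φ' M' A' B' C' E') :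
    A' = (Y⁻¹).1ᵀ * (X.1 0 0 • A - X.1 0 1 • (eps k * B)) := by
  refine matrix_ext_mulVec fun v => ?_
  have e := h'.map_G v 0
  rw [LinearEquiv.mul_apply, h.map_G, autHom_apply_iota] at e
  simp only [Matrix.mulVec_zero, add_zero, zero_smul, Matrix.mul_zero,
    Matrix.zero_mul] at e
  have h0 : (0 : Matrix (Fin 2) (Fin 2) (Shat k)).trace = 0 := Matrix.trace_zero _ _
  rw [← (eq_of_vec_eq hi h0 h0 (iota_injective e)).2.2.1, ← Matrix.mulVec_mulVec,
    Matrix.sub_mulVec, Matrix.smul_mulVec, Matrix.smul_mulVec, Matrix.mulVec_mulVec]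

/-- The determinant of `A` is a nonzero constant `c²`, so `A` is `c` times the transpose of some `Z`
in `SL₂(Ŝ)`. Composing `σ` with the automorphism of `Z` turns the first block into the scalar `c`,
and `exists_rot_eq` applies. -/
theorem exists_autHom_eq_of_ne_zero [IsAlgClosed k] (hi : i * i = -1) (hσ : σ ∈ (n4Shat i).Aut)
    (h : ActsBy i σ φ M A B C E) (hA : A ≠ 0) : ∃ z, autHom hi z = ⟨σ, hσ⟩ := by
  obtain ⟨d, hd⟩ := exists_eq_cst_of_ddt_eq_zero (h.ddt_det hi hσ)
  have hd0 := h.det_ne_zero hi hσ hA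
  -- Algebraic closedness is used for this square root, by which `A` is rescaled to determinant one.
  obtain ⟨c, hc⟩ := IsAlgClosed.exists_eq_mul_self d
  have hc0 : c ≠ 0 := by
    rintro rfl
    rw [hd, hc, mul_zero, map_zero] at hd0
    exact hd0 rfl
  let Z : SL(2, Shat k) := ⟨((cst c⁻¹ : Shat k) • A)ᵀ, by
    rw [Matrix.det_transpose, Matrix.det_smul, hd, hc, ← map_pow, ← map_mul, Fintype.card_fin]
    rw [show c⁻¹ ^ 2 * (c * c) = 1 by field_simp, map_one]⟩
  have hZ : A = (cst c : Shat k) • (Z.1)ᵀ := by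
    change A = (cst c : Shat k) • (((cst c⁻¹ : Shat k) • A)ᵀ)ᵀ
    rw [Matrix.transpose_transpose, smul_smul, ← map_mul, mul_inv_cancel₀ hc0, map_one, one_smul]
  have hτ : (autHom hi (Z, 1)).1 * σ ∈ (n4Shat i).Aut := mul_mem (autHom hi (Z, 1)).2 hσ
  obtain ⟨φ', M', A', B', C', E', h'⟩ := exists_actsBy hi hτ
  have hA' : A' = (cst c : Shat k) • 1 := by
    rw [h.eq_of_autHom_mul hi Z 1 h', hZ]
    have h00 : (1 : SL(2, k)).1 0 0 = 1 := rfl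
    have h01 : (1 : SL(2, k)).1 0 1 = 0 := rfl
    rw [h00, h01, one_smul, zero_smul, sub_zero, Matrix.mul_smul, ← Matrix.transpose_mul,
      SL_mul_inv, Matrix.transpose_one]
  rw [hA'] at h'
  obtain ⟨X, hX⟩ := exists_rot_eq hi hτ hc0 h'
  refine ⟨(Z, 1)⁻¹ * (1, X), ?_⟩
  rw [map_mul, map_inv, inv_mul_eq_iff_eq_mul]
  exact Subtype.ext hX

theorem autHom_surjective [IsAlgClosed k] (hi : i * i = -1) :
    Function.Surjective (autHom hi) := by
  rintro ⟨σ, hσ⟩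
  obtain ⟨φ, M, A, B, C, E, h⟩ := exists_actsBy hi hσ
  by_cases hA : A = 0
  -- This rotation interchanges the two odd families, so the new first block is `ε B`. It is
  -- nonzero, since otherwise `A = B = 0` and `σ` would kill `G^1`.
  · let X : SL(2, k) := ⟨!![0, -1; 1, 0], by simp⟩
    have hτ : (autHom hi (1, X)).1 * σ ∈ (n4Shat i).Aut := mul_mem (autHom hi (1, X)).2 hσ
    obtain ⟨φ', M', A', B', C', E', h'⟩ := exists_actsBy hi hτ
    have hA' : A' ≠ 0 := by
      have e := h.eq_of_autHom_mul hi 1 X h'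
      have h00 : X.1 0 0 = 0 := rfl
      have h01 : X.1 0 1 = -1 := rfl
      have h1 : (1 : SL(2, Shat k)).1 = 1 := rfl
      rw [inv_one, h1, h00, h01, zero_smul, neg_smul, one_smul, sub_neg_eq_add, zero_add,
        Matrix.transpose_one, Matrix.one_mul] at e
      intro h0
      rw [h0] at e
      have hB : B = 0 := by
        have h2 : eps k * eps k = -1 := by
          refine Matrix.ext fun a b => ?_
          fin_cases a <;> fin_cases b <;> simp [eps]
        have h3 := congrArg (eps k * ·) e
        simp only [Matrix.mul_zero, ← Matrix.mul_assoc, h2, Matrix.neg_mul, Matrix.one_mul] at h3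
        exact neg_eq_zero.1 h3.symm
      have e0 := h.map_G (Pi.single 0 1) 0
      rw [hA, hB, Matrix.zero_mulVec, Matrix.mulVec_zero, Matrix.mulVec_zero,
        add_zero, vec_zero, map_zero, LinearEquiv.map_eq_zero_iff, ← map_zero iota] at e0
      have := congrFun (iota_injective e0) (.G 0)
      simp [vec] at this
    obtain ⟨z, hz⟩ := exists_autHom_eq_of_ne_zero hi hτ h' hA'
    refine ⟨(1, X)⁻¹ * z, ?_⟩
    rw [map_mul, map_inv, inv_mul_eq_iff_eq_mul, hz]
    rfl
  · exact exists_autHom_eq_of_ne_zero hi hσ h hA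

/-! ### The kernel -/

theorem autHom_neg_one (hi : i * i = -1) : autHom hi (-1, -1) = 1 := by
  refine Subtype.ext (eq_of_map_iota hi (autHom hi (-1, -1)).2 (one_mem _) fun r N v w _ => ?_)
  have hY : (-1 : SL(2, Shat k)).1 = -1 := rfl
  have hY' : ((-1 : SL(2, Shat k))⁻¹).1 = -1 := by
    rw [inv_neg, inv_one]
    rfl
  have hX : (-1 : SL(2, k)).1 = -1 := rfl
  have hm : (-1 : Matrix (Fin 2) (Fin 2) (Shat k)).map (ddt k) = 0 := by
    refine Matrix.ext fun a b => ?_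
    fin_cases a <;> fin_cases b <;> simp
  rw [autHom_apply_iota, hY, hY', hX, hm]
  change _ = iota (vec i r N v w)
  refine congrArg iota (vec_congr i rfl ?_ ?_ ?_)
  · simp
  · simp only [Matrix.neg_apply, Matrix.one_apply_eq,
      Matrix.one_apply_ne (zero_ne_one (α := Fin 2)),
      neg_zero, zero_smul, sub_zero, Matrix.transpose_neg, Matrix.transpose_one,
      Matrix.neg_mulVec, Matrix.one_mulVec, neg_smul, one_smul, neg_neg]
  · simp only [Matrix.neg_apply, Matrix.one_apply_eq,
      Matrix.one_apply_ne (one_ne_zero (α := Fin 2)),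
      neg_zero, zero_smul, zero_add,
      Matrix.neg_mulVec, Matrix.one_mulVec, neg_smul, one_smul, neg_neg]

theorem eq_of_autHom_eq_one (hi : i * i = -1) {Y : SL(2, Shat k)} {X : SL(2, k)}
    (hz : autHom hi (Y, X) = 1) (N : Matrix (Fin 2) (Fin 2) (Shat k)) (v w : Fin 2 → Shat k)
    (hN : N.trace = 0) : Y.1 * N * (Y⁻¹).1 = N ∧
      (Y⁻¹).1ᵀ *ᵥ (X.1 0 0 • v - X.1 0 1 • eps k *ᵥ w) = v ∧
      Y.1 *ᵥ (X.1 1 0 • (eps k *ᵥ v) + X.1 1 1 • w) = w := by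
  have e := autHom_apply_iota hi Y X 0 N v w
  rw [hz] at e
  have h1 : (Y.1 * N * (Y⁻¹).1).trace = 0 := by
    rw [Matrix.trace_mul_comm, ← Matrix.mul_assoc, SL_inv_mul, Matrix.one_mul, hN]
  rw [zero_smul, zero_add] at e
  have e2 := eq_of_vec_eq hi hN h1 (iota_injective e)
  exact ⟨e2.2.1.symm, e2.2.2.1.symm, e2.2.2.2.symm⟩

theorem eq_one_of_autHom_one_left (hi : i * i = -1) {X : SL(2, k)}
    (hz : autHom hi (1, X) = 1) : X = 1 := by
  have h1 : (1 : SL(2, Shat k)).1 = 1 := rfl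
  have key := eq_of_autHom_eq_one hi hz 0
  simp only [inv_one, h1, Matrix.transpose_one, Matrix.one_mulVec] at key
  obtain ⟨-, b1, b2⟩ := key (Pi.single 0 1) 0 (Matrix.trace_zero _ _)
  obtain ⟨-, b3, b4⟩ := key 0 (Pi.single 0 1) (Matrix.trace_zero _ _)
  have c1 := congrFun b1 0
  have c2 := congrFun b2 1
  have c3 := congrFun b3 1
  have c4 := congrFun b4 0
  simp only [Pi.sub_apply, Pi.add_apply, Pi.smul_apply, eps_mulVec_zero, eps_mulVec_one,
    Pi.zero_apply, Pi.single_eq_same, smul_eq_cst_mul, mul_one, mul_zero, sub_zero,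
    add_zero, zero_add, zero_sub, mul_neg, neg_neg, neg_eq_zero] at c1 c2 c3 c4
  have e1 : X.1 0 0 = 1 := cst_injective (c1.trans (map_one _).symm)
  have e2 : X.1 1 0 = 0 := cst_injective (c2.trans (map_zero _).symm)
  have e3 : X.1 0 1 = 0 := cst_injective (c3.trans (map_zero _).symm)
  have e4 : X.1 1 1 = 1 := cst_injective (c4.trans (map_one _).symm)
  refine Subtype.ext (Matrix.ext fun a b => ?_)
  fin_cases a <;> fin_cases b
  · exact e1
  · exact e3
  · exact e2
  · exact e4

/-- The trivial action on currents makes `Y` commute with `sl₂`, hence scalar; its determinant is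
one, and `Ŝ` is a domain. -/
theorem eq_one_or_eq_neg_one_of_autHom_eq_one (hi : i * i = -1) {Y : SL(2, Shat k)} {X : SL(2, k)}
    (hz : autHom hi (Y, X) = 1) : Y = 1 ∨ Y = -1 := by
  have hc : ∀ N : Matrix (Fin 2) (Fin 2) (Shat k), N.trace = 0 → Y.1 * N = N * Y.1 := by
    intro N hN
    conv_rhs => rw [← (eq_of_autHom_eq_one hi hz N 0 0 hN).1, Matrix.mul_assoc, SL_inv_mul,
      Matrix.mul_one]
  have entry : ∀ {P Q : Matrix (Fin 2) (Fin 2) (Shat k)}, P = Q → ∀ a b, P a b = Q a b :=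
    fun h a b => by rw [h]
  have a1 := entry (hc _ trace_E12) 0 0
  have a2 := entry (hc _ trace_E12) 0 1
  have a3 := entry (hc _ trace_E21) 0 0
  simp [Matrix.mul_apply, Fin.sum_univ_two] at a1 a2 a3
  have hdet := Y.2
  rw [Matrix.det_fin_two, ← a1, ← a2, mul_zero, sub_zero] at hdet
  rcases mul_self_eq_one_iff.1 hdet with h | h
  · refine Or.inl (Subtype.ext (Matrix.ext fun a b => ?_))
    fin_cases a <;> fin_cases b
    · exact h
    · exact a3
    · exact a1.symm
    · exact a2.symm.trans h
  · refine Or.inr (Subtype.ext (Matrix.ext fun a b => ?_))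
    fin_cases a <;> fin_cases b
    · exact h
    · exact a3.trans neg_zero.symm
    · exact a1.symm.trans neg_zero.symm
    · exact a2.symm.trans h

theorem ker_autHom (hi : i * i = -1) : (autHom hi).ker = signs k := by
  refine le_antisymm ?_ ?_
  · rintro ⟨Y, X⟩ hz
    rw [MonoidHom.mem_ker] at hz
    rcases eq_one_or_eq_neg_one_of_autHom_eq_one hi hz with rfl | rfl
    · rw [eq_one_of_autHom_one_left hi hz]
      exact one_mem _
    -- Factoring out the known kernel element reduces the case `Y = -1` to `Y = 1`.
    · have h : ((-1 : SL(2, Shat k)), X) = (-1, -1) * (1, -X) := by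
        refine Prod.ext ?_ ?_ <;> simp
      have hX : -X = 1 := by
        refine eq_one_of_autHom_one_left hi ?_
        rwa [h, map_mul, autHom_neg_one, one_mul] at hz
      rw [h, hX]
      exact mul_mem (Subgroup.mem_zpowers _) (one_mem _)
  · rw [signs, Subgroup.zpowers_le, MonoidHom.mem_ker]
    exact autHom_neg_one hi

end

/-! ### The formulas for the isomorphism -/

section

variable {k : Type*} [Field k] [CharZero k]

theorem gVec_zero : gVec (0 : Fin 2 → Shat k) = 0 := by
  simp [gVec]

theorem gbarVec_zero : gbarVec (0 : Fin 2 → Shat k) = 0 := by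
  simp [gbarVec]

theorem ofSl2_zero (i : k) : ofSl2 i 0 = 0 := by
  simp [ofSl2]

theorem gVec_smul (c : k) (v : Fin 2 → Shat k) : gVec (c • v) = c • gVec v := by
  simp only [gVec, Finset.smul_sum, Pi.smul_apply, TensorProduct.smul_tmul']

theorem gbarVec_smul (c : k) (v : Fin 2 → Shat k) : gbarVec (c • v) = c • gbarVec v := by
  simp only [gbarVec, Finset.smul_sum, Pi.smul_apply, TensorProduct.smul_tmul']

theorem gVec_single (a : Fin 2) : gVec (Pi.single a (1 : Shat k)) = 1 ⊗ₜ gen (.G a) := by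
  rw [gVec, Finset.sum_eq_single a]
  · rw [Pi.single_eq_same]
  · intro b _ hb
    rw [Pi.single_eq_of_ne hb, TensorProduct.zero_tmul]
  · simp

theorem gbarVec_single (a : Fin 2) : gbarVec (Pi.single a (1 : Shat k)) = 1 ⊗ₜ gen (.Gbar a) := by
  rw [gbarVec, Finset.sum_eq_single a]
  · rw [Pi.single_eq_same]
  · intro b _ hb
    rw [Pi.single_eq_of_ne hb, TensorProduct.zero_tmul]
  · simp

variable {i : k}

theorem iota_vec_L (i : k) : iota (vec i 1 0 0 0) = 1 ⊗ₜ gen .L := by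
  rw [iota_vec, ofSl2_zero, gVec_zero, gbarVec_zero, add_zero, add_zero, add_zero]

theorem iota_vec_Jmat (hi : i * i = -1) (s : Fin 3) :
    iota (vec i 0 ((Jmat i s).map (algebraMap k (Shat k))) 0 0) = 1 ⊗ₜ gen (.J s) := by
  rw [← iota_single, ← vec_coords hi (Pi.single (.J s) 1)]
  refine congrArg iota (vec_congr i ?_ ?_ ?_ ?_)
  · simp
  · rw [toMat, Finset.sum_eq_single s]
    · rw [Pi.single_eq_same, one_smul]
      rfl
    · intro t _ ht
      rw [Pi.single_eq_of_ne (by simpa using ht), zero_smul]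
    · simp
  · funext a
    simp
  · funext a
    simp

theorem iota_vec_G (i : k) (v : Fin 2 → Shat k) : iota (vec i 0 0 v 0) = gVec v := by
  rw [iota_vec, ofSl2_zero, gbarVec_zero, TensorProduct.zero_tmul, add_zero, add_zero, zero_add]

theorem iota_vec_Gbar (i : k) (v : Fin 2 → Shat k) : iota (vec i 0 0 0 v) = gbarVec v := by
  rw [iota_vec, ofSl2_zero, gVec_zero, TensorProduct.zero_tmul, add_zero, add_zero, zero_add]

theorem autHom_L (hi : i * i = -1) (Y : SL(2, Shat k)) (X : SL(2, k)) :
    (autHom hi (Y, X)).1 (1 ⊗ₜ gen .L)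
      = 1 ⊗ₜ gen .L + ofSl2 i (Y.1.map (ddt k) * (Y⁻¹).1) := by
  rw [← iota_vec_L i, autHom_apply_iota]
  simp only [smul_zero, Matrix.mulVec_zero, Matrix.mul_zero, Matrix.zero_mul, add_zero, sub_zero,
    one_smul]
  rw [iota_vec, iota_vec_L, gVec_zero, gbarVec_zero, add_zero, add_zero]

theorem autHom_J (hi : i * i = -1) (Y : SL(2, Shat k)) (X : SL(2, k)) (s : Fin 3) :
    (autHom hi (Y, X)).1 (1 ⊗ₜ gen (.J s))
      = ofSl2 i (Y.1 * (Jmat i s).map (algebraMap k (Shat k)) * (Y⁻¹).1) := by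
  rw [← iota_vec_Jmat hi, autHom_apply_iota]
  simp only [smul_zero, Matrix.mulVec_zero, add_zero, sub_zero, zero_smul, zero_add]
  rw [iota_vec, TensorProduct.zero_tmul, gVec_zero, gbarVec_zero, add_zero, add_zero, zero_add]

theorem autHom_gVec (hi : i * i = -1) (Y : SL(2, Shat k)) (X : SL(2, k)) (v : Fin 2 → Shat k) :
    (autHom hi (Y, X)).1 (gVec v)
      = X.1 0 0 • gVec ((Y⁻¹).1ᵀ *ᵥ v) + X.1 1 0 • gbarVec ((Y.1 * eps k) *ᵥ v) := by
  rw [← iota_vec_G i, autHom_apply_iota]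
  simp only [smul_zero, Matrix.mulVec_zero, Matrix.mul_zero, Matrix.zero_mul, add_zero, sub_zero,
    zero_smul]
  rw [iota_vec, TensorProduct.zero_tmul, ofSl2_zero, add_zero, zero_add, Matrix.mulVec_smul,
    Matrix.mulVec_smul, Matrix.mulVec_mulVec, gVec_smul, gbarVec_smul]

theorem autHom_gbarVec (hi : i * i = -1) (Y : SL(2, Shat k)) (X : SL(2, k)) (v : Fin 2 → Shat k) :
    (autHom hi (Y, X)).1 (gbarVec v)
      = (-X.1 0 1) • gVec (((Y⁻¹).1ᵀ * eps k) *ᵥ v) + X.1 1 1 • gbarVec (Y.1 *ᵥ v) := by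
  rw [← iota_vec_Gbar i, autHom_apply_iota]
  simp only [smul_zero, Matrix.mulVec_zero, Matrix.mul_zero, Matrix.zero_mul, add_zero, zero_sub,
    zero_add, zero_smul]
  rw [iota_vec, TensorProduct.zero_tmul, ofSl2_zero, add_zero, zero_add, ← neg_smul,
    Matrix.mulVec_smul, Matrix.mulVec_smul, Matrix.mulVec_mulVec, gVec_smul, gbarVec_smul]

theorem aut_ext {σ τ : Shat k ⊗[k] N4 k ≃ₗ[Shat k] Shat k ⊗[k] N4 k}
    (hσ : σ ∈ (n4Shat i).Aut) (hτ : τ ∈ (n4Shat i).Aut)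
    (hL : σ (1 ⊗ₜ gen .L) = τ (1 ⊗ₜ gen .L))
    (hJ : ∀ s, σ (1 ⊗ₜ gen (.J s)) = τ (1 ⊗ₜ gen (.J s)))
    (hG : ∀ v, σ (gVec v) = τ (gVec v)) (hG' : ∀ v, σ (gbarVec v) = τ (gbarVec v)) : σ = τ := by
  have := hom_ext_gen i (f := σ.toLinearMap) (g := τ.toLinearMap) hσ.2.2 hτ.2.2 fun u => by
    rcases u with _ | s | a | a
    · exact hL
    · exact hJ s
    · rw [← gVec_single]
      exact hG _
    · rw [← gbarVec_single]
      exact hG' _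
  exact LinearEquiv.ext fun x => LinearMap.congr_fun this x

/-- The isomorphism of `(SL₂(Ŝ) × SL₂(k)) / ⟨(-I, -I)⟩` with the automorphism group. -/
def autEquiv [IsAlgClosed k] (hi : i * i = -1) :
    (SL(2, Shat k) × SL(2, k)) ⧸ signs k ≃* (n4Shat i).Aut :=
  (QuotientGroup.quotientMulEquivOfEq (ker_autHom hi).symm).trans
    (QuotientGroup.quotientKerEquivOfSurjective (autHom hi) (autHom_surjective hi))

theorem autEquiv_mk [IsAlgClosed k] (hi : i * i = -1) (z : SL(2, Shat k) × SL(2, k)) :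
    autEquiv hi (QuotientGroup.mk z) = autHom hi z := rfl

end

end ConformalSuper

end

theorem proposition3p62 {k : Type*} [Field k] [IsAlgClosed k] [CharZero k]
    (i : k) (hi : i * i = -1) :
    ∃! Φ : (SL(2, Shat k) × SL(2, k)) ⧸ signs k ≃*
        ((n4 i).baseChange (ddt k)).Aut,
      ∀ (Y : SL(2, Shat k)) (X : SL(2, k)),
        let σ : Shat k ⊗[k] N4 k ≃ₗ[Shat k]
            Shat k ⊗[k] N4 k :=
          (Φ (QuotientGroup.mk (Y, X))).1
        let Ym : Matrix (Fin 2) (Fin 2) (Shat k) := Y.1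
        let Yinv : Matrix (Fin 2) (Fin 2) (Shat k) := (Y⁻¹).1
        let ε : Matrix (Fin 2) (Fin 2) (Shat k) := !![0, 1; -1, 0]
        let c : k := X.1 0 0
        let d : k := X.1 1 0
        let e : k := -X.1 0 1
        let f : k := X.1 1 1
        σ (1 ⊗ₜ[k] gen .L) = 1 ⊗ₜ[k] gen .L
            + ofSl2 i (Ym.map (ddt k) * Yinv) ∧
        (∀ s, σ (1 ⊗ₜ[k] gen (.J s)) = ofSl2 i
            (Ym * (Jmat i s).map (algebraMap k (Shat k)) * Yinv)) ∧
        (∀ v, σ (gVec v) = c • gVec (Yinvᵀ *ᵥ v)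
            + d • gbarVec ((Ym * ε) *ᵥ v)) ∧
        (∀ v, σ (gbarVec v) = e • gVec ((Yinvᵀ * ε) *ᵥ v)
            + f • gbarVec (Ym *ᵥ v)) := by
  refine ⟨autEquiv hi, fun Y X => ⟨autHom_L hi Y X, autHom_J hi Y X, autHom_gVec hi Y X,
    autHom_gbarVec hi Y X⟩, fun Ψ hΨ => MulEquiv.ext fun q => ?_⟩
  -- Uniqueness: every class has a representative, and the formulas prescribe the automorphism on
  -- all generators.
  obtain ⟨⟨Y, X⟩, rfl⟩ := QuotientGroup.mk_surjective q
  obtain ⟨hL, hJ, hG, hG'⟩ := hΨ Y X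
  rw [autEquiv_mk]
  exact Subtype.ext (aut_ext (Ψ _).2 (autHom hi (Y, X)).2 (hL.trans (autHom_L hi Y X).symm)
    (fun s => (hJ s).trans (autHom_J hi Y X s).symm)
    (fun v => (hG v).trans (autHom_gVec hi Y X v).symm)
    fun v => (hG' v).trans (autHom_gbarVec hi Y X v).symm)
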